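/- **Setting.** Let $Y\to X$ be a smooth fibre bundle with $\dim X=n$ and adapted coordinates $(x^\lambda,y^i)$, let $F^1\to X$ be a vector bundle, and let $E_k=E_k^0\oplus E_k^1\to X$, $0\le k\le N$, be graded vector bundles. Consider the graded commutative algebra of graded functions of finite jet order with local basis $(s^A,\bar s_A,\bar c_{r_0},\dots,\bar c_{r_N})$. Here $s^A=(y^i,c^a)$, with $y^i$ even and $c^a$ odd linear coordinates on $F^1$. The antifields $\bar s_A$ and $\bar c_{r_k}$ are fibre coordinates on the density-duals $V^*Y\otimes\bigwedge^nT^*X$, $F^{1*}\otimes\bigwedge^nT^*X$ and $E_k^*\otimes\bigwedge^nT^*X$; their parity is opposite to that of the fields, respectively of the parts of $E_k$, to which they are dual. The algebra is locally generated over the smooth functions of finitely many jet coordinates $x^\lambda,y^i_\Lambda$ by the jets $c^a_\Lambda,\bar s_{\Lambda A},\bar c_{\Lambda r_k}$. The antifield numbers are $\mathrm{Ant}[\bar s_A]=1$ and $\mathrm{Ant}[\bar c_{r_k}]=k+2$. Put $\bar c_{r_{-1}}=\bar s_A$ and $\omega=dx^1\wedge\dots\wedge dx^n$. Denote by $\mathcal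 P\{k\}_q$ ($k\ge -1$) the space of global graded densities $\Phi\,\omega$ of finite jet order and antifield number $q$ which involve antifields of stages $\le k$ only. Let $L=\mathcal L\omega$ be an even graded Lagrangian without antifields, with variational derivatives $\mathcal E_A=\sum_\Lambda(-1)^{|\Lambda|}d_\Lambda(\partial^\Lambda_A\mathcal L)$. Let $\bar\delta$ be the odd right graded derivation that commutes with the total derivatives $d_\lambda$, vanishes on $s^A$ and on all $\bar c_{r_k}$, $k\geq 0$, and has $\bar\delta\bar s_A=\mathcal E_A$. Let $\Delta_{r_k}\in$ the algebra with antifields of stage $\le k-1$ be elements of antifield number $k+1$ and of parity opposite to $\bar c_{r_k}$, which change like $\bar c_{r_k}$ under changes of charts, for $0\le k\le N$. Let $\delta_k$ ($-1\le k\le N$) be the odd right graded derivation that agrees with $\bar\delta$ on $s^A,\bar s_A$ and on the $\bar c_{r_j}$ with $j>k$, commutes with the $d_\lambda$, and has $\delta_k\bar c_{r_j}=\Delta_{r_j}$ for $0\le j\le k$; thus $\delta_{-1}=\bar\delta$. Suppose that the Koszul–Tate operator $\delta_N$ is nilpotent. Write $$\Delta_{r_k}=\sum_\Sigma\Delta_{r_k}^{r_{k-1},\Sigma}\,\bar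 c_{\Sigma r_{k-1}}+h_{r_k},$$ where $h_{r_k}$ involves antifields of stages $\le k-2$ only ($h_{r_0}=0$). **Homology regularity condition.** For each $-1\le k<N$, every $\delta_k$-cycle $\phi\in\mathcal P\{k\}_{k+3}$ is a $\delta_{k+1}$-boundary, $\phi=\delta_{k+1}\psi$ with $\psi\in\mathcal P\{k+1\}_{k+4}$. **Noether identities.** Each $\Phi\in\mathcal P\{k\}_{k+2}$, $0\le k\le N$, has the form $\Phi=G+H+\dots$ with $$G=\sum_\Lambda G^{r_k,\Lambda}\bar c_{\Lambda r_k}\omega,\qquad H=\sum_{\Xi,\Sigma}H^{(A,\Xi)(r_{k-1},\Sigma)}\bar s_{\Xi A}\bar c_{\Sigma r_{k-1}}\omega ,$$ where the remaining terms involve only antifields of stages $\le k-2$ (they are absent for $k=0$). The $k$-stage Noether identity for $G$ and $H$ is the equality $$\sum_\Lambda G^{r_k,\Lambda}\,d_\Lambda\Big(\sum_\Sigma\Delta_{r_k}^{r_{k-1},\Sigma}\bar c_{\Sigma r_{k-1}}\Big)\omega+\bar\delta\Big(\sum_{\Xi,\Sigma}H^{(A,\Xi)(r_{k-1},\Sigma)}\bar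 s_{\Xi A}\bar c_{\Sigma r_{k-1}}\omega\Big)=0.\qquad(*)$$ The Noether identity given by a $\delta_k$-cycle $\Phi\in\mathcal P\{k\}_{k+2}$ is called trivial if $\Phi=\delta_k\Psi$ for some $\Psi\in\mathcal P\{k\}_{k+3}$, or if $G=\bar\delta\Psi$ for some $\Psi\in\mathcal P\{k\}_{k+3}$. **Proposition.** Suppose that the homology regularity condition holds, and let $0\le k\le N$. 1. If $\Phi\in\mathcal P\{k\}_{k+2}$ is a $\delta_k$-cycle, then its summands $G$ and $H$ satisfy the $k$-stage Noether identity $(*)$. 2. Conversely, if global densities $G$ and $H$ of the above form satisfy $(*)$, then $(*)$ extends to a cycle condition: there is $\Psi\in\mathcal P\{k-1\}_{k+2}$ such that $\delta_k(G+H-\Psi)=0$ and such that the part of $\delta_k\Psi$ that depends on the $\bar c_{\Sigma r_{k-1}}$ vanishes, so that $\Psi$ does not contribute to $(*)$. 3. If the Noether identity given by a $\delta_k$-cycle $\Phi\in\mathcal P\{k\}_{k+2}$ is trivial, then $\Phi$ is a $\delta_k$-boundary, $\Phi=\delta_k\Psi$ with $\Psi\in\mathcal P\{k\}_{k+3}$.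 -/

import Mathlib

open scoped Manifold ContDiff

noncomputable section

namespace GradedLagrangian

/-! ### Free graded commutative algebras

`GrAlg par` is the free graded commutative real algebra on generators `g : G` of Grassmann parity
`par g` (read modulo 2): polynomial in the even generators, exterior in the odd ones. -/

/-- The relations `g h = (-1)^{[g][h]} h g` between generators. -/
inductive GrRel {G : Type*} (par : G → ℕ) : FreeAlgebra ℝ G → FreeAlgebra ℝ G → Prop
  | swap (g h : G) : GrRel par (FreeAlgebra.ι ℝ g * FreeAlgebra.ι ℝ h)
      ((-1 : ℝ) ^ (par g * par h) • (FreeAlgebra.ι ℝ h * FreeAlgebra.ι ℝ g))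

/-- The free graded commutative real algebra. -/
abbrev GrAlg {G : Type*} (par : G → ℕ) : Type _ := RingQuot (GrRel par)

namespace GrAlg

variable {G : Type*} {par : G → ℕ}

/-- The generators. -/
def gen (g : G) : GrAlg par := RingQuot.mkAlgHom ℝ (GrRel par) (FreeAlgebra.ι ℝ g)

theorem gen_mul_gen (g h : G) :
    (gen g * gen h : GrAlg par) = (-1 : ℝ) ^ (par g * par h) • (gen h * gen g) := by
  have := RingQuot.mkAlgHom_rel ℝ (GrRel.swap (par := par) g h)
  simpa [gen] using this

/-- The universal property of `GrAlg par`. -/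
def lift {B : Type*} [Semiring B] [Algebra ℝ B] (f : G → B)
    (hf : ∀ g h, f g * f h = (-1 : ℝ) ^ (par g * par h) • (f h * f g)) : GrAlg par →ₐ[ℝ] B :=
  RingQuot.liftAlgHom ℝ ⟨FreeAlgebra.lift ℝ f, by
    rintro _ _ ⟨g, h⟩
    simpa using hf g h⟩

@[simp] theorem lift_gen {B : Type*} [Semiring B] [Algebra ℝ B] (f : G → B)
    (hf : ∀ g h, f g * f h = (-1 : ℝ) ^ (par g * par h) • (f h * f g)) (g : G) :
    lift (par := par) f hf (gen g) = f g := by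
  simp [lift, gen]

/-- The parity involution, equal to `(-1)^{[x]} x` on homogeneous elements. -/
def invol : GrAlg par →ₐ[ℝ] GrAlg par :=
  lift (fun g => (-1 : ℝ) ^ par g • gen g) (fun g h => by
    rw [smul_mul_smul_comm, smul_mul_smul_comm, gen_mul_gen g h, smul_comm,
      mul_comm ((-1 : ℝ) ^ par g)])

theorem tri_comm {A : Type*} [Ring A] [Algebra ℝ A] {a b c a' b' c' : A} {s : ℝ}
    (ha : a * a' = s • (a' * a)) (hb : a * b' + b * c' = s • (a' * b + b' * c))
    (hc : c * c' = s • (c' * c)) :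
    !![a, b; 0, c] * !![a', b'; 0, c'] = s • (!![a', b'; 0, c'] * !![a, b; 0, c]) := by
  rw [Matrix.mul_fin_two, Matrix.mul_fin_two, Matrix.smul_of]
  simp [ha, hb, hc, Matrix.smul_cons]

theorem sign_sq (k : ℕ) : (-1 : ℝ) ^ k * (-1 : ℝ) ^ k = 1 := by
  rw [← mul_pow]; simp

open Classical in
/-- The algebra homomorphism `x ↦ [[(-1)^{[g][x]} x, ∂x/∂g], [0, x]]` into triangular matrices,
which encodes the left graded derivation `∂/∂g`. -/
def leftMat (g : G) : GrAlg par →ₐ[ℝ] Matrix (Fin 2) (Fin 2) (GrAlg par) :=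
  lift (fun h => !![(-1 : ℝ) ^ (par g * par h) • gen h, if h = g then 1 else 0; 0, gen h])
    (fun h k => by
      refine tri_comm ?_ ?_ (gen_mul_gen h k)
      · rw [smul_mul_smul_comm, smul_mul_smul_comm, gen_mul_gen h k, smul_comm,
          mul_comm ((-1 : ℝ) ^ (par g * par h))]
      · by_cases e : h = g <;> by_cases e' : k = g
        · rw [e, e']; simp only [if_true, mul_one, one_mul]
          rw [smul_add, smul_smul, sign_sq, one_smul, add_comm]
        · rw [e]; simp [e', smul_smul, sign_sq]
        · rw [e']; simp [e, mul_comm]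
        · simp [e, e'])

open Classical in
/-- The algebra homomorphism `x ↦ [[x, x∂/∂g], [0, (-1)^{[g][x]} x]]` into triangular matrices,
which encodes the right graded derivation by `g`. -/
def rightMat (g : G) : GrAlg par →ₐ[ℝ] Matrix (Fin 2) (Fin 2) (GrAlg par) :=
  lift (fun h => !![gen h, if h = g then 1 else 0; 0, (-1 : ℝ) ^ (par g * par h) • gen h])
    (fun h k => by
      refine tri_comm (gen_mul_gen h k) ?_ ?_
      · by_cases e : h = g <;> by_cases e' : k = g
        · rw [e, e']; simp only [if_true, mul_one, one_mul]
          rw [smul_add, smul_smul, sign_sq, one_smul, add_comm]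
        · rw [e]; simp [e']
        · rw [e']; simp [e, smul_smul, mul_comm (par h), sign_sq]
        · simp [e, e']
      · rw [smul_mul_smul_comm, smul_mul_smul_comm, gen_mul_gen h k, smul_comm,
          mul_comm ((-1 : ℝ) ^ (par g * par h))])

/-- The left graded partial derivative `∂x/∂g`. -/
def lpd (g : G) (x : GrAlg par) : GrAlg par := leftMat g x 0 1

/-- The right graded partial derivative of `x` by `g`. -/
def rpd (g : G) (x : GrAlg par) : GrAlg par := rightMat g x 0 1

/-- Given multidegrees `deg g` of the generators, the homomorphism `x ↦ ∑_d t^d x_d`, where `x_d` is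
the component of `x` of multidegree `d`. -/
def gradeHom {M : Type*} [AddCommMonoid M] (deg : G → M) :
    GrAlg par →ₐ[ℝ] AddMonoidAlgebra (GrAlg par) M :=
  lift (fun g => AddMonoidAlgebra.single (deg g) (gen g)) (fun g h => by
    rw [AddMonoidAlgebra.single_mul_single, AddMonoidAlgebra.single_mul_single, gen_mul_gen g h,
      AddMonoidAlgebra.smul_single, add_comm])

/-- The component of multidegree `d`. -/
def comp {M : Type*} [AddCommMonoid M] (deg : G → M) (d : M) (x : GrAlg par) : GrAlg par :=
  (gradeHom deg x).coeff d

end GrAlg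

open GrAlg

/-! ### Local objects: jets, graded functions, total derivatives -/

/-- Discrete data: `n = dim X`, fibre dimension `m` of `Y → X` (even fields `yⁱ`), rank `p` of
`F¹ → X` (odd fields `cᵃ`), the last stage `N`, and the ranks of the homogeneous parts
`E_k^0, E_k^1` of the graded vector bundles `E_0, …, E_N`. -/
structure Dims where
  n : ℕ
  m : ℕ
  p : ℕ
  N : ℕ
  rk : Fin (N + 1) → Fin 2 → ℕ

namespace Dims

variable (D : Dims)

/-- Base coordinates. -/
abbrev Base : Type := Fin D.n → ℝ

/-- Fibre coordinates of `Y → X`. -/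
abbrev Fib : Type := Fin D.m → ℝ

/-- Symmetric multi-indices `Λ`; `Λ l` is the multiplicity of `l`. -/
abbrev MI : Type := Fin D.n → ℕ

/-- Infinite order jets `(x^λ, y^i_Λ)` in coordinates. -/
abbrev Jet : Type := D.Base × (Fin D.m → D.MI → ℝ)

/-- The local generating basis besides `yⁱ`: the odd fields `cᵃ`, the antifields `s̄_i` and `s̄_a` of
`yⁱ` and `cᵃ`, and the `k`-stage Noether antifields `c̄_{r_k}`. -/
inductive Var (D : Dims) : Type
  | fieldOdd (a : Fin D.p)
  | antiEven (i : Fin D.m)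
  | antiOdd (a : Fin D.p)
  | noether (k : Fin (D.N + 1)) (ε : Fin 2) (r : Fin (D.rk k ε))

/-- Grassmann parity, read modulo 2. Antifields dual to a bundle of parity `ε` have parity `ε+1`. -/
def par : D.Var → ℕ
  | .fieldOdd _ => 1
  | .antiEven _ => 1
  | .antiOdd _ => 2
  | .noether _ ε _ => ε.val + 1

/-- Antifield number. -/
def ant : D.Var → ℕ
  | .fieldOdd _ => 0
  | .antiEven _ => 1
  | .antiOdd _ => 1
  | .noether k _ _ => k.val + 2

/-- The fibre algebra of graded functions, free on the jets `v_Λ` of the basis elements `v`. A graded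
function is locally a function of the jet coordinates with values in this algebra. -/
abbrev Alg : Type := GrAlg (fun g : D.Var × D.MI => D.par g.1)

variable {D}

/-- The generator `v_Λ`. -/
def jetGen (v : D.Var) (Λ : D.MI) : D.Alg := gen (v, Λ)

/-- The multidegree of a generator that counts generators of each positive antifield number. -/
def multideg (g : D.Var × D.MI) : ℕ →₀ ℕ :=
  if D.ant g.1 = 0 then 0 else Finsupp.single (D.ant g.1) 1

/-- The part of `x` which contains exactly `d a` factors of antifield number `a`, for each `a ≥ 1`. -/
def part (d : ℕ →₀ ℕ) (x : D.Alg) : D.Alg := comp multideg d x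

/-- `x` is an element of antifield number `q` of the algebra with antifields of stages `≤ k` only
(the antifields `s̄_A` have stage `-1`). -/
def IsPure (k q : ℤ) (x : D.Alg) : Prop :=
  ∀ d, part d x ≠ 0 →
    (∀ a ∈ d.support, (a : ℤ) ≤ k + 2) ∧ ((d.sum fun a c => a * c : ℕ) : ℤ) = q

end Dims

variable {D : Dims}

open Dims

/-- The derivative at `z` in the direction `v` of a function on jets with values in a real vector
space, computed on linear functionals. -/
def vderiv {W : Type*} [AddCommGroup W] [Module ℝ W] (f : D.Jet → W) (z v : D.Jet) : W :=
  open Classical in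
  if h : ∃ w : W, ∀ ℓ : Module.Dual ℝ W, HasDerivAt (fun t : ℝ => ℓ (f (z + t • v))) (ℓ w) 0
  then h.choose else 0

/-- The jets whose underlying point lies in `V`. -/
def jetDom (V : Set (D.Base × D.Fib)) : Set D.Jet := {z | (z.1, fun i => z.2 i 0) ∈ V}

/-- On the jets over `V`, the function `a` is a smooth function of finitely many jet coordinates
`y^i_Λ`, those with all entries of `Λ` at most `r`. -/
def IsSmoothOn (r : ℕ) (V : Set (D.Base × D.Fib)) (a : D.Jet → ℝ) : Prop :=
  ∃ g : D.Base × (Fin D.m → (Fin D.n → Fin (r + 1)) → ℝ) → ℝ,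
    ContDiffOn ℝ ∞ g {u | (u.1, fun i => u.2 i 0) ∈ V} ∧
    ∀ z ∈ jetDom V, a z = g (z.1, fun i Λ => z.2 i fun l => (Λ l : ℕ))

/-- Graded functions over `V` of bounded jet order (at most `r` in each direction): finite sums of
products of smooth functions as above and of polynomials in the generators `v_Λ`. -/
def IsGradedFunction (r : ℕ) (V : Set (D.Base × D.Fib)) (f : D.Jet → D.Alg) : Prop :=
  ∃ (M : ℕ) (a : Fin M → D.Jet → ℝ) (w : Fin M → D.Alg),
    (∀ i, IsSmoothOn r V (a i)) ∧
    (∀ i, w i ∈ Algebra.adjoin ℝ {x : D.Alg | ∃ v Λ, (∀ l, Λ l ≤ r) ∧ x = jetGen v Λ}) ∧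
    ∀ z ∈ jetDom V, f z = ∑ i, a i z • w i

/-- For operators `T_l`, the operator `T_Λ`, in which each `T_l` is applied `Λ l` times. -/
def multi {A : Type*} (T : Fin D.n → A → A) (Λ : D.MI) (f : A) : A :=
  (List.finRange D.n).foldr (fun l h => (T l)^[Λ l] h) f

/-- The part `∂_l + ∑ y^i_{l+Λ} ∂_i^Λ` of the total derivative. -/
def hderiv {W : Type*} [AddCommGroup W] [Module ℝ W] (l : Fin D.n) (f : D.Jet → W) : D.Jet → W :=
  fun z => vderiv f z (Pi.single l 1, fun i Λ => z.2 i (Λ + Pi.single l 1))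

/-- The total derivative `d_l = ∂_l + ∑ y^i_{l+Λ} ∂_i^Λ + ∑ v_{l+Λ} ∂_v^Λ`. -/
def tderiv (l : Fin D.n) (f : D.Jet → D.Alg) : D.Jet → D.Alg :=
  fun z => hderiv l f z +
    ∑ᶠ g : D.Var × D.MI, jetGen g.1 (g.2 + Pi.single l 1) * lpd g (f z)

/-- The partial derivative by the jet coordinate `y^i_Λ`. -/
def pdEven (i : Fin D.m) (Λ : D.MI) (f : D.Jet → D.Alg) : D.Jet → D.Alg :=
  fun z => vderiv f z (0, Pi.single i (Pi.single Λ 1))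

/-- The left partial derivative by the odd jet coordinate `c^a_Λ`. -/
def pdOdd (a : Fin D.p) (Λ : D.MI) (f : D.Jet → D.Alg) : D.Jet → D.Alg :=
  fun z => lpd (.fieldOdd a, Λ) (f z)

/-- `∑_Λ (-1)^{|Λ|} d_Λ (P^Λ)`. -/
def eulerSum (P : D.MI → D.Jet → D.Alg) : D.Jet → D.Alg :=
  fun z => ∑ᶠ Λ : D.MI, (-1 : ℝ) ^ (∑ l, Λ l) • multi tderiv Λ (P Λ) z

/-- The right derivation `f ↦ ∑ (f ∂_v^Λ) d_Λ(u_v)`, which commutes with total derivatives, sends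
`v` to `u_v` and vanishes on functions of `x^λ, y^i_Λ`. -/
def rightDer (u : D.Var → D.Jet → D.Alg) (f : D.Jet → D.Alg) : D.Jet → D.Alg :=
  fun z => ∑ᶠ g : D.Var × D.MI, rpd g (f z) * multi tderiv g.2 (u g.1) z

/-! ### Global objects -/

/-- A fibred manifold `Y → X` with vector bundles `F¹ → X` and `E_k = E_k^0 ⊕ E_k^1 → X`, `k ≤ N`,
given by their smooth transition functions. Each smooth fibre bundle `Y → X` has adapted charts
`(x^λ, y^i)` about each of its points. -/
structure Bundles (D : Dims) (X Y : Type*)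
    [TopologicalSpace X] [ChartedSpace D.Base X] [IsManifold 𝓘(ℝ, D.Base) ∞ X]
    [TopologicalSpace Y] [ChartedSpace (D.Base × D.Fib) Y]
    [IsManifold 𝓘(ℝ, D.Base × D.Fib) ∞ Y] where
  proj : Y → X
  proj_surjective : Function.Surjective proj
  exists_adapted : ∀ y : Y,
    ∃ eX ∈ IsManifold.maximalAtlas 𝓘(ℝ, D.Base) ∞ X,
    ∃ eY ∈ IsManifold.maximalAtlas 𝓘(ℝ, D.Base × D.Fib) ∞ Y,
      y ∈ eY.source ∧ ∀ y' ∈ eY.source, proj y' ∈ eX.source ∧ (eY y').1 = eX (proj y')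
  idxF : Type*
  F : VectorBundleCore ℝ X (Fin D.p → ℝ) idxF
  smoothF : F.IsContMDiff 𝓘(ℝ, D.Base) ∞
  idxE : Fin (D.N + 1) → Fin 2 → Type*
  E : ∀ k ε, VectorBundleCore ℝ X (Fin (D.rk k ε) → ℝ) (idxE k ε)
  smoothE : ∀ k ε, (E k ε).IsContMDiff 𝓘(ℝ, D.Base) ∞

section Global

variable {X Y : Type*}
  [TopologicalSpace X] [ChartedSpace D.Base X] [IsManifold 𝓘(ℝ, D.Base) ∞ X]
  [TopologicalSpace Y] [ChartedSpace (D.Base × D.Fib) Y]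
  [IsManifold 𝓘(ℝ, D.Base × D.Fib) ∞ Y]

/-- An adapted chart of `Y → X` together with trivializations of the vector bundles over it. -/
structure Chart (B : Bundles D X Y) where
  eX : OpenPartialHomeomorph X D.Base
  eX_mem : eX ∈ IsManifold.maximalAtlas 𝓘(ℝ, D.Base) ∞ X
  eY : OpenPartialHomeomorph Y (D.Base × D.Fib)
  eY_mem : eY ∈ IsManifold.maximalAtlas 𝓘(ℝ, D.Base × D.Fib) ∞ Y
  adapted : ∀ y ∈ eY.source, B.proj y ∈ eX.source ∧ (eY y).1 = eX (B.proj y)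
  iF : B.idxF
  memF : ∀ y ∈ eY.source, B.proj y ∈ B.F.baseSet iF
  iE : ∀ k ε, B.idxE k ε
  memE : ∀ k ε, ∀ y ∈ eY.source, B.proj y ∈ (B.E k ε).baseSet (iE k ε)

namespace Chart

variable {B : Bundles D X Y}

/-- The jets over a chart. -/
def dom (α : Chart B) : Set D.Jet := jetDom α.eY.target

/-- The point of `Y` under a jet. -/
def point (α : Chart B) (z : D.Jet) : Y := α.eY.symm (z.1, fun i => z.2 i 0)

/-- The jets of `α` over the overlap with `β`. -/
def overlap (α β : Chart B) : Set D.Jet := {z | z ∈ α.dom ∧ α.point z ∈ β.eY.source}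

/-- The coordinate change `x'(x)`. In what follows primes refer to `β`. -/
def baseMap (α β : Chart B) (x : D.Base) : D.Base := β.eX (α.eX.symm x)

/-- The coordinate change `y'(x, y)`. -/
def fibMap (α β : Chart B) (u : D.Base × D.Fib) : D.Fib := (β.eY (α.eY.symm u)).2

/-- The Jacobian `det (∂x'/∂x)`. -/
def jac (α β : Chart B) (x : D.Base) : ℝ := (fderiv ℝ (α.baseMap β) x).det

/-- The derivative `∂x^μ/∂x'^l` at the point `x'(x)`. -/
def invJac (α β : Chart B) (l μ : Fin D.n) (x : D.Base) : ℝ :=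
  fderiv ℝ (β.baseMap α) (α.baseMap β x) (Pi.single l 1) μ

/-- The total derivative `d'_l = (∂x^μ/∂x'^l) d_μ`, on functions of `x^λ, y^i_Λ`. -/
def scalarD (α β : Chart B) (l : Fin D.n) (f : D.Jet → ℝ) : D.Jet → ℝ :=
  fun z => ∑ μ, α.invJac β l μ z.1 * hderiv μ f z

/-- The total derivative `d'_l = (∂x^μ/∂x'^l) d_μ`, on graded functions. -/
def gradedD (α β : Chart B) (l : Fin D.n) (f : D.Jet → D.Alg) : D.Jet → D.Alg :=
  fun z => ∑ μ, α.invJac β l μ z.1 • tderiv μ f z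

/-- The change of jet coordinates `x' = x'(x)`, `y'^i_Λ = d'_Λ y'^i`. -/
def prolong (α β : Chart B) (z : D.Jet) : D.Jet :=
  (α.baseMap β z.1, fun i Λ =>
    multi (α.scalarD β) Λ (fun w => α.fibMap β (w.1, fun j => w.2 j 0) i) z)

/-- The transition law of the generating basis: `cᵃ` are coordinates on `F¹`, the antifields are
coordinates on the density-duals `V*Y ⊗ ⋀ⁿT*X`, `F¹* ⊗ ⋀ⁿT*X`, `E_k* ⊗ ⋀ⁿT*X`. In terms of
quantities `u v` that stand for the elements `v` of the basis of `α`, this is the expression for the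
element `v` of the basis of `β`. -/
def transl (α β : Chart B) (u : D.Var → D.Alg) (z : D.Jet) : D.Var → D.Alg
  | .fieldOdd a =>
      ∑ b, B.F.coordChange α.iF β.iF (B.proj (α.point z)) (Pi.single b 1) a • u (.fieldOdd b)
  | .antiEven i =>
      β.jac α (α.baseMap β z.1) • ∑ j,
        fderiv ℝ (β.fibMap α) (α.baseMap β z.1, α.fibMap β (z.1, fun j => z.2 j 0))
          (0, Pi.single i 1) j • u (.antiEven j)
  | .antiOdd a =>
      β.jac α (α.baseMap β z.1) • ∑ b,
        B.F.coordChange β.iF α.iF (B.proj (α.point z)) (Pi.single a 1) b • u (.antiOdd b)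
  | .noether k ε r =>
      β.jac α (α.baseMap β z.1) • ∑ s,
        (B.E k ε).coordChange (β.iE k ε) (α.iE k ε) (B.proj (α.point z)) (Pi.single r 1) s •
          u (.noether k ε s)

/-- `T` is the pull-back homomorphism of fibre algebras at the jet `z`: it sends each generator `v_Λ`
of `β` to `d'_Λ v'`, where `v'` is the expression of `v` in the chart `α`. -/
def IsPullback (α β : Chart B) (z : D.Jet) (T : D.Alg →ₐ[ℝ] D.Alg) : Prop :=
  ∀ v Λ, T (jetGen v Λ) =
    multi (α.gradedD β) Λ (fun w => α.transl β (fun v' => jetGen v' 0) w v) z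

end Chart

variable (B : Bundles D X Y)

/-- A family of local expressions, one in each chart. Only the values of `φ α` on `α.dom` matter. -/
abbrev Family : Type _ := Chart B → D.Jet → D.Alg

variable {B}

/-- The family `φ` consists of the local coefficients of a global graded density `φ ω`,
`ω = dx^1 ∧ … ∧ dx^n`, of finite jet order. -/
structure IsDensity (φ : Family B) : Prop where
  order : ∃ r, ∀ α : Chart B, IsGradedFunction r α.eY.target (φ α)
  glue : ∀ α β : Chart B, ∀ z ∈ α.overlap β, ∃ T : D.Alg →ₐ[ℝ] D.Alg,
    α.IsPullback β z T ∧ φ α z = α.jac β z.1 • T (φ β (α.prolong β z))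

/-- Equality of the densities given by two families. -/
def Same (φ ψ : Family B) : Prop := ∀ α : Chart B, ∀ z ∈ α.dom, φ α z = ψ α z

/-- The `q`-chains of stage `k`: the graded densities of antifield number `q` which involve antifields
of stages `≤ k` only. For `k = -1` the only antifields are the `s̄_A`; for `q = 0` one obtains
the graded densities without antifields. -/
structure IsChain (k q : ℤ) (φ : Family B) : Prop where
  density : IsDensity φ
  pure : ∀ α : Chart B, ∀ z ∈ α.dom, IsPure k q (φ α z)

/-- The part of a family of multidegree `d`. -/
def Family.part (d : ℕ →₀ ℕ) (φ : Family B) : Family B := fun α z => Dims.part d (φ α z)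

variable (B) in
/-- An even graded Lagrangian `L = 𝓛 ω`. -/
structure Lagrangian where
  L : Family B
  chain : IsChain (-1) 0 L
  even : ∀ α : Chart B, ∀ z ∈ α.dom, invol (L α z) = L α z

/-- The values `s̄_A ↦ 𝓔_A = ∑ (-1)^{|Λ|} d_Λ (∂_A^Λ 𝓛)` (the variational derivatives of `L`) and
`c̄_{r_k} ↦ Δ_{r_k}`, restricted to the antifields of stage `≤ k`. -/
def source (S : Lagrangian B) (Δ : Chart B → ∀ (k : Fin (D.N + 1)) (ε : Fin 2),
    Fin (D.rk k ε) → D.Jet → D.Alg) (k : ℤ) (α : Chart B) : D.Var → D.Jet → D.Alg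
  | .fieldOdd _ => 0
  | .antiEven i => eulerSum fun Λ => pdEven i Λ (S.L α)
  | .antiOdd a => eulerSum fun Λ => pdOdd a Λ (S.L α)
  | .noether j ε r => if (j.val : ℤ) ≤ k then Δ α j ε r else 0

/-- A Koszul–Tate operator `δ_N = δ̄ + ∑ ∂^{r_k} Δ_{r_k}` of the Lagrangian system: elements
`Δ_{r_k}` of antifield number `k + 1` and of stage `≤ k - 1`, of parity opposite to `c̄_{r_k}`, which
change like `c̄_{r_k}` under a change of charts, such that the right derivation `δ_N` is nilpotent. -/
structure KoszulTate (S : Lagrangian B) where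
  Δ : Chart B → ∀ (k : Fin (D.N + 1)) (ε : Fin 2), Fin (D.rk k ε) → D.Jet → D.Alg
  order : ∃ s, ∀ α k ε r, IsGradedFunction s α.eY.target (Δ α k ε r)
  glue : ∀ α β : Chart B, ∀ z ∈ α.overlap β, ∃ T : D.Alg →ₐ[ℝ] D.Alg,
    α.IsPullback β z T ∧ ∀ k ε r, T (Δ β k ε r (α.prolong β z)) =
      α.transl β (fun v => source S Δ D.N α v z) z (.noether k ε r)
  pure : ∀ α k ε r, ∀ z ∈ α.dom, IsPure ((k.val : ℤ) - 1) ((k.val : ℤ) + 1) (Δ α k ε r z)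
  parity : ∀ α k ε r, ∀ z ∈ α.dom,
    invol (Δ α k ε r z) = (-1 : ℝ) ^ (D.par (.noether k ε r) + 1) • Δ α k ε r z
  nilpotent : ∀ α : Chart B, ∀ f : D.Jet → D.Alg, ∀ z ∈ α.dom,
    rightDer (source S Δ D.N α) (rightDer (source S Δ D.N α) f) z = 0

namespace KoszulTate

variable {S : Lagrangian B} (K : KoszulTate S)

/-- The operator `δ_k = δ̄ + ∑_{j ≤ k} ∂^{r_j} Δ_{r_j}`; in particular `δ_{-1} = δ̄`. -/
def δ (k : ℤ) (φ : Family B) : Family B := fun α => rightDer (source S K.Δ k α) (φ α)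

/-- `φ` is a `δ_k`-cycle. -/
def IsCycle (k : ℤ) (φ : Family B) : Prop := Same (K.δ k φ) 0

/-- The `q`-chain `φ` is a `δ_k`-boundary of a `(q+1)`-chain of stage `k`. -/
def IsBoundary (k q : ℤ) (φ : Family B) : Prop :=
  ∃ ψ : Family B, IsChain k (q + 1) ψ ∧ Same φ (K.δ k ψ)

/-- The homology regularity condition: for `-1 ≤ k < N`, each `δ_k`-cycle of stage `k` and antifield
number `k + 3` is a `δ_{k+1}`-boundary. -/
def HomologyRegular : Prop :=
  ∀ k : ℤ, -1 ≤ k → k < D.N → ∀ φ : Family B, IsChain k (k + 3) φ →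
    K.IsCycle k φ → K.IsBoundary (k + 1) (k + 3) φ

/-- The part `∑ Δ_{r_k}^{r_{k-1},Σ} c̄_{Σ r_{k-1}}` of `Δ_{r_k}` (with `c̄_{r_{-1}} = s̄_A`) as the value
at `c̄_{r_k}`; the value at the other elements of the basis is zero. -/
def linSource (k : ℕ) (α : Chart B) : D.Var → D.Jet → D.Alg
  | .noether j ε r =>
      if j.val = k then fun z => Dims.part (Finsupp.single (k + 1) 1) (K.Δ α j ε r z) else 0
  | _ => 0

end KoszulTate

/-- The summand `G = ∑ G^{r_k,Λ} c̄_{Λ r_k} ω` of a chain. -/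
def Gpart (k : ℕ) (φ : Family B) : Family B := φ.part (Finsupp.single (k + 2) 1)

/-- The summand `∑ H^{(A,Ξ)(r_{k-1},Σ)} s̄_{ΞA} c̄_{Σ r_{k-1}} ω` of a chain, where
`c̄_{r_{-1}} = s̄_A`. -/
def Hpart (k : ℕ) (φ : Family B) : Family B :=
  φ.part (Finsupp.single 1 1 + Finsupp.single (k + 1) 1)

namespace KoszulTate

variable {S : Lagrangian B} (K : KoszulTate S)

/-- The `k`-stage Noether identity
`∑ G^{r_k,Λ} d_Λ(∑ Δ_{r_k}^{r_{k-1},Σ} c̄_{Σ r_{k-1}}) ω + δ̄(∑ H^{(A,Ξ)(r_{k-1},Σ)} s̄_{ΞA} c̄_{Σ r_{k-1}} ω) = 0`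
for the summands of the chain `φ`. -/
def IsNoetherIdentity (k : ℕ) (φ : Family B) : Prop :=
  Same (fun α z => rightDer (K.linSource k α) (Gpart k φ α) z + K.δ (-1) (Hpart k φ) α z) 0

/-- The `k`-stage Noether identity given by a `δ_k`-cycle `φ` is trivial: `φ` is a `δ_k`-boundary or its
summand `G` is `δ̄`-exact. -/
def IsTrivialIdentity (k : ℕ) (φ : Family B) : Prop :=
  K.IsBoundary k (k + 2) φ ∨
    ∃ ψ : Family B, IsChain k (k + 3) ψ ∧ Same (Gpart k φ) (K.δ (-1) ψ)

end KoszulTate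

end Global

end GradedLagrangian

end

/-! The fibre algebra is graded by multidegrees, which count the antifields of each antifield
number, and the theorem follows from keeping track of the multidegrees that the derivations can
reach. The antifields s̄_A have antifield number 1 and c̄_{r_k} has k + 2. So in a density of stage
≤ k and antifield number k + 2 an antifield of top stage uses up the whole antifield number: it
stands alone, in the summand G (`eq_single_of_weight`, `mem_pureSet_of_ne_single`).

Statement 1. Take the component of δ_k Φ that is linear in the antifields of stage k - 1. Such a
term arises in two ways only: the single antifield of a term of G is replaced by the linear part of
Δ_{r_k}, or the factor s̄_A of a term of H is replaced by the variational derivative. So this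
component is the left-hand side of (*), which is `KoszulTate.comp_δ`, and it vanishes for a cycle.

Statement 2. Modulo (*), what is left of δ_k(G + H) is a density σ, made of h_{r_k} acting through G
and of Δ_{r_{k-1}} acting through H. It has stage ≤ k - 2 and antifield number k + 1. Nilpotency
makes σ a cycle, and homology regularity at stage k - 2 writes it as a boundary of some Ψ. For k = 0
no antifield is left, while the antifield number is 1, so σ = 0.

Statement 3. If G = δ̄Ψ, one may keep only the part of Ψ bilinear in s̄_A and c̄_{r_k}. Then Φ - δ_k
Ψ is a cycle of stage ≤ k - 1, and homology regularity at stage k - 1 makes it a boundary.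

Homology regularity concerns global densities, so σ has to be global; this takes up most of the
file. An odd derivation whose values change like the basis preserves densities
(`Chart.derAt_pullback`, `KoszulTate.isDensity_derFam`), because derivations commute with total
derivatives (`IsGradedFunction.tderiv_rightDer`) and total derivatives are natural under prolonged
coordinate changes (`Chart.scalarD_comp_prolong`, `Chart.gradedD_pullback_comp`). In both arguments
σ is written with derivations built from the Δ alone, δ̄ having been eliminated by (*) or by G =
δ̄Ψ; covariance of the variational derivatives is therefore never needed. -/

noncomputable section

namespace GradedLagrangian

/-! ### Free graded commutative algebras: monomials and induction -/

namespace GrAlg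

variable {G : Type*} {par : G → ℕ}

theorem hom_ext {B : Type*} [Semiring B] [Algebra ℝ B] {f g : GrAlg par →ₐ[ℝ] B}
    (h : ∀ x, f (gen x) = g (gen x)) : f = g := by
  apply RingQuot.ringQuot_ext'
  apply FreeAlgebra.hom_ext
  funext x
  exact h x

theorem adjoin_gen : Algebra.adjoin ℝ (Set.range (gen : G → GrAlg par)) = ⊤ := by
  have h : Set.range (gen : G → GrAlg par) =
      RingQuot.mkAlgHom ℝ (GrRel par) '' Set.range (FreeAlgebra.ι ℝ) := by
    rw [← Set.range_comp]; rfl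
  rw [h, ← AlgHom.map_adjoin, FreeAlgebra.adjoin_range_ι, Algebra.map_top]
  exact (AlgHom.range_eq_top _).2 (RingQuot.mkAlgHom_surjective ℝ _)

/-- The monomial with the given list of factors. -/
def mono (l : List G) : GrAlg par := (l.map gen).prod

@[simp] theorem mono_nil : (mono [] : GrAlg par) = 1 := rfl

@[simp] theorem mono_cons (g : G) (l : List G) : (mono (g :: l) : GrAlg par) = gen g * mono l := by
  simp [mono]

/-- Linear statements can thus be tested on monomials, where degrees and parities are explicit. -/
theorem span_mono : Submodule.span ℝ (Set.range (mono : List G → GrAlg par)) = ⊤ := by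
  rw [eq_top_iff, ← Algebra.top_toSubmodule, ← adjoin_gen, Algebra.adjoin_eq_span]
  apply Submodule.span_mono
  intro x hx
  induction hx using Submonoid.closure_induction_left with
  | one => exact ⟨[], rfl⟩
  | mul_left x hx y _ h =>
    obtain ⟨g, rfl⟩ := hx
    obtain ⟨l, rfl⟩ := h
    exact ⟨g :: l, by simp⟩

theorem mem_of_mono {p : Submodule ℝ (GrAlg par)} (h : ∀ l, mono l ∈ p) (x : GrAlg par) : x ∈ p := by
  have : (⊤ : Submodule ℝ (GrAlg par)) ≤ p := by
    rw [← span_mono, Submodule.span_le]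
    rintro _ ⟨l, rfl⟩
    exact h l
  exact this trivial

theorem linearMap_ext {W : Type*} [AddCommGroup W] [Module ℝ W] {f g : GrAlg par →ₗ[ℝ] W}
    (h : ∀ l, f (mono l) = g (mono l)) : f = g := by
  ext x
  exact mem_of_mono (p := LinearMap.eqLocus f g) h x

@[elab_as_elim]
theorem induction {P : GrAlg par → Prop} (hc : ∀ r : ℝ, P (algebraMap ℝ _ r))
    (hg : ∀ g, P (gen g)) (ha : ∀ x y, P x → P y → P (x + y)) (hm : ∀ x y, P x → P y → P (x * y))
    (x : GrAlg par) : P x := by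
  have : x ∈ Algebra.adjoin ℝ (Set.range (gen : G → GrAlg par)) := by rw [adjoin_gen]; trivial
  induction this using Algebra.adjoin_induction with
  | mem x hx => obtain ⟨g, rfl⟩ := hx; exact hg g
  | algebraMap r => exact hc r
  | add x y _ _ hx hy => exact ha x y hx hy
  | mul x y _ _ hx hy => exact hm x y hx hy

/-- The augmentation that kills all generators separates 1 from 0. Later this lets a real function
be recovered from its multiple of the unit (`Chart.scalarD_comm`). -/
instance : Nontrivial (GrAlg par) := by
  let f : GrAlg par →ₐ[ℝ] ℝ := lift (fun _ => 0) (by simp)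
  refine ⟨⟨1, 0, fun h => ?_⟩⟩
  have := congrArg f h
  simp at this

/-! #### Multidegrees -/

section Degree

variable {M : Type*} [AddCommMonoid M] {deg : G → M}

/-- The component of multidegree `d` as a linear map. -/
def compL (deg : G → M) (d : M) : GrAlg par →ₗ[ℝ] GrAlg par where
  toFun := comp deg d
  map_add' x y := by simp [comp]
  map_smul' r x := by simp [comp]

@[simp] theorem compL_apply (d : M) (x : GrAlg par) : compL deg d x = comp deg d x := rfl

theorem comp_add (d : M) (x y : GrAlg par) : comp deg d (x + y) = comp deg d x + comp deg d y :=
  (compL deg d).map_add x y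

theorem comp_sub (d : M) (x y : GrAlg par) : comp deg d (x - y) = comp deg d x - comp deg d y :=
  (compL deg d).map_sub x y

theorem comp_smul (d : M) (r : ℝ) (x : GrAlg par) : comp deg d (r • x) = r • comp deg d x :=
  (compL deg d).map_smul r x

@[simp] theorem comp_zero (d : M) : comp deg d (0 : GrAlg par) = 0 := (compL deg d).map_zero

theorem gradeHom_mono (l : List G) :
    gradeHom deg (mono l : GrAlg par) = AddMonoidAlgebra.single (l.map deg).sum (mono l) := by
  induction l with
  | nil => simp [AddMonoidAlgebra.one_def]
  | cons g l ih =>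
    rw [mono_cons, map_mul, ih, gradeHom, lift_gen, AddMonoidAlgebra.single_mul_single]
    simp

open Classical in
theorem comp_mono (d : M) (l : List G) :
    comp deg d (mono l : GrAlg par) = if (l.map deg).sum = d then mono l else 0 := by
  rw [comp, gradeHom_mono, AddMonoidAlgebra.coeff_single, Finsupp.single_apply]

/-- Setting the grading variables of `gradeHom` equal to 1 gives the identity, as one sees on
monomials. -/
theorem sum_comp (x : GrAlg par) :
    ∑ d ∈ (gradeHom deg x).coeff.support, comp deg d x = x := by
  have h : ∀ x : GrAlg par, (gradeHom deg x).coeff.sum (fun _ y => y) = x := by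
    intro x
    let s : GrAlg par →ₗ[ℝ] GrAlg par :=
      { toFun := fun x => (gradeHom deg x).coeff.sum (fun _ y => y)
        map_add' := fun x y => by
          rw [map_add, AddMonoidAlgebra.coeff_add]
          exact Finsupp.sum_add_index' (by simp) (by simp)
        map_smul' := fun r x => by
          rw [map_smul, AddMonoidAlgebra.coeff_smul, Finsupp.sum_smul_index' (by simp),
            RingHom.id_apply, Finsupp.smul_sum] }
    have : s = LinearMap.id := linearMap_ext fun l => by
      change (gradeHom deg (mono l : GrAlg par)).coeff.sum (fun _ y => y) = _
      rw [gradeHom_mono]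
      simp
    exact LinearMap.congr_fun this x
  exact h x

/-- The elements whose nonzero components have multidegree in `p`. -/
def degSub (deg : G → M) (p : Set M) : Submodule ℝ (GrAlg par) where
  carrier := {x | ∀ d, comp deg d x ≠ 0 → d ∈ p}
  zero_mem' := by simp
  add_mem' {x y} hx hy d h := by
    by_contra hd
    refine h ?_
    rw [comp_add, not_not.1 (mt (hx d) hd), not_not.1 (mt (hy d) hd), add_zero]
  smul_mem' r x hx d h := hx d fun h' => h (by rw [comp_smul, h', smul_zero])

theorem degSub_le {p q : Set M} (h : p ⊆ q) : (degSub deg p : Submodule ℝ (GrAlg par)) ≤ degSub deg q :=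
  fun _ hx d hd => h (hx d hd)

theorem mono_mem_degSub {p : Set M} {l : List G} (h : (l.map deg).sum ∈ p) :
    (mono l : GrAlg par) ∈ degSub deg p := by
  classical
  intro d hd
  rw [comp_mono] at hd
  by_cases e : (l.map deg).sum = d
  · exact e ▸ h
  · simp [e] at hd

theorem comp_mem_span (d : M) (x : GrAlg par) :
    comp deg d x ∈ Submodule.span ℝ (mono '' {l | (l.map deg).sum = d}) := by
  classical
  refine mem_of_mono (p := (Submodule.span ℝ (mono '' {l | (l.map deg).sum = d})).comap
    (compL deg d)) (fun l => ?_) x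
  rw [Submodule.mem_comap, compL_apply, comp_mono]
  split_ifs with h
  · exact Submodule.subset_span ⟨l, h, rfl⟩
  · exact zero_mem _

/-- Each component is spanned by monomials of its own multidegree. Hence degree estimates for
products and for linear maps need only be made on monomials. -/
theorem degSub_eq_span (p : Set M) :
    (degSub deg p : Submodule ℝ (GrAlg par)) =
      Submodule.span ℝ (mono '' {l | (l.map deg).sum ∈ p}) := by
  apply le_antisymm
  · intro x hx
    rw [← sum_comp (deg := deg) x]
    refine Submodule.sum_mem _ fun d hd => ?_
    have hd' : d ∈ p := hx d (by simpa [comp] using hd)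
    refine Submodule.span_mono ?_ (comp_mem_span d x)
    rintro _ ⟨l, hl, rfl⟩
    exact ⟨l, by rw [Set.mem_ofPred_eq, show (l.map deg).sum = d from hl]; exact hd', rfl⟩
  · rw [Submodule.span_le]
    rintro _ ⟨l, hl, rfl⟩
    exact mono_mem_degSub hl

theorem comp_mem_degSub (d : M) (x : GrAlg par) : comp deg d x ∈ degSub deg ({d} : Set M) := by
  rw [degSub_eq_span]
  exact comp_mem_span d x

theorem comp_of_mem {d : M} {x : GrAlg par} (h : x ∈ degSub deg ({d} : Set M)) :
    comp deg d x = x := by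
  classical
  have h2 := sum_comp (deg := deg) x
  rw [Finset.sum_subset_zero_on_sdiff (s₂ := (gradeHom deg x).coeff.support ∪ {d})
    (g := fun e => comp deg e x) Finset.subset_union_left] at h2
  · rw [Finset.sum_eq_single d] at h2
    · exact h2
    · intro e _ hne
      by_contra hc
      exact hne (h e hc)
    · intro hd; simp at hd
  · intro e he
    simpa [comp] using (Finset.mem_sdiff.1 he).2
  · intros; rfl

theorem comp_of_not_mem {p : Set M} {d : M} {x : GrAlg par} (h : x ∈ degSub deg p) (hd : d ∉ p) :
    comp deg d x = 0 := by
  by_contra hc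
  exact hd (h d hc)

theorem mul_mem_degSub {p q r : Set M} {x y : GrAlg par} (hx : x ∈ degSub deg p)
    (hy : y ∈ degSub deg q) (h : ∀ a ∈ p, ∀ b ∈ q, a + b ∈ r) : x * y ∈ degSub deg r := by
  rw [degSub_eq_span] at hx hy
  refine Submodule.span_induction₂ (p := fun x y _ _ => x * y ∈ degSub deg r) ?_ ?_ ?_ ?_ ?_ ?_ ?_
    hx hy
  · rintro _ _ ⟨l, hl, rfl⟩ ⟨l', hl', rfl⟩
    have : (mono l * mono l' : GrAlg par) = mono (l ++ l') := by simp [mono]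
    rw [this]
    apply mono_mem_degSub
    rw [List.map_append, List.sum_append]
    exact h _ hl _ hl'
  · intros; simp
  · intros; simp
  · intro x y z _ _ _ hx hy; rw [add_mul]; exact add_mem hx hy
  · intro x y z _ _ _ hx hy; rw [mul_add]; exact add_mem hx hy
  · intro r x y _ _ h; rw [smul_mul_assoc]; exact Submodule.smul_mem _ _ h
  · intro r x y _ _ h; rw [mul_smul_comm]; exact Submodule.smul_mem _ _ h

theorem gen_mem_degSub (g : G) : (gen g : GrAlg par) ∈ degSub deg ({deg g} : Set M) := by
  have := mono_mem_degSub (par := par) (deg := deg) (p := {deg g}) (l := [g]) (by simp)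
  simpa using this

theorem map_mem_degSub {F : GrAlg par →ₗ[ℝ] GrAlg par} {p q : Set M}
    (h : ∀ l : List G, (l.map deg).sum ∈ p → F (mono l) ∈ degSub deg q) {x : GrAlg par}
    (hx : x ∈ degSub deg p) : F x ∈ degSub deg q := by
  rw [degSub_eq_span] at hx
  have : Submodule.span ℝ (mono '' {l | (l.map deg).sum ∈ p}) ≤
      (degSub deg q : Submodule ℝ (GrAlg par)).comap F := by
    rw [Submodule.span_le]
    rintro _ ⟨l, hl, rfl⟩
    exact h l hl
  exact this hx

/-- On a monomial both sides survive for the same multidegree, by cancellation of `c`. The shift is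
zero for total derivatives and pull-backs, and one factor s̄_A for δ̄. -/
theorem comp_map_of_shift [IsRightCancelAdd M] (F : GrAlg par →ₗ[ℝ] GrAlg par) (c : M)
    (hF : ∀ l : List G, F (mono l) ∈ degSub deg {d | d + c = (l.map deg).sum}) (d : M)
    (x : GrAlg par) : comp deg d (F x) = F (comp deg (d + c) x) := by
  have : (compL deg d).comp F = F.comp (compL deg (d + c)) := linearMap_ext fun l => by
    classical
    simp only [LinearMap.comp_apply, compL_apply, comp_mono]
    split_ifs with h
    · apply comp_of_mem
      refine degSub_le ?_ (hF l)
      rw [h]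
      intro e he
      exact add_right_cancel he
    · rw [map_zero]
      exact comp_of_not_mem (hF l) fun e => h e.symm
  exact LinearMap.congr_fun this x

end Degree

/-! #### Signs -/

/-- The automorphism `x ↦ (-1)^{e[x]} x`. -/
def tau (e : ℕ) : GrAlg par →ₐ[ℝ] GrAlg par :=
  lift (fun h => (-1 : ℝ) ^ (e * par h) • gen h) (fun g h => by
    rw [smul_mul_smul_comm, smul_mul_smul_comm, gen_mul_gen g h, smul_comm,
      mul_comm ((-1 : ℝ) ^ (e * par g))])

@[simp] theorem tau_gen (e : ℕ) (g : G) :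
    tau e (gen g : GrAlg par) = (-1 : ℝ) ^ (e * par g) • gen g := by simp [tau]

theorem invol_gen (g : G) : invol (gen g : GrAlg par) = (-1 : ℝ) ^ par g • gen g := by simp [invol]

theorem tau_one : tau 1 = (invol : GrAlg par →ₐ[ℝ] GrAlg par) :=
  hom_ext fun g => by simp [invol_gen]

theorem tau_congr {e f : ℕ} (h : (-1 : ℝ) ^ e = (-1) ^ f) :
    tau e = (tau f : GrAlg par →ₐ[ℝ] GrAlg par) :=
  hom_ext fun g => by simp [pow_mul, h]

theorem tau_zero (x : GrAlg par) : tau 0 x = x := by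
  have : tau 0 = AlgHom.id ℝ (GrAlg par) := hom_ext fun g => by simp
  rw [this]; rfl

theorem tau_add (e f : ℕ) (x : GrAlg par) : tau (e + f) x = tau e (tau f x) := by
  have : tau (e + f) = (tau e).comp (tau f : GrAlg par →ₐ[ℝ] GrAlg par) :=
    hom_ext fun g => by simp [add_mul, pow_add, smul_smul, mul_comm ((-1 : ℝ) ^ (f * par g))]
  rw [this]; rfl

theorem tau_tau (e : ℕ) (x : GrAlg par) : tau e (tau e x) = x := by
  rw [← tau_add, ← two_mul, tau_congr (f := 0) (by simp [pow_mul]), tau_zero]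

theorem tau_invol (e : ℕ) (x : GrAlg par) : tau e (invol x) = invol (tau e x) := by
  rw [← tau_one, ← tau_add, ← tau_add, add_comm]

theorem gen_mul (g : G) (y : GrAlg par) : gen g * y = tau (par g) y * gen g := by
  induction y using GrAlg.induction with
  | hc r => simp [Algebra.commutes]
  | hg h => simp [gen_mul_gen g h]
  | ha x y hx hy => simp [mul_add, add_mul, hx, hy]
  | hm x y hx hy => rw [← mul_assoc, hx, mul_assoc, hy, map_mul, mul_assoc]

theorem mono_mul (l : List G) (y : GrAlg par) :
    mono l * y = tau (l.map par).sum y * mono l := by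
  induction l with
  | nil => simp [tau_zero]
  | cons g l ih =>
    rw [mono_cons, mul_assoc, ih, ← mul_assoc, gen_mul, List.map_cons, List.sum_cons, tau_add,
      mul_assoc]

theorem tau_mono (e : ℕ) (l : List G) :
    tau e (mono l : GrAlg par) = (-1 : ℝ) ^ (e * (l.map par).sum) • mono l := by
  induction l with
  | nil => simp
  | cons g l ih => simp [ih, mul_add, pow_add, smul_smul, mul_comm]

theorem invol_mono (l : List G) :
    invol (mono l : GrAlg par) = (-1 : ℝ) ^ (l.map par).sum • mono l := by
  rw [← tau_one, tau_mono, one_mul]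

/-- The homogeneous elements of parity `e`. -/
def parSub (e : ℕ) : Submodule ℝ (GrAlg par) :=
  LinearMap.eqLocus (invol : GrAlg par →ₐ[ℝ] GrAlg par).toLinearMap ((-1 : ℝ) ^ e • LinearMap.id)

theorem mem_parSub {e : ℕ} {x : GrAlg par} : x ∈ parSub e ↔ invol x = (-1 : ℝ) ^ e • x := Iff.rfl

theorem gen_mem_parSub (g : G) : (gen g : GrAlg par) ∈ parSub (par g) := invol_gen g

/-- The operator x ↦ x + (-1)^e `invol` x kills the monomials of the wrong parity and doubles the
others, for which the sign rule is `mono_mul`. On a homogeneous element of parity e it is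
multiplication by 2. -/
theorem mul_comm_of_mem_parSub {e : ℕ} {x : GrAlg par} (hx : x ∈ parSub e) (y : GrAlg par) :
    x * y = tau e y * x := by
  have key : ∀ x : GrAlg par, (x + (-1 : ℝ) ^ e • invol x) * y =
      tau e y * (x + (-1 : ℝ) ^ e • invol x) := by
    let F : GrAlg par →ₗ[ℝ] GrAlg par :=
      LinearMap.id + (-1 : ℝ) ^ e • (invol : GrAlg par →ₐ[ℝ] GrAlg par).toLinearMap
    have : (LinearMap.mulRight ℝ y).comp F = (LinearMap.mulLeft ℝ (tau e y)).comp F :=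
      linearMap_ext fun l => by
        simp only [F, LinearMap.comp_apply, LinearMap.add_apply, LinearMap.id_apply,
          LinearMap.smul_apply, AlgHom.toLinearMap_apply, LinearMap.mulRight_apply,
          LinearMap.mulLeft_apply, invol_mono, smul_smul]
        rcases neg_one_pow_eq_or ℝ e with h | h <;>
          rcases neg_one_pow_eq_or ℝ (l.map par).sum with h' | h'
        · rw [h, h']; simp [add_mul, mul_add, mono_mul, tau_congr (h.trans h'.symm)]
        · rw [h, h']; simp
        · rw [h, h']; simp
        · rw [h, h']; simp [add_mul, mul_add, mono_mul, tau_congr (h.trans h'.symm)]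
    exact fun x => LinearMap.congr_fun this x
  have h2 : x + (-1 : ℝ) ^ e • invol x = (2 : ℝ) • x := by
    rw [mem_parSub.1 hx, smul_smul, sign_sq, one_smul, two_smul]
  have := key x
  rw [h2, smul_mul_assoc, mul_smul_comm] at this
  exact smul_right_injective _ (two_ne_zero (α := ℝ)) this

theorem mul_tau_of_mem_parSub {e : ℕ} {x : GrAlg par} (hx : x ∈ parSub e) (y : GrAlg par) :
    x * tau e y = y * x := by rw [mul_comm_of_mem_parSub hx, tau_tau]

/-! #### Partial derivatives and derivations -/

/-- With these entries known, the corner entry of a matrix product is the graded Leibniz rule. -/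
theorem rightMat_apply (g : G) (x : GrAlg par) :
    rightMat g x 0 0 = x ∧ rightMat g x 1 0 = 0 ∧ rightMat g x 1 1 = tau (par g) x := by
  induction x using GrAlg.induction with
  | hc r => simp [Algebra.algebraMap_eq_smul_one]
  | hg h => simp [rightMat, lift_gen, tau]
  | ha x y hx hy => simp [hx, hy]
  | hm x y hx hy => simp [hx, hy, Matrix.mul_apply, Fin.sum_univ_two]

theorem leftMat_apply (g : G) (x : GrAlg par) :
    leftMat g x 0 0 = tau (par g) x ∧ leftMat g x 1 0 = 0 ∧ leftMat g x 1 1 = x := by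
  induction x using GrAlg.induction with
  | hc r => simp [Algebra.algebraMap_eq_smul_one]
  | hg h => simp [leftMat, lift_gen, tau]
  | ha x y hx hy => simp [hx, hy]
  | hm x y hx hy => simp [hx, hy, Matrix.mul_apply, Fin.sum_univ_two]

/-- The right partial derivative as a linear map. -/
def rpdL (g : G) : GrAlg par →ₗ[ℝ] GrAlg par where
  toFun := rpd g
  map_add' x y := by simp [rpd]
  map_smul' r x := by simp [rpd]

/-- The left partial derivative as a linear map. -/
def lpdL (g : G) : GrAlg par →ₗ[ℝ] GrAlg par where
  toFun := lpd g
  map_add' x y := by simp [lpd]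
  map_smul' r x := by simp [lpd]

theorem rpd_mul (g : G) (x y : GrAlg par) : rpd g (x * y) = x * rpd g y + rpd g x * tau (par g) y := by
  simp [rpd, Matrix.mul_apply, Fin.sum_univ_two, rightMat_apply]

theorem lpd_mul (g : G) (x y : GrAlg par) : lpd g (x * y) = tau (par g) x * lpd g y + lpd g x * y := by
  simp [lpd, Matrix.mul_apply, Fin.sum_univ_two, leftMat_apply]

open Classical in
theorem rpd_gen (g h : G) : rpd g (gen h : GrAlg par) = if h = g then 1 else 0 := by
  simp [rpd, rightMat]

open Classical in
theorem lpd_gen (g h : G) : lpd g (gen h : GrAlg par) = if h = g then 1 else 0 := by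
  simp [lpd, leftMat]

@[simp] theorem rpd_algebraMap (g : G) (r : ℝ) : rpd g (algebraMap ℝ (GrAlg par) r) = 0 := by
  simp [rpd, Algebra.algebraMap_eq_smul_one]

@[simp] theorem lpd_algebraMap (g : G) (r : ℝ) : lpd g (algebraMap ℝ (GrAlg par) r) = 0 := by
  simp [lpd, Algebra.algebraMap_eq_smul_one]

theorem rpd_mem_degSub {M : Type*} [AddCommMonoid M] {deg : G → M} {p : Set M} (g : G)
    {x : GrAlg par} (hx : x ∈ degSub deg p) : rpd g x ∈ degSub deg {d | d + deg g ∈ p} := by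
  have key : ∀ l : List G, rpd g (mono l : GrAlg par) ∈ degSub deg {d | d + deg g = (l.map deg).sum} := by
    intro l
    induction l with
    | nil =>
      have : (mono [] : GrAlg par) = algebraMap ℝ _ 1 := by simp
      rw [this, rpd_algebraMap]
      exact zero_mem _
    | cons h l ih =>
      classical
      rw [mono_cons, rpd_mul, rpd_gen, tau_mono]
      refine add_mem (mul_mem_degSub (gen_mem_degSub h) ih ?_) ?_
      · rintro _ rfl b hb
        simp only [Set.mem_ofPred_eq] at hb
        simp [← hb, add_assoc]
      · split_ifs with e
        · rw [one_mul]
          refine Submodule.smul_mem _ _ (mono_mem_degSub ?_)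
          simp [e, add_comm]
        · rw [zero_mul]; exact zero_mem _
  exact map_mem_degSub (F := rpdL g) (fun l hl => degSub_le (fun d hd => by
    rw [Set.mem_ofPred_eq] at hd ⊢; rwa [hd]) (key l)) hx

theorem lpd_mem_degSub {M : Type*} [AddCommMonoid M] {deg : G → M} {p : Set M} (g : G)
    {x : GrAlg par} (hx : x ∈ degSub deg p) : lpd g x ∈ degSub deg {d | d + deg g ∈ p} := by
  have key : ∀ l : List G, lpd g (mono l : GrAlg par) ∈ degSub deg {d | d + deg g = (l.map deg).sum} := by
    intro l
    induction l with
    | nil =>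
      have : (mono [] : GrAlg par) = algebraMap ℝ _ 1 := by simp
      rw [this, lpd_algebraMap]
      exact zero_mem _
    | cons h l ih =>
      classical
      rw [mono_cons, lpd_mul, lpd_gen, tau_gen, smul_mul_assoc]
      refine add_mem (Submodule.smul_mem _ _ (mul_mem_degSub (gen_mem_degSub h) ih ?_)) ?_
      · rintro _ rfl b hb
        simp only [Set.mem_ofPred_eq] at hb
        simp [← hb, add_assoc]
      · split_ifs with e
        · rw [one_mul]
          refine mono_mem_degSub ?_
          simp [e, add_comm]
        · rw [zero_mul]; exact zero_mem _
  exact map_mem_degSub (F := lpdL g) (fun l hl => degSub_le (fun d hd => by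
    rw [Set.mem_ofPred_eq] at hd ⊢; rwa [hd]) (key l)) hx

/-- An element involves finitely many generators. So the sums over all generators that define
derivations are genuine, not the default value of `finsum`. -/
theorem finite_rpd (x : GrAlg par) : {g | rpd g x ≠ 0}.Finite := by
  classical
  induction x using GrAlg.induction with
  | hc r => simp
  | hg h =>
    refine (Set.finite_singleton h).subset fun g hg => ?_
    by_contra hne
    exact hg (by rw [rpd_gen, if_neg fun e => hne e.symm])
  | ha x y hx hy =>
    refine (hx.union hy).subset fun g hg => ?_
    by_contra hne
    simp only [Set.mem_union, Set.mem_ofPred_eq, not_or, not_not] at hne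
    exact hg (by rw [show rpd g (x + y) = rpd g x + rpd g y from (rpdL g).map_add x y, hne.1, hne.2,
      add_zero])
  | hm x y hx hy =>
    refine (hx.union hy).subset fun g hg => ?_
    by_contra hne
    simp only [Set.mem_union, Set.mem_ofPred_eq, not_or, not_not] at hne
    exact hg (by rw [rpd_mul, hne.1, hne.2, mul_zero, zero_mul, add_zero])

theorem finite_lpd (x : GrAlg par) : {g | lpd g x ≠ 0}.Finite := by
  classical
  induction x using GrAlg.induction with
  | hc r => simp
  | hg h =>
    refine (Set.finite_singleton h).subset fun g hg => ?_
    by_contra hne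
    exact hg (by rw [lpd_gen, if_neg fun e => hne e.symm])
  | ha x y hx hy =>
    refine (hx.union hy).subset fun g hg => ?_
    by_contra hne
    simp only [Set.mem_union, Set.mem_ofPred_eq, not_or, not_not] at hne
    exact hg (by rw [show lpd g (x + y) = lpd g x + lpd g y from (lpdL g).map_add x y, hne.1, hne.2,
      add_zero])
  | hm x y hx hy =>
    refine (hx.union hy).subset fun g hg => ?_
    by_contra hne
    simp only [Set.mem_union, Set.mem_ofPred_eq, not_or, not_not] at hne
    exact hg (by rw [lpd_mul, hne.1, hne.2, mul_zero, zero_mul, add_zero])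

theorem support_rpd_mul (U : G → GrAlg par) (x : GrAlg par) :
    (Function.support fun g => rpd g x * U g).Finite :=
  (finite_rpd x).subset fun g hg h => hg (by simp [h])

theorem support_mul_lpd (V : G → GrAlg par) (x : GrAlg par) :
    (Function.support fun g => V g * lpd g x).Finite :=
  (finite_lpd x).subset fun g hg h => hg (by simp [h])

/-- The right derivation that sends each generator `g` to `U g`. -/
def derR (U : G → GrAlg par) : GrAlg par →ₗ[ℝ] GrAlg par where
  toFun x := ∑ᶠ g, rpd g x * U g
  map_add' x y := by
    rw [← finsum_add_distrib (support_rpd_mul U x) (support_rpd_mul U y)]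
    refine finsum_congr fun g => ?_
    rw [← add_mul]
    exact congrArg (· * U g) ((rpdL g).map_add x y)
  map_smul' r x := by
    rw [RingHom.id_apply, smul_finsum]
    refine finsum_congr fun g => ?_
    rw [← smul_mul_assoc]
    exact congrArg (· * U g) ((rpdL g).map_smul r x)

/-- The left derivation that sends each generator `g` to `V g`. -/
def derL (V : G → GrAlg par) : GrAlg par →ₗ[ℝ] GrAlg par where
  toFun x := ∑ᶠ g, V g * lpd g x
  map_add' x y := by
    rw [← finsum_add_distrib (support_mul_lpd V x) (support_mul_lpd V y)]
    refine finsum_congr fun g => ?_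
    rw [← mul_add]
    exact congrArg (V g * ·) ((lpdL g).map_add x y)
  map_smul' r x := by
    rw [RingHom.id_apply, smul_finsum]
    refine finsum_congr fun g => ?_
    rw [← mul_smul_comm]
    exact congrArg (V g * ·) ((lpdL g).map_smul r x)

theorem derR_apply (U : G → GrAlg par) (x : GrAlg par) : derR U x = ∑ᶠ g, rpd g x * U g := rfl

theorem derL_apply (V : G → GrAlg par) (x : GrAlg par) : derL V x = ∑ᶠ g, V g * lpd g x := rfl

@[simp] theorem derR_gen (U : G → GrAlg par) (g : G) : derR U (gen g) = U g := by
  classical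
  rw [derR_apply, finsum_eq_single _ g]
  · simp [rpd_gen]
  · intro h hne; simp [rpd_gen, hne.symm]

@[simp] theorem derL_gen (V : G → GrAlg par) (g : G) : derL V (gen g) = V g := by
  classical
  rw [derL_apply, finsum_eq_single _ g]
  · simp [lpd_gen]
  · intro h hne; simp [lpd_gen, hne.symm]

@[simp] theorem derR_algebraMap (U : G → GrAlg par) (r : ℝ) : derR U (algebraMap ℝ _ r) = 0 := by
  simp [derR_apply]

@[simp] theorem derL_algebraMap (V : G → GrAlg par) (r : ℝ) : derL V (algebraMap ℝ _ r) = 0 := by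
  simp [derL_apply]

/-- The partial derivative by g puts the sign of g on y. Moving the value `U g`, whose parity is
opposite to that of g, past y cancels this sign and leaves one involution, the same for all g. -/
theorem derR_mul {U : G → GrAlg par} (hU : ∀ g, U g ∈ parSub (par g + 1)) (x y : GrAlg par) :
    derR U (x * y) = x * derR U y + derR U x * invol y := by
  simp only [derR_apply]
  rw [mul_finsum' _ _ (support_rpd_mul U y), finsum_mul' _ _ (support_rpd_mul U x), ← finsum_add_distrib]
  · refine finsum_congr fun g => ?_
    have : tau (par g) y * U g = U g * invol y := by
      rw [mul_comm_of_mem_parSub (hU g), tau_add, tau_one, tau_invol, tau_invol,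
        ← tau_one, tau_tau]
    rw [rpd_mul, add_mul, mul_assoc, mul_assoc, this, mul_assoc]
  · exact (finite_rpd y).subset fun g hg h => hg (by simp [h])
  · exact (finite_rpd x).subset fun g hg h => hg (by simp [h])

/-- Here `V g` has the parity of g, so the two signs cancel completely and an ordinary derivation
results. -/
theorem derL_mul {V : G → GrAlg par} (hV : ∀ g, V g ∈ parSub (par g)) (x y : GrAlg par) :
    derL V (x * y) = derL V x * y + x * derL V y := by
  simp only [derL_apply]
  rw [mul_finsum' _ _ (support_mul_lpd V y), finsum_mul' _ _ (support_mul_lpd V x), ← finsum_add_distrib]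
  · refine finsum_congr fun g => ?_
    rw [lpd_mul, mul_add, ← mul_assoc, mul_tau_of_mem_parSub (hV g), add_comm, mul_assoc, mul_assoc]
  · exact (finite_lpd x).subset fun g hg h => hg (by simp [h])
  · exact (finite_lpd y).subset fun g hg h => hg (by simp [h])

theorem derL_invol {V : G → GrAlg par} (hV : ∀ g, V g ∈ parSub (par g)) (x : GrAlg par) :
    derL V (invol x) = invol (derL V x) := by
  induction x using GrAlg.induction with
  | hc r => simp
  | hg g => rw [invol_gen, map_smul, derL_gen, mem_parSub.1 (hV g)]
  | ha x y hx hy => simp [hx, hy]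
  | hm x y hx hy => simp [derL_mul hV, hx, hy]

theorem derL_comm {V W : G → GrAlg par} (hV : ∀ g, V g ∈ parSub (par g))
    (hW : ∀ g, W g ∈ parSub (par g)) (h : ∀ g, derL V (W g) = derL W (V g)) (x : GrAlg par) :
    derL V (derL W x) = derL W (derL V x) := by
  induction x using GrAlg.induction with
  | hc r => simp
  | hg g => simpa using h g
  | ha x y hx hy => simp [hx, hy]
  | hm x y hx hy => simp only [derL_mul hV, derL_mul hW, hx, hy, map_add]; abel

theorem derR_mem {p : Submodule ℝ (GrAlg par)} {U : G → GrAlg par} {x : GrAlg par}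
    (h : ∀ g, rpd g x ≠ 0 → rpd g x * U g ∈ p) : derR U x ∈ p := by
  rw [derR_apply]
  refine finsum_induction (· ∈ p) (zero_mem _) (fun _ _ => add_mem) fun g => ?_
  by_cases e : rpd g x = 0
  · simp [e]
  · exact h g e

theorem derL_mem {p : Submodule ℝ (GrAlg par)} {V : G → GrAlg par} {x : GrAlg par}
    (h : ∀ g, V g * lpd g x ∈ p) : derL V x ∈ p :=
  finsum_induction (· ∈ p) (zero_mem _) (fun _ _ => add_mem) h

theorem derR_congr {U U' : G → GrAlg par} {x : GrAlg par} (h : ∀ g, rpd g x ≠ 0 → U g = U' g) :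
    derR U x = derR U' x := by
  refine finsum_congr fun g => ?_
  by_cases e : rpd g x = 0
  · simp [e]
  · rw [h g e]

theorem derR_add {U V : G → GrAlg par} (x : GrAlg par) :
    derR (fun g => U g + V g) x = derR U x + derR V x := by
  simp only [derR_apply]
  rw [← finsum_add_distrib (support_rpd_mul U x) (support_rpd_mul V x)]
  simp [mul_add]

theorem comp_derR {M : Type*} [AddCommMonoid M] {deg : G → M} {U : G → GrAlg par} (d : M)
    (x : GrAlg par) : comp deg d (derR U x) = ∑ᶠ g, comp deg d (rpd g x * U g) := by
  exact (compL deg d).toAddMonoidHom.map_finsum (support_rpd_mul U x)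

theorem exists_deg_of_rpd_ne_zero {M : Type*} [AddCommMonoid M] {deg : G → M} {p : Set M} {g : G}
    {x : GrAlg par} (hx : x ∈ degSub deg p) (h : rpd g x ≠ 0) : ∃ d, d + deg g ∈ p := by
  by_contra hc
  push Not at hc
  refine h ?_
  rw [← sum_comp (deg := deg) (rpd g x)]
  exact Finset.sum_eq_zero fun d _ => comp_of_not_mem (rpd_mem_degSub g hx) (hc d)

end GrAlg

open GrAlg Dims Filter Topology

variable {D : Dims}

/-! ### Weak directional derivatives -/

section VDeriv

variable {W : Type*} [AddCommGroup W] [Module ℝ W]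

/-- `w` is the derivative of `f` at `z` in the direction `v`, in the weak sense. -/
def HasVD (f : D.Jet → W) (z v : D.Jet) (w : W) : Prop :=
  ∀ ℓ : Module.Dual ℝ W, HasDerivAt (fun t : ℝ => ℓ (f (z + t • v))) (ℓ w) 0

/-- Linear functionals separate the points of a real vector space, so a weak derivative is unique.
-/
theorem HasVD.vderiv_eq {f : D.Jet → W} {z v : D.Jet} {w : W} (h : HasVD f z v w) :
    vderiv f z v = w := by
  have hex : ∃ w : W, ∀ ℓ : Module.Dual ℝ W,
      HasDerivAt (fun t : ℝ => ℓ (f (z + t • v))) (ℓ w) 0 := ⟨w, h⟩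
  rw [vderiv, dif_pos hex, ← sub_eq_zero, ← Module.forall_dual_apply_eq_zero_iff ℝ]
  intro ℓ
  rw [map_sub, (hex.choose_spec ℓ).unique (h ℓ), sub_self]

theorem vderiv_congr {f g : D.Jet → W} {z v : D.Jet}
    (h : ∀ᶠ t : ℝ in 𝓝 0, f (z + t • v) = g (z + t • v)) : vderiv f z v = vderiv g z v := by
  have : (fun w : W => ∀ ℓ : Module.Dual ℝ W, HasDerivAt (fun t : ℝ => ℓ (f (z + t • v))) (ℓ w) 0) =
      fun w : W => ∀ ℓ : Module.Dual ℝ W, HasDerivAt (fun t : ℝ => ℓ (g (z + t • v))) (ℓ w) 0 := by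
    funext w
    refine propext (forall_congr' fun ℓ => Filter.EventuallyEq.hasDerivAt_iff ?_)
    filter_upwards [h] with t ht
    rw [ht]
  unfold vderiv
  by_cases hex : ∃ w : W, ∀ ℓ : Module.Dual ℝ W,
      HasDerivAt (fun t : ℝ => ℓ (f (z + t • v))) (ℓ w) 0
  · have hf : HasVD f z v hex.choose := hex.choose_spec
    have hg : HasVD g z v hex.choose := (congrFun this _).mp hex.choose_spec
    exact hf.vderiv_eq.trans hg.vderiv_eq.symm
  · have hex' : ¬ ∃ w : W, ∀ ℓ : Module.Dual ℝ W,
        HasDerivAt (fun t : ℝ => ℓ (g (z + t • v))) (ℓ w) 0 :=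
      fun ⟨w, hw⟩ => hex ⟨w, (congrFun this w).mpr hw⟩
    rw [dif_neg hex, dif_neg hex']

theorem HasVD.congr {f g : D.Jet → W} {z v : D.Jet} {w : W} (hg : HasVD g z v w)
    (h : ∀ᶠ t : ℝ in 𝓝 0, f (z + t • v) = g (z + t • v)) : HasVD f z v w := fun ℓ => by
  refine (hg ℓ).congr_of_eventuallyEq ?_
  filter_upwards [h] with t ht
  rw [ht]

/-- A functional that vanishes on the subspace but not on the derivative would be zero along the
line near the point. Differentiability is not needed, since the default value zero lies in the
subspace as well; so constraints on degree and parity pass to derivatives of arbitrary functions. -/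
theorem vderiv_mem {p : Submodule ℝ W} {f : D.Jet → W} {z v : D.Jet}
    (h : ∀ᶠ t : ℝ in 𝓝 0, f (z + t • v) ∈ p) : vderiv f z v ∈ p := by
  unfold vderiv
  split_ifs with hex
  · by_contra hc
    obtain ⟨ℓ, hℓ, hp⟩ := Submodule.exists_dual_map_eq_bot_of_notMem hc inferInstance
    refine hℓ ((hex.choose_spec ℓ).unique ?_)
    refine (hasDerivAt_const (0 : ℝ) (0 : ℝ)).congr_of_eventuallyEq ?_
    filter_upwards [h] with t ht
    have : ℓ (f (z + t • v)) ∈ p.map ℓ := ⟨_, ht, rfl⟩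
    rwa [hp, Submodule.mem_bot] at this
  · exact zero_mem _

theorem hasVD_const (w : W) (z v : D.Jet) : HasVD (fun _ => w) z v 0 := fun ℓ => by
  simpa using hasDerivAt_const (0 : ℝ) (ℓ w)

theorem HasVD.add {f g : D.Jet → W} {z v : D.Jet} {w w' : W} (hf : HasVD f z v w)
    (hg : HasVD g z v w') : HasVD (fun z => f z + g z) z v (w + w') := fun ℓ => by
  simp only [map_add]
  exact (hf ℓ).fun_add (hg ℓ)

theorem HasVD.sum {ι : Type*} {s : Finset ι} {f : ι → D.Jet → W} {z v : D.Jet} {w : ι → W}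
    (hf : ∀ i ∈ s, HasVD (f i) z v (w i)) :
    HasVD (fun z => ∑ i ∈ s, f i z) z v (∑ i ∈ s, w i) := fun ℓ => by
  simp only [map_sum]
  exact HasDerivAt.fun_sum fun i hi => hf i hi ℓ

theorem hasVD_real {a : D.Jet → ℝ} {z v : D.Jet} {b : ℝ} :
    HasVD a z v b ↔ HasDerivAt (fun t : ℝ => a (z + t • v)) b 0 := by
  refine ⟨fun h => h LinearMap.id, fun h ℓ => ?_⟩
  obtain ⟨c, hc⟩ : ∃ c, ∀ x : ℝ, ℓ x = x * c := ⟨ℓ 1, fun x => by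
    conv_lhs => rw [← mul_one x, ← smul_eq_mul, map_smul, smul_eq_mul]⟩
  simp only [hc]
  exact h.mul_const c

theorem HasVD.smul {a : D.Jet → ℝ} {f : D.Jet → W} {z v : D.Jet} {b : ℝ} {w : W}
    (ha : HasVD a z v b) (hf : HasVD f z v w) :
    HasVD (fun z => a z • f z) z v (b • f z + a z • w) := fun ℓ => by
  have := (hasVD_real.1 ha).fun_mul (hf ℓ)
  simp only [zero_smul, add_zero] at this
  simp only [map_add, map_smul, smul_eq_mul]
  exact this

theorem HasVD.map {W' : Type*} [AddCommGroup W'] [Module ℝ W'] (L : W →ₗ[ℝ] W') {f : D.Jet → W}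
    {z v : D.Jet} {w : W} (hf : HasVD f z v w) : HasVD (fun z => L (f z)) z v (L w) :=
  fun ℓ => hf (ℓ.comp L)

end VDeriv

theorem eventually_mem_jetDom {V : Set (D.Base × D.Fib)} (hV : IsOpen V) {z : D.Jet}
    (hz : z ∈ jetDom V) (v : D.Jet) : ∀ᶠ t : ℝ in 𝓝 0, z + t • v ∈ jetDom V := by
  have hc : Continuous fun t : ℝ => ((z + t • v).1, fun i => (z + t • v).2 i 0) := by
    simp only [Prod.fst_add, Prod.snd_add, Prod.smul_fst, Prod.smul_snd, Pi.add_apply, Pi.smul_apply]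
    fun_prop
  refine hc.continuousAt.eventually_mem (hV.mem_nhds ?_)
  simpa [jetDom] using hz

/-! ### Smooth functions of finitely many jet coordinates -/

/-- Jet coordinates `(x, y^i_Λ)` with all entries of `Λ` at most `r`. -/
abbrev FinJet (D : Dims) (r : ℕ) : Type := D.Base × (Fin D.m → (Fin D.n → Fin (r + 1)) → ℝ)

/-- The finite jets over `V`. -/
def finDom (r : ℕ) (V : Set (D.Base × D.Fib)) : Set (FinJet D r) := {u | (u.1, fun i => u.2 i 0) ∈ V}

theorem isOpen_finDom (r : ℕ) {V : Set (D.Base × D.Fib)} (hV : IsOpen V) : IsOpen (finDom r V) :=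
  hV.preimage (f := fun u : FinJet D r => (u.1, fun i => u.2 i 0)) (by fun_prop)

/-- Truncation of jets. -/
def trunc (r : ℕ) : D.Jet →ₗ[ℝ] FinJet D r where
  toFun z := (z.1, fun i Λ => z.2 i fun l => (Λ l : ℕ))
  map_add' _ _ := rfl
  map_smul' _ _ := rfl

theorem trunc_mem_finDom {r : ℕ} {V : Set (D.Base × D.Fib)} {z : D.Jet} :
    trunc r z ∈ finDom r V ↔ z ∈ jetDom V := Iff.rfl

/-- Extension of truncated jets by zero. -/
def extendJet (r : ℕ) (u : FinJet D r) : D.Jet :=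
  (u.1, fun i Λ => if h : ∀ l, Λ l < r + 1 then u.2 i fun l => ⟨Λ l, h l⟩ else 0)

@[simp] theorem trunc_extendJet (r : ℕ) (u : FinJet D r) : trunc r (extendJet r u) = u := by
  ext
  · rfl
  · simp [trunc, extendJet, Fin.is_le]

theorem extendJet_mem {r : ℕ} {V : Set (D.Base × D.Fib)} {u : FinJet D r} :
    extendJet r u ∈ jetDom V ↔ u ∈ finDom r V := by
  rw [← trunc_mem_finDom (r := r), trunc_extendJet]

theorem isSmoothOn_iff {r : ℕ} {V : Set (D.Base × D.Fib)} {a : D.Jet → ℝ} :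
    IsSmoothOn r V a ↔ ∃ g : FinJet D r → ℝ, ContDiffOn ℝ ∞ g (finDom r V) ∧
      ∀ z ∈ jetDom V, a z = g (trunc r z) := Iff.rfl

/-- Truncation of finite jets. -/
def truncFin {r r' : ℕ} (h : r ≤ r') : FinJet D r' →L[ℝ] FinJet D r :=
  LinearMap.toContinuousLinearMap
    { toFun := fun u => (u.1, fun i Λ => u.2 i fun l => Fin.castLE (by omega) (Λ l))
      map_add' := fun _ _ => rfl
      map_smul' := fun _ _ => rfl }

theorem truncFin_trunc {r r' : ℕ} (h : r ≤ r') (z : D.Jet) : truncFin h (trunc r' z) = trunc r z := rfl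

theorem truncFin_mem {r r' : ℕ} (h : r ≤ r') {V : Set (D.Base × D.Fib)} {u : FinJet D r'} :
    truncFin h u ∈ finDom r V ↔ u ∈ finDom r' V := by
  conv_lhs => rw [← trunc_extendJet r' u, truncFin_trunc, trunc_mem_finDom, extendJet_mem]

namespace IsSmoothOn

variable {r r' : ℕ} {V V' : Set (D.Base × D.Fib)} {a b : D.Jet → ℝ}

theorem mono_set (h : IsSmoothOn r V a) (hV : V' ⊆ V) : IsSmoothOn r V' a := by
  obtain ⟨g, hg, e⟩ := h
  exact ⟨g, hg.mono fun u hu => hV hu, fun z hz => e z (hV hz)⟩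

theorem mono_order (h : IsSmoothOn r V a) (hr : r ≤ r') : IsSmoothOn r' V a := by
  obtain ⟨g, hg, e⟩ := isSmoothOn_iff.1 h
  refine isSmoothOn_iff.2 ⟨g ∘ truncFin hr, hg.comp (truncFin hr).contDiff.contDiffOn fun u hu =>
    (truncFin_mem hr).2 hu, fun z hz => e z hz⟩

theorem congr (h : IsSmoothOn r V a) (e : ∀ z ∈ jetDom V, b z = a z) : IsSmoothOn r V b := by
  obtain ⟨g, hg, e'⟩ := h
  exact ⟨g, hg, fun z hz => (e z hz).trans (e' z hz)⟩

theorem const (c : ℝ) : IsSmoothOn r V (fun _ : D.Jet => c) :=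
  ⟨fun _ => c, contDiffOn_const, fun _ _ => rfl⟩

theorem add (ha : IsSmoothOn r V a) (hb : IsSmoothOn r V b) :
    IsSmoothOn r V (fun z => a z + b z) := by
  obtain ⟨g, hg, e⟩ := ha
  obtain ⟨g', hg', e'⟩ := hb
  exact ⟨fun u => g u + g' u, hg.add hg', fun z hz => by simp only [e z hz, e' z hz]⟩

theorem mul (ha : IsSmoothOn r V a) (hb : IsSmoothOn r V b) :
    IsSmoothOn r V (fun z => a z * b z) := by
  obtain ⟨g, hg, e⟩ := ha
  obtain ⟨g', hg', e'⟩ := hb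
  exact ⟨fun u => g u * g' u, hg.mul hg', fun z hz => by simp only [e z hz, e' z hz]⟩

theorem sum {ι : Type*} {s : Finset ι} {a : ι → D.Jet → ℝ} (h : ∀ i ∈ s, IsSmoothOn r V (a i)) :
    IsSmoothOn r V (fun z => ∑ i ∈ s, a i z) := by
  classical
  induction s using Finset.induction_on with
  | empty => simpa using const 0
  | insert i s hi ih =>
    simp only [Finset.sum_insert hi]
    exact (h i (Finset.mem_insert_self i s)).add (ih fun j hj => h j (Finset.mem_insert_of_mem hj))

/-- Smooth functions on `V` are smooth functions of jets. -/
theorem of_contDiffOn {g : D.Base × D.Fib → ℝ} (hg : ContDiffOn ℝ ∞ g V) :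
    IsSmoothOn r V (fun z => g (z.1, fun i => z.2 i 0)) := by
  refine ⟨fun u => g (u.1, fun i => u.2 i 0), ?_, fun z _ => rfl⟩
  refine hg.comp (f := fun u : FinJet D r => (u.1, fun i => u.2 i 0)) ?_ fun u hu => hu
  fun_prop

theorem hasDerivAt_of_eq {g : FinJet D r → ℝ} (hV : IsOpen V) (hg : ContDiffOn ℝ ∞ g (finDom r V))
    (e : ∀ z ∈ jetDom V, a z = g (trunc r z)) {z : D.Jet} (hz : z ∈ jetDom V) (v : D.Jet) :
    HasDerivAt (fun t : ℝ => a (z + t • v)) (fderiv ℝ g (trunc r z) (trunc r v)) 0 := by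
  have hd : DifferentiableAt ℝ g (trunc r z) :=
    (hg.contDiffAt ((isOpen_finDom r hV).mem_nhds hz)).differentiableAt (by simp)
  have hl : HasDerivAt (fun t : ℝ => trunc r z + t • trunc r v) (trunc r v) 0 := by
    simpa using ((hasDerivAt_id (0 : ℝ)).smul_const (trunc r v)).const_add (trunc r z)
  have hd' : HasFDerivAt g (fderiv ℝ g (trunc r z)) (trunc r z + (0 : ℝ) • trunc r v) := by
    simpa using hd.hasFDerivAt
  refine (hd'.comp_hasDerivAt (0 : ℝ) hl).congr_of_eventuallyEq ?_
  filter_upwards [eventually_mem_jetDom hV hz v] with t ht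
  rw [e _ ht, map_add, map_smul]
  rfl

theorem vderiv_of_eq {g : FinJet D r → ℝ} (hV : IsOpen V) (hg : ContDiffOn ℝ ∞ g (finDom r V))
    (e : ∀ z ∈ jetDom V, a z = g (trunc r z)) {z : D.Jet} (hz : z ∈ jetDom V) (v : D.Jet) :
    vderiv a z v = fderiv ℝ g (trunc r z) (trunc r v) :=
  (hasVD_real.2 (hasDerivAt_of_eq hV hg e hz v)).vderiv_eq

theorem hasVD (hV : IsOpen V) (ha : IsSmoothOn r V a) {z : D.Jet} (hz : z ∈ jetDom V) (v : D.Jet) :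
    HasVD a z v (vderiv a z v) := by
  obtain ⟨g, hg, e⟩ := isSmoothOn_iff.1 ha
  rw [vderiv_of_eq hV hg e hz v]
  exact hasVD_real.2 (hasDerivAt_of_eq hV hg e hz v)

end IsSmoothOn

/-- The vector moves together with the point because the direction of a total derivative depends on
the jet. -/
theorem hasDerivAt_fderiv_line {E : Type*} [NormedAddCommGroup E] [NormedSpace ℝ E] {g : E → ℝ} {p : E}
    (hg : ContDiffAt ℝ ∞ g p) (u v s : E) :
    HasDerivAt (fun t : ℝ => fderiv ℝ g (p + t • u) (v + t • s))
      (fderiv ℝ (fderiv ℝ g) p u v + fderiv ℝ g p s) 0 := by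
  have hd : HasFDerivAt (fderiv ℝ g) (fderiv ℝ (fderiv ℝ g) p) (p + (0 : ℝ) • u) := by
    have : ContDiffAt ℝ 1 (fderiv ℝ g) p := hg.fderiv_right (by norm_cast)
    rw [zero_smul, add_zero]
    exact (this.differentiableAt one_ne_zero).hasFDerivAt
  have hl : HasDerivAt (fun t : ℝ => p + t • u) u 0 := by
    simpa using ((hasDerivAt_id (0 : ℝ)).smul_const u).const_add p
  have hs : HasDerivAt (fun t : ℝ => v + t • s) s 0 := by
    simpa using ((hasDerivAt_id (0 : ℝ)).smul_const s).const_add v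
  have h1 : HasDerivAt (fun t : ℝ => fderiv ℝ g (p + t • u)) (fderiv ℝ (fderiv ℝ g) p u) 0 :=
    hd.comp_hasDerivAt (0 : ℝ) hl
  have h2 := HasDerivAt.clm_apply h1 hs
  rw [zero_smul, add_zero, zero_smul, add_zero] at h2
  exact h2

/-- The jet `(0, y^i_{l+Λ})`. -/
def shiftJet (l : Fin D.n) : D.Jet →ₗ[ℝ] D.Jet where
  toFun z := (0, fun i Λ => z.2 i (Λ + Pi.single l 1))
  map_add' _ _ := by ext <;> simp
  map_smul' _ _ := by ext <;> simp

/-- The direction of the total derivative. -/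
def horDir (l : Fin D.n) (z : D.Jet) : D.Jet :=
  ((Pi.single l 1 : D.Base), fun i Λ => z.2 i (Λ + Pi.single l 1))

theorem horDir_eq (l : Fin D.n) (z : D.Jet) :
    horDir l z = ((Pi.single l 1 : D.Base), 0) + shiftJet l z := by
  ext <;> simp [horDir, shiftJet]

theorem hderiv_eq {W : Type*} [AddCommGroup W] [Module ℝ W] (l : Fin D.n) (f : D.Jet → W) (z : D.Jet) :
    hderiv l f z = vderiv f z (horDir l z) := rfl

theorem shiftJet_horDir (l m : Fin D.n) (z : D.Jet) :
    shiftJet l (horDir m z) = shiftJet m (horDir l z) := by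
  ext
  · rfl
  · simp [shiftJet, horDir, add_right_comm]

/-- The shift on finite jets. -/
def shiftFin (r : ℕ) (l : Fin D.n) : FinJet D (r + 1) →L[ℝ] FinJet D r :=
  LinearMap.toContinuousLinearMap
    { toFun := fun u => (0, fun i Λ => u.2 i fun k =>
        ⟨Λ k + Pi.single (M := fun _ => ℕ) l 1 k, by
          have := (Λ k).2
          rw [Pi.single_apply]
          split_ifs <;> omega⟩)
      map_add' := fun _ _ => by ext <;> simp
      map_smul' := fun _ _ => by ext <;> simp }

namespace IsSmoothOn

variable {r : ℕ} {V : Set (D.Base × D.Fib)} {a : D.Jet → ℝ}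

/-- The direction at a jet contains the coordinates y^i_{l+Λ}, whose entries may exceed the previous
bound by one; hence the new order. -/
theorem hderiv (hV : IsOpen V) (ha : IsSmoothOn r V a) (l : Fin D.n) :
    IsSmoothOn (r + 1) V (hderiv l a) := by
  obtain ⟨g, hg, e⟩ := isSmoothOn_iff.1 ha
  refine isSmoothOn_iff.2 ⟨fun u => fderiv ℝ g (truncFin r.le_succ u)
    (((Pi.single l 1 : D.Base), 0) + shiftFin r l u), ?_, fun z hz => ?_⟩
  · have h1 : ContDiffOn ℝ ∞ (fderiv ℝ g) (finDom r V) :=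
      hg.fderiv_of_isOpen (isOpen_finDom r hV) (by simp)
    have h2 : ContDiffOn ℝ ∞ (fun u : FinJet D (r + 1) => fderiv ℝ g (truncFin r.le_succ u))
        (finDom (r + 1) V) :=
      h1.comp (truncFin r.le_succ).contDiff.contDiffOn fun u hu => (truncFin_mem _).2 hu
    exact h2.clm_apply (contDiff_const.add (shiftFin r l).contDiff).contDiffOn
  · rw [hderiv_eq, vderiv_of_eq hV hg e hz, horDir_eq, map_add]
    rfl

/-- The iterated derivative is the second derivative in the two horizontal directions plus the first
derivative along the shift of a horizontal direction. The former is symmetric by smoothness, the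
latter because shifts commute. -/
theorem hderiv_comm (hV : IsOpen V) (ha : IsSmoothOn r V a) (l m : Fin D.n) {z : D.Jet}
    (hz : z ∈ jetDom V) :
    GradedLagrangian.hderiv l (GradedLagrangian.hderiv m a) z =
      GradedLagrangian.hderiv m (GradedLagrangian.hderiv l a) z := by
  obtain ⟨g, hg, e⟩ := isSmoothOn_iff.1 ha
  have hga : ContDiffAt ℝ ∞ g (trunc r z) := hg.contDiffAt ((isOpen_finDom r hV).mem_nhds hz)
  have key : ∀ l m : Fin D.n, GradedLagrangian.hderiv l (GradedLagrangian.hderiv m a) z =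
      fderiv ℝ (fderiv ℝ g) (trunc r z) (trunc r (horDir l z)) (trunc r (horDir m z)) +
        fderiv ℝ g (trunc r z) (trunc r (shiftJet m (horDir l z))) := by
    intro l m
    rw [hderiv_eq]
    refine HasVD.vderiv_eq (hasVD_real.2 ?_)
    have := hasDerivAt_fderiv_line hga (trunc r (horDir l z)) (trunc r (horDir m z))
      (trunc r (shiftJet m (horDir l z)))
    refine this.congr_of_eventuallyEq ?_
    filter_upwards [eventually_mem_jetDom hV hz (horDir l z)] with t ht
    rw [hderiv_eq, vderiv_of_eq hV hg e ht, ← map_smul, ← map_add, ← map_smul, ← map_add]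
    congr 2
    rw [horDir_eq, horDir_eq m z, map_add, map_smul, add_assoc]
  rw [key, key, shiftJet_horDir m l]
  have hsym : IsSymmSndFDerivAt ℝ g (trunc r z) :=
    hga.isSymmSndFDerivAt (by simpa using ENat.LEInfty.out)
  rw [hsym.eq]

end IsSmoothOn

/-! ### Iterated operators -/

/-- Invariance, comparison and naturality statements for d_Λ are all obtained from the case of one
derivative by a suitable choice of `R`. -/
theorem multi_rel {A A' : Type*} {T : Fin D.n → A → A} {T' : Fin D.n → A' → A'} {R : A → A' → Prop}
    (h : ∀ l f f', R f f' → R (T l f) (T' l f')) {f : A} {f' : A'} (hf : R f f') (Λ : D.MI) :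
    R (multi T Λ f) (multi T' Λ f') := by
  unfold multi
  induction List.finRange D.n with
  | nil => exact hf
  | cons a L ih =>
    simp only [List.foldr_cons]
    induction Λ a with
    | zero => exact ih
    | succ k ih' => rw [Function.iterate_succ_apply', Function.iterate_succ_apply']; exact h _ _ _ ih'

@[simp] theorem multi_zero {A : Type*} (T : Fin D.n → A → A) (f : A) : multi T (0 : D.MI) f = f := by
  unfold multi
  induction List.finRange D.n with
  | nil => rfl
  | cons a L ih => simp

theorem multi_mem {A : Type*} {T : Fin D.n → A → A} {P : A → Prop} (h : ∀ l f, P f → P (T l f))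
    {f : A} (hf : P f) (Λ : D.MI) : P (multi T Λ f) :=
  multi_rel (T' := T) (R := fun a _ => P a) (fun l f _ => h l f) hf Λ (f' := f)

/-- `multi` composes the operators in a fixed order, so the additional T_l has to be brought to the
outside. Commutation is available only on `s` and only for functions in `P`; hence the operators
must preserve `P` and depend on values in `s` alone. -/
theorem multi_add_single {Z W : Type*} {T : Fin D.n → (Z → W) → Z → W} {s : Set Z}
    {P : (Z → W) → Prop} (hP : ∀ l f, P f → P (T l f))
    (hT : ∀ l f g, Set.EqOn f g s → Set.EqOn (T l f) (T l g) s)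
    (hc : ∀ l m f, P f → Set.EqOn (T l (T m f)) (T m (T l f)) s) {f : Z → W} (hf : P f)
    (Λ : D.MI) (l : Fin D.n) :
    Set.EqOn (multi T (Λ + Pi.single l 1) f) (T l (multi T Λ f)) s := by
  have hit : ∀ a k f g, Set.EqOn f g s → Set.EqOn ((T a)^[k] f) ((T a)^[k] g) s := by
    intro a k f g h
    induction k with
    | zero => exact h
    | succ k ih => rw [Function.iterate_succ_apply', Function.iterate_succ_apply']; exact hT _ _ _ ih
  have hPit : ∀ a k f, P f → P ((T a)^[k] f) := by
    intro a k f h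
    induction k with
    | zero => exact h
    | succ k ih => rw [Function.iterate_succ_apply']; exact hP _ _ ih
  have hcit : ∀ a k f, P f → Set.EqOn ((T a)^[k] (T l f)) (T l ((T a)^[k] f)) s := by
    intro a k f h
    induction k with
    | zero => exact fun _ _ => rfl
    | succ k ih =>
      rw [Function.iterate_succ_apply', Function.iterate_succ_apply']
      exact (hT _ _ _ ih).trans (hc _ _ _ (hPit _ _ _ h))
  let F : D.MI → List (Fin D.n) → Z → W := fun Λ L => L.foldr (fun l h => (T l)^[Λ l] h) f
  have hPF : ∀ L, P (F Λ L) := by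
    intro L
    induction L with
    | nil => exact hf
    | cons a L ih => exact hPit _ _ _ ih
  have hnot : ∀ L : List (Fin D.n), l ∉ L → F (Λ + Pi.single l 1) L = F Λ L := by
    intro L hL
    induction L with
    | nil => rfl
    | cons a L ih =>
      rw [List.mem_cons, not_or] at hL
      simp only [F, List.foldr_cons] at ih ⊢
      rw [ih hL.2, Pi.add_apply, Pi.single_eq_of_ne (Ne.symm hL.1), add_zero]
  -- At the entry l the additional operator is already outermost, and the rest of the list does not
  -- see it by `hnot`. At any other entry it is moved past the iterates by `hcit`.
  have hin : ∀ L : List (Fin D.n), L.Nodup → l ∈ L →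
      Set.EqOn (F (Λ + Pi.single l 1) L) (T l (F Λ L)) s := by
    intro L hL hl
    induction L with
    | nil => simp at hl
    | cons a L ih =>
      rw [List.nodup_cons] at hL
      by_cases e : a = l
      · subst e
        have := hnot L hL.1
        simp only [F, List.foldr_cons] at this ⊢
        rw [this, Pi.add_apply, Pi.single_eq_same, Function.iterate_succ_apply']
        exact fun _ _ => rfl
      · have hl' : l ∈ L := by
          rcases List.mem_cons.1 hl with h | h
          · exact absurd h.symm e
          · exact h
        have h1 := hit a (Λ a) _ _ (ih hL.2 hl')
        have h2 := hcit a (Λ a) _ (hPF L)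
        have h3 := h1.trans h2
        simp only [F, List.foldr_cons] at h3 ⊢
        rw [Pi.add_apply, Pi.single_eq_of_ne e, add_zero]
        exact h3
  exact hin _ (List.nodup_finRange _) (List.mem_finRange l)

/-! ### The shift of generators -/

/-- The derivation `v_Λ ↦ v_{l+Λ}` of the fibre algebra. -/
def shiftDer (l : Fin D.n) : D.Alg →ₗ[ℝ] D.Alg :=
  derL fun g => jetGen g.1 (g.2 + Pi.single l 1)

theorem jetGen_mem_parSub (v : D.Var) (Λ : D.MI) : (jetGen v Λ : D.Alg) ∈ parSub (D.par v) :=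
  gen_mem_parSub (par := fun g : D.Var × D.MI => D.par g.1) (v, Λ)

theorem shiftDer_jetGen (l : Fin D.n) (v : D.Var) (Λ : D.MI) :
    shiftDer l (jetGen v Λ) = jetGen v (Λ + Pi.single l 1) :=
  derL_gen _ _

@[simp] theorem shiftDer_algebraMap (l : Fin D.n) (r : ℝ) : shiftDer l (algebraMap ℝ D.Alg r) = 0 :=
  derL_algebraMap _ _

theorem shiftDer_mul (l : Fin D.n) (x y : D.Alg) :
    shiftDer l (x * y) = shiftDer l x * y + x * shiftDer l y :=
  derL_mul (par := fun g : D.Var × D.MI => D.par g.1)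
    (V := fun g => jetGen g.1 (g.2 + Pi.single l 1)) (fun g => jetGen_mem_parSub g.1 _) x y

theorem shiftDer_invol (l : Fin D.n) (x : D.Alg) : shiftDer l (invol x) = invol (shiftDer l x) :=
  derL_invol (par := fun g : D.Var × D.MI => D.par g.1)
    (V := fun g => jetGen g.1 (g.2 + Pi.single l 1)) (fun g => jetGen_mem_parSub g.1 _) x

theorem shiftDer_comm (l m : Fin D.n) (x : D.Alg) :
    shiftDer l (shiftDer m x) = shiftDer m (shiftDer l x) :=
  derL_comm (par := fun g : D.Var × D.MI => D.par g.1)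
    (V := fun g => jetGen g.1 (g.2 + Pi.single l 1)) (W := fun g => jetGen g.1 (g.2 + Pi.single m 1))
    (fun g => jetGen_mem_parSub g.1 _) (fun g => jetGen_mem_parSub g.1 _)
    (fun g => (shiftDer_jetGen l g.1 _).trans
      ((congrArg _ (add_right_comm _ _ _)).trans (shiftDer_jetGen m g.1 _).symm)) x

theorem shiftDer_mem_parSub {e : ℕ} (l : Fin D.n) {x : D.Alg} (hx : x ∈ parSub e) :
    shiftDer l x ∈ parSub e := by
  rw [mem_parSub] at *
  rw [← shiftDer_invol, hx, map_smul]

theorem jetGen_mem_degSub (v : D.Var) (Λ Λ' : D.MI) :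
    (jetGen v Λ : D.Alg) ∈ degSub multideg ({multideg (v, Λ')} : Set (ℕ →₀ ℕ)) :=
  gen_mem_degSub (par := fun g : D.Var × D.MI => D.par g.1) (deg := multideg) (v, Λ)

theorem shiftDer_mem_degSub {p : Set (ℕ →₀ ℕ)} (l : Fin D.n) {x : D.Alg}
    (hx : x ∈ degSub multideg p) : shiftDer l x ∈ degSub multideg p :=
  derL_mem fun g => mul_mem_degSub (jetGen_mem_degSub g.1 _ g.2) (lpd_mem_degSub g hx) (by
    rintro _ rfl b hb
    rw [add_comm]
    exact hb)

theorem shiftDer_comp (l : Fin D.n) (d : ℕ →₀ ℕ) (x : D.Alg) :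
    shiftDer l (comp multideg d x) = comp multideg d (shiftDer l x) := by
  have := comp_map_of_shift (shiftDer l) (0 : ℕ →₀ ℕ) (fun L => by
    simpa using shiftDer_mem_degSub l (mono_mem_degSub (p := {(L.map multideg).sum}) rfl)) d x
  rw [this, add_zero]

/-- The subalgebra generated by the `v_Λ` such that all entries of `Λ` are at most `r`. -/
abbrev lowAlg (D : Dims) (r : ℕ) : Subalgebra ℝ D.Alg :=
  Algebra.adjoin ℝ {x : D.Alg | ∃ v Λ, (∀ l, Λ l ≤ r) ∧ x = jetGen v Λ}

theorem lowAlg_mono {r r' : ℕ} (h : r ≤ r') : lowAlg D r ≤ lowAlg D r' :=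
  Algebra.adjoin_mono fun _ ⟨v, Λ, hΛ, e⟩ => ⟨v, Λ, fun l => (hΛ l).trans h, e⟩

theorem jetGen_mem_lowAlg {r : ℕ} (v : D.Var) {Λ : D.MI} (h : ∀ l, Λ l ≤ r) :
    jetGen v Λ ∈ lowAlg D r := Algebra.subset_adjoin ⟨v, Λ, h, rfl⟩

theorem exists_mem_lowAlg (x : D.Alg) : ∃ r, x ∈ lowAlg D r := by
  induction x using GrAlg.induction with
  | hc r => exact ⟨0, Subalgebra.algebraMap_mem _ r⟩
  | hg g => exact ⟨∑ l, g.2 l, jetGen_mem_lowAlg g.1 fun l =>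
      Finset.single_le_sum (f := g.2) (fun _ _ => Nat.zero_le _) (Finset.mem_univ l)⟩
  | ha x y hx hy =>
    obtain ⟨r, hr⟩ := hx
    obtain ⟨s, hs⟩ := hy
    exact ⟨max r s, add_mem (lowAlg_mono (le_max_left _ _) hr) (lowAlg_mono (le_max_right _ _) hs)⟩
  | hm x y hx hy =>
    obtain ⟨r, hr⟩ := hx
    obtain ⟨s, hs⟩ := hy
    exact ⟨max r s, mul_mem (lowAlg_mono (le_max_left _ _) hr) (lowAlg_mono (le_max_right _ _) hs)⟩

theorem shiftDer_mem_lowAlg {r : ℕ} (l : Fin D.n) {x : D.Alg} (hx : x ∈ lowAlg D r) :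
    shiftDer l x ∈ lowAlg D (r + 1) := by
  induction hx using Algebra.adjoin_induction with
  | mem x hx =>
    obtain ⟨v, Λ, h, rfl⟩ := hx
    rw [shiftDer_jetGen]
    refine jetGen_mem_lowAlg v fun k => ?_
    have := h k
    rw [Pi.add_apply, Pi.single_apply]
    split_ifs <;> omega
  | algebraMap r => rw [shiftDer_algebraMap]; exact zero_mem _
  | add x y _ _ hx hy => rw [map_add]; exact add_mem hx hy
  | mul x y hx' hy' hx hy =>
    rw [shiftDer_mul]
    exact add_mem (mul_mem hx (lowAlg_mono r.le_succ hy')) (mul_mem (lowAlg_mono r.le_succ hx') hy)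

theorem rpd_eq_zero_of_mem_lowAlg {r : ℕ} {x : D.Alg} (hx : x ∈ lowAlg D r) {g : D.Var × D.MI}
    (hg : ¬ ∀ l, g.2 l ≤ r) : rpd g x = 0 := by
  classical
  induction hx using Algebra.adjoin_induction with
  | mem x hx =>
    obtain ⟨v, Λ, h, rfl⟩ := hx
    rw [jetGen, rpd_gen, if_neg]
    rintro rfl
    exact hg h
  | algebraMap r => rw [rpd_algebraMap]
  | add x y _ _ hx hy => rw [show rpd g (x + y) = rpd g x + rpd g y from (rpdL g).map_add x y, hx, hy, add_zero]
  | mul x y _ _ hx hy => rw [rpd_mul, hx, hy, mul_zero, zero_mul, add_zero]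

theorem rpd_mem_lowAlg {r : ℕ} {x : D.Alg} (hx : x ∈ lowAlg D r) (g : D.Var × D.MI) :
    rpd g x ∈ lowAlg D r := by
  classical
  have htau : ∀ x ∈ lowAlg D r, tau (D.par g.1) x ∈ lowAlg D r := by
    intro x hx
    induction hx using Algebra.adjoin_induction with
    | mem x hx =>
      obtain ⟨v, Λ, h, rfl⟩ := hx
      rw [jetGen, tau_gen]
      exact Subalgebra.smul_mem _ (jetGen_mem_lowAlg v h) _
    | algebraMap r => rw [AlgHom.commutes]; exact Subalgebra.algebraMap_mem _ r
    | add x y _ _ hx hy => rw [map_add]; exact add_mem hx hy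
    | mul x y _ _ hx hy => rw [map_mul]; exact mul_mem hx hy
  induction hx using Algebra.adjoin_induction with
  | mem x hx =>
    obtain ⟨v, Λ, h, rfl⟩ := hx
    rw [jetGen, rpd_gen]
    split_ifs
    · exact one_mem _
    · exact zero_mem _
  | algebraMap r => rw [rpd_algebraMap]; exact zero_mem _
  | add x y _ _ hx hy =>
    rw [show rpd g (x + y) = _ from (rpdL g).map_add x y]
    exact add_mem hx hy
  | mul x y hx' hy' hx hy =>
    rw [rpd_mul]
    exact add_mem (mul_mem hx' hy) (mul_mem hx (htau y hy'))

/-- The subalgebra is spanned by monomials in its generators, and taking a component either keeps a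
monomial or removes it. -/
theorem comp_mem_lowAlg {M : Type*} [AddCommMonoid M] {deg : D.Var × D.MI → M} {r : ℕ} {x : D.Alg}
    (hx : x ∈ lowAlg D r) (d : M) : comp deg d x ∈ lowAlg D r := by
  classical
  rw [← Subalgebra.mem_toSubmodule, lowAlg, Algebra.adjoin_eq_span] at hx
  have : Submodule.span ℝ (Submonoid.closure
      {x : D.Alg | ∃ v Λ, (∀ l, Λ l ≤ r) ∧ x = jetGen v Λ} : Set D.Alg) ≤
      (Subalgebra.toSubmodule (lowAlg D r)).comap (compL deg d) := by
    rw [Submodule.span_le]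
    intro y hy
    have : ∃ L, y = mono L ∧ y ∈ lowAlg D r := by
      induction hy using Submonoid.closure_induction_left with
      | one => exact ⟨[], rfl, one_mem _⟩
      | mul_left a ha y _ h =>
        obtain ⟨v, Λ, hΛ, rfl⟩ := ha
        obtain ⟨L, rfl, hL⟩ := h
        exact ⟨(v, Λ) :: L, (mono_cons _ _).symm, mul_mem (jetGen_mem_lowAlg v hΛ) hL⟩
    obtain ⟨L, rfl, hL⟩ := this
    change comp deg d (mono L) ∈ lowAlg D r
    rw [comp_mono]
    split_ifs
    · exact hL
    · exact zero_mem _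
  exact this hx

/-! ### Graded functions -/

theorem isGradedFunction_of_sum {ι : Type*} [Fintype ι] {r : ℕ} {V : Set (D.Base × D.Fib)}
    {f : D.Jet → D.Alg} (a : ι → D.Jet → ℝ) (w : ι → D.Alg) (ha : ∀ i, IsSmoothOn r V (a i))
    (hw : ∀ i, w i ∈ lowAlg D r) (hf : ∀ z ∈ jetDom V, f z = ∑ i, a i z • w i) :
    IsGradedFunction r V f := by
  refine ⟨Fintype.card ι, fun i => a ((Fintype.equivFin ι).symm i),
    fun i => w ((Fintype.equivFin ι).symm i), fun i => ha _, fun i => hw _, fun z hz => ?_⟩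
  rw [hf z hz]
  exact ((Fintype.equivFin ι).symm.sum_comp fun i => a i z • w i).symm

theorem tderiv_eq (l : Fin D.n) (f : D.Jet → D.Alg) (z : D.Jet) :
    tderiv l f z = hderiv l f z + shiftDer l (f z) := rfl

theorem hderiv_congr {W : Type*} [AddCommGroup W] [Module ℝ W] {V : Set (D.Base × D.Fib)}
    (hV : IsOpen V) {f g : D.Jet → W} (h : Set.EqOn f g (jetDom V)) (l : Fin D.n) :
    Set.EqOn (hderiv l f) (hderiv l g) (jetDom V) := fun z hz => by
  refine vderiv_congr ?_
  filter_upwards [eventually_mem_jetDom hV hz (horDir l z)] with t ht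
  exact h ht

theorem tderiv_congr {V : Set (D.Base × D.Fib)} (hV : IsOpen V) {f g : D.Jet → D.Alg}
    (h : Set.EqOn f g (jetDom V)) (l : Fin D.n) : Set.EqOn (tderiv l f) (tderiv l g) (jetDom V) :=
  fun z hz => by rw [tderiv_eq, tderiv_eq, h hz, hderiv_congr hV h l hz]

theorem tderiv_mem {p : Submodule ℝ D.Alg} {V : Set (D.Base × D.Fib)} (hV : IsOpen V)
    (l : Fin D.n) (hp : ∀ x ∈ p, shiftDer l x ∈ p) {f : D.Jet → D.Alg}
    (hf : ∀ z ∈ jetDom V, f z ∈ p) : ∀ z ∈ jetDom V, tderiv l f z ∈ p := fun z hz => by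
  rw [tderiv_eq]
  refine add_mem (vderiv_mem ?_) (hp _ (hf z hz))
  filter_upwards [eventually_mem_jetDom hV hz (horDir l z)] with t ht
  exact hf _ ht

namespace IsGradedFunction

variable {r r' : ℕ} {V V' : Set (D.Base × D.Fib)} {f g : D.Jet → D.Alg}

theorem mono_set (h : IsGradedFunction r V f) (hV : V' ⊆ V) : IsGradedFunction r V' f := by
  obtain ⟨M, a, w, ha, hw, e⟩ := h
  exact ⟨M, a, w, fun i => (ha i).mono_set hV, hw, fun z hz => e z (hV hz)⟩

theorem mono_order (h : IsGradedFunction r V f) (hr : r ≤ r') : IsGradedFunction r' V f := by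
  obtain ⟨M, a, w, ha, hw, e⟩ := h
  exact ⟨M, a, w, fun i => (ha i).mono_order hr, fun i => lowAlg_mono hr (hw i), e⟩

theorem congr (h : IsGradedFunction r V f) (e : Set.EqOn g f (jetDom V)) : IsGradedFunction r V g := by
  obtain ⟨M, a, w, ha, hw, e'⟩ := h
  exact ⟨M, a, w, ha, hw, fun z hz => (e hz).trans (e' z hz)⟩

theorem const {x : D.Alg} (hx : x ∈ lowAlg D r) : IsGradedFunction r V (fun _ => x) :=
  isGradedFunction_of_sum (ι := Unit) (fun _ _ => 1) (fun _ => x) (fun _ => IsSmoothOn.const 1)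
    (fun _ => hx) (by simp)

theorem zero : IsGradedFunction r V (fun _ => (0 : D.Alg)) := const (zero_mem _)

theorem add (hf : IsGradedFunction r V f) (hg : IsGradedFunction r V g) :
    IsGradedFunction r V (fun z => f z + g z) := by
  obtain ⟨M, a, w, ha, hw, e⟩ := hf
  obtain ⟨M', a', w', ha', hw', e'⟩ := hg
  refine isGradedFunction_of_sum (ι := Fin M ⊕ Fin M') (Sum.elim a a') (Sum.elim w w') ?_ ?_ ?_
  · rintro (i | i)
    exacts [ha i, ha' i]
  · rintro (i | i)
    exacts [hw i, hw' i]
  · intro z hz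
    simp [e z hz, e' z hz]

theorem smul {b : D.Jet → ℝ} (hb : IsSmoothOn r V b) (hf : IsGradedFunction r V f) :
    IsGradedFunction r V (fun z => b z • f z) := by
  obtain ⟨M, a, w, ha, hw, e⟩ := hf
  refine ⟨M, fun i z => b z * a i z, w, fun i => hb.mul (ha i), hw, fun z hz => ?_⟩
  simp only [e z hz, Finset.smul_sum, smul_smul]

theorem mul (hf : IsGradedFunction r V f) (hg : IsGradedFunction r V g) :
    IsGradedFunction r V (fun z => f z * g z) := by
  obtain ⟨M, a, w, ha, hw, e⟩ := hf
  obtain ⟨M', a', w', ha', hw', e'⟩ := hg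
  refine isGradedFunction_of_sum (ι := Fin M × Fin M') (fun i z => a i.1 z * a' i.2 z)
    (fun i => w i.1 * w' i.2) (fun i => (ha _).mul (ha' _)) (fun i => mul_mem (hw _) (hw' _)) ?_
  intro z hz
  simp only [e z hz, e' z hz, Finset.sum_mul_sum, smul_mul_smul_comm, Fintype.sum_prod_type]

theorem sum {ι : Type*} {s : Finset ι} {f : ι → D.Jet → D.Alg}
    (h : ∀ i ∈ s, IsGradedFunction r V (f i)) : IsGradedFunction r V (fun z => ∑ i ∈ s, f i z) := by
  classical
  induction s using Finset.induction_on with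
  | empty => simpa using zero
  | insert i s hi ih =>
    simp only [Finset.sum_insert hi]
    exact (h i (Finset.mem_insert_self i s)).add (ih fun j hj => h j (Finset.mem_insert_of_mem hj))

theorem map (L : D.Alg →ₗ[ℝ] D.Alg) (hL : ∀ x ∈ lowAlg D r, L x ∈ lowAlg D r')
    (hr : r ≤ r') (hf : IsGradedFunction r V f) : IsGradedFunction r' V (fun z => L (f z)) := by
  obtain ⟨M, a, w, ha, hw, e⟩ := hf
  exact ⟨M, a, fun i => L (w i), fun i => (ha i).mono_order hr, fun i => hL _ (hw i),
    fun z hz => by simp [e z hz]⟩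

theorem sub (hf : IsGradedFunction r V f) (hg : IsGradedFunction r V g) :
    IsGradedFunction r V (fun z => f z - g z) := by
  have := hf.add (smul (IsSmoothOn.const (-1)) hg)
  exact this.congr fun z _ => by
    rw [sub_eq_add_neg]
    exact congrArg (f z + ·) (neg_one_smul ℝ (g z)).symm

theorem comp (hf : IsGradedFunction r V f) {M : Type*} [AddCommMonoid M] (deg : D.Var × D.MI → M)
    (d : M) : IsGradedFunction r V (fun z => GrAlg.comp deg d (f z)) :=
  hf.map (compL deg d) (fun _ hx => comp_mem_lowAlg hx d) le_rfl

theorem hasVD (hV : IsOpen V) (hf : IsGradedFunction r V f) {z : D.Jet} (hz : z ∈ jetDom V)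
    (v : D.Jet) : HasVD f z v (vderiv f z v) := by
  obtain ⟨M, a, w, ha, hw, e⟩ := hf
  have h1 : HasVD (fun z => ∑ i, a i z • w i) z v
      (∑ i, (vderiv (a i) z v • w i + a i z • (0 : D.Alg))) :=
    HasVD.sum fun i _ => ((ha i).hasVD hV hz v).smul (hasVD_const (w i) z v)
  have h2 : HasVD f z v _ := h1.congr (by
    filter_upwards [eventually_mem_jetDom hV hz v] with t ht
    exact e _ ht)
  rw [h2.vderiv_eq]
  exact h2

/-- A product of weakly differentiable functions is not accessible through linear functionals
directly. It is here because one factor is a finite combination of constant elements with smooth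
coefficients. -/
theorem hasVD_mul (hV : IsOpen V) (hf : IsGradedFunction r V f) {z v : D.Jet} (hz : z ∈ jetDom V)
    {y : D.Alg} (hg : HasVD g z v y) :
    HasVD (fun z => f z * g z) z v (vderiv f z v * g z + f z * y) := by
  have hf' := (hf.hasVD hV hz v)
  obtain ⟨M, a, w, ha, hw, e⟩ := hf
  have h1 : HasVD (fun z => ∑ i, a i z • (w i * g z)) z v
      (∑ i, (vderiv (a i) z v • (w i * g z) + a i z • (w i * y))) :=
    HasVD.sum fun i _ => ((ha i).hasVD hV hz v).smul (hg.map (LinearMap.mulLeft ℝ (w i)))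
  have h3 : vderiv f z v = ∑ i, vderiv (a i) z v • w i := by
    have h2 : HasVD (fun z => ∑ i, a i z • w i) z v
        (∑ i, (vderiv (a i) z v • w i + a i z • (0 : D.Alg))) :=
      HasVD.sum fun i _ => ((ha i).hasVD hV hz v).smul (hasVD_const (w i) z v)
    have h2' : HasVD f z v _ := h2.congr (by
      filter_upwards [eventually_mem_jetDom hV hz v] with t ht
      exact e _ ht)
    simpa using h2'.vderiv_eq
  have h4 : vderiv f z v * g z + f z * y =
      ∑ i, (vderiv (a i) z v • (w i * g z) + a i z • (w i * y)) := by
    rw [h3, e z hz, Finset.sum_mul, Finset.sum_mul, ← Finset.sum_add_distrib]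
    simp only [smul_mul_assoc]
  rw [h4]
  refine h1.congr ?_
  filter_upwards [eventually_mem_jetDom hV hz v] with t ht
  rw [e _ ht, Finset.sum_mul]
  simp only [smul_mul_assoc]

theorem tderiv_add (hV : IsOpen V) (hf : IsGradedFunction r V f) (hg : IsGradedFunction r' V g)
    (l : Fin D.n) {z : D.Jet} (hz : z ∈ jetDom V) :
    tderiv l (fun z => f z + g z) z = tderiv l f z + tderiv l g z := by
  simp only [tderiv_eq, hderiv_eq, map_add]
  rw [((hf.hasVD hV hz _).add (hg.hasVD hV hz _)).vderiv_eq]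
  abel

theorem tderiv_smul (hV : IsOpen V) {b : D.Jet → ℝ} (hb : IsSmoothOn r V b)
    (hf : IsGradedFunction r' V f) (l : Fin D.n) {z : D.Jet} (hz : z ∈ jetDom V) :
    tderiv l (fun z => b z • f z) z = hderiv l b z • f z + b z • tderiv l f z := by
  simp only [tderiv_eq, hderiv_eq, map_smul, smul_add]
  rw [((hb.hasVD hV hz _).smul (hf.hasVD hV hz _)).vderiv_eq]
  abel

theorem tderiv_mul (hV : IsOpen V) (hf : IsGradedFunction r V f)
    (hg : IsGradedFunction r' V g) (l : Fin D.n) {z : D.Jet} (hz : z ∈ jetDom V) :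
    tderiv l (fun z => f z * g z) z = tderiv l f z * g z + f z * tderiv l g z := by
  simp only [tderiv_eq, hderiv_eq, shiftDer_mul, add_mul, mul_add]
  rw [(hf.hasVD_mul hV hz (hg.hasVD hV hz _)).vderiv_eq]
  abel

theorem tderiv_map (hV : IsOpen V) (hf : IsGradedFunction r V f) (L : D.Alg →ₗ[ℝ] D.Alg)
    (l : Fin D.n) (hL : ∀ x, shiftDer l (L x) = L (shiftDer l x)) {z : D.Jet} (hz : z ∈ jetDom V) :
    tderiv l (fun z => L (f z)) z = L (tderiv l f z) := by
  simp only [tderiv_eq, hderiv_eq, hL, map_add]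
  rw [((hf.hasVD hV hz _).map L).vderiv_eq]

theorem tderiv_sum (hV : IsOpen V) {ι : Type*} {s : Finset ι} {f : ι → D.Jet → D.Alg}
    (hf : ∀ i ∈ s, IsGradedFunction r V (f i)) (l : Fin D.n) {z : D.Jet} (hz : z ∈ jetDom V) :
    tderiv l (fun z => ∑ i ∈ s, f i z) z = ∑ i ∈ s, tderiv l (f i) z := by
  simp only [tderiv_eq, hderiv_eq, map_sum, Finset.sum_add_distrib]
  rw [(HasVD.sum fun i hi => (hf i hi).hasVD hV hz _).vderiv_eq]

theorem _root_.GradedLagrangian.tderiv_const (x : D.Alg) (l : Fin D.n) (z : D.Jet) :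
    tderiv l (fun _ => x) z = shiftDer l x := by
  rw [tderiv_eq, hderiv_eq, (hasVD_const x z _).vderiv_eq, zero_add]

theorem tderiv_of_eq (hV : IsOpen V) {M : ℕ} {a : Fin M → D.Jet → ℝ} {w : Fin M → D.Alg}
    (ha : ∀ i, IsSmoothOn r V (a i)) (e : ∀ z ∈ jetDom V, f z = ∑ i, a i z • w i) (l : Fin D.n)
    {z : D.Jet} (hz : z ∈ jetDom V) :
    GradedLagrangian.tderiv l f z = ∑ i, (hderiv l (a i) z • w i + a i z • shiftDer l (w i)) := by
  rw [tderiv_eq, hderiv_eq]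
  have h1 : HasVD (fun z => ∑ i, a i z • w i) z (horDir l z)
      (∑ i, (vderiv (a i) z (horDir l z) • w i + a i z • (0 : D.Alg))) :=
    HasVD.sum fun i _ => ((ha i).hasVD hV hz _).smul (hasVD_const (w i) z _)
  have h2 : HasVD f z (horDir l z) _ := h1.congr (by
    filter_upwards [eventually_mem_jetDom hV hz (horDir l z)] with t ht
    exact e _ ht)
  rw [h2.vderiv_eq, e z hz, map_sum, ← Finset.sum_add_distrib]
  simp [hderiv_eq]

protected theorem tderiv (hV : IsOpen V) (hf : IsGradedFunction r V f) (l : Fin D.n) :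
    IsGradedFunction (r + 1) V (tderiv l f) := by
  obtain ⟨M, a, w, ha, hw, e⟩ := hf
  have : IsGradedFunction (r + 1) V
      fun z => ∑ i, (hderiv l (a i) z • w i + a i z • shiftDer l (w i)) :=
    sum fun i _ => (smul ((ha i).hderiv hV l) (const (lowAlg_mono r.le_succ (hw i)))).add
      (smul ((ha i).mono_order r.le_succ) (const (shiftDer_mem_lowAlg l (hw i))))
  exact this.congr fun z hz => tderiv_of_eq hV ha e l hz

/-- In a local expression ∑ a_i w_i the two mixed terms are exchanged, and the other terms are
symmetric because horizontal derivatives commute on the a_i and shifts commute on the w_i. -/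
theorem tderiv_comm (hV : IsOpen V) (hf : IsGradedFunction r V f) (l m : Fin D.n) {z : D.Jet}
    (hz : z ∈ jetDom V) :
    GradedLagrangian.tderiv l (GradedLagrangian.tderiv m f) z =
      GradedLagrangian.tderiv m (GradedLagrangian.tderiv l f) z := by
  obtain ⟨M, a, w, ha, hw, e⟩ := hf
  have key : ∀ l m : Fin D.n, GradedLagrangian.tderiv l (GradedLagrangian.tderiv m f) z =
      ∑ i, (hderiv l (hderiv m (a i)) z • w i + hderiv m (a i) z • shiftDer l (w i) +
        (hderiv l (a i) z • shiftDer m (w i) + a i z • shiftDer l (shiftDer m (w i)))) := by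
    intro l m
    have h1 : ∀ i, IsGradedFunction (r + 1) V fun z => hderiv m (a i) z • w i := fun i =>
      smul ((ha i).hderiv hV m) (const (lowAlg_mono r.le_succ (hw i)))
    have h2 : ∀ i, IsGradedFunction (r + 1) V fun z => a i z • shiftDer m (w i) := fun i =>
      smul ((ha i).mono_order r.le_succ) (const (shiftDer_mem_lowAlg m (hw i)))
    rw [tderiv_congr hV (fun z hz => tderiv_of_eq hV ha e m hz) l hz,
      tderiv_sum hV (fun i _ => (h1 i).add (h2 i)) l hz]
    refine Finset.sum_congr rfl fun i _ => ?_
    rw [tderiv_add hV (h1 i) (h2 i) l hz,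
      tderiv_smul hV ((ha i).hderiv hV m) (const (V := V) (hw i)) l hz,
      tderiv_smul hV (ha i) (const (V := V) (shiftDer_mem_lowAlg m (hw i))) l hz, tderiv_const,
      tderiv_const]
  rw [key, key]
  refine Finset.sum_congr rfl fun i _ => ?_
  rw [(ha i).hderiv_comm hV l m hz, shiftDer_comm l m]
  abel

theorem multi_add_single (hV : IsOpen V) (hf : IsGradedFunction r V f) (Λ : D.MI) (l : Fin D.n) :
    Set.EqOn (GradedLagrangian.multi GradedLagrangian.tderiv (Λ + Pi.single l 1) f)
      (GradedLagrangian.tderiv l (GradedLagrangian.multi GradedLagrangian.tderiv Λ f)) (jetDom V) :=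
  GradedLagrangian.multi_add_single (P := fun f => ∃ s, IsGradedFunction s V f)
    (fun l _ ⟨s, hs⟩ => ⟨s + 1, hs.tderiv hV l⟩) (fun l _ _ h => tderiv_congr hV h l)
    (fun l m _ ⟨_, hs⟩ _ hz => hs.tderiv_comm hV l m hz) ⟨r, hf⟩ Λ l

end IsGradedFunction

theorem multi_tderiv_mem {p : Submodule ℝ D.Alg} {V : Set (D.Base × D.Fib)} (hV : IsOpen V)
    (hp : ∀ l, ∀ x ∈ p, shiftDer l x ∈ p) {f : D.Jet → D.Alg} (hf : ∀ z ∈ jetDom V, f z ∈ p)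
    (Λ : D.MI) : ∀ z ∈ jetDom V, multi tderiv Λ f z ∈ p :=
  multi_mem (P := fun f : D.Jet → D.Alg => ∀ z ∈ jetDom V, f z ∈ p) (fun l _ h => tderiv_mem hV l (hp l) h) hf Λ

theorem multi_tderiv_map {r : ℕ} {V : Set (D.Base × D.Fib)} (hV : IsOpen V) {f : D.Jet → D.Alg}
    (hf : IsGradedFunction r V f) (L : D.Alg →ₗ[ℝ] D.Alg)
    (hL : ∀ l x, shiftDer l (L x) = L (shiftDer l x)) (Λ : D.MI) :
    Set.EqOn (multi tderiv Λ fun z => L (f z)) (fun z => L (multi tderiv Λ f z)) (jetDom V) :=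
  (multi_rel (R := fun (g f : D.Jet → D.Alg) => (∃ s, IsGradedFunction s V f) ∧
      Set.EqOn g (fun z => L (f z)) (jetDom V)) (f' := f)
    (fun l _ _ ⟨⟨s, hs⟩, e⟩ => ⟨⟨s + 1, hs.tderiv hV l⟩, fun _ hz =>
      (tderiv_congr hV e l hz).trans (hs.tderiv_map hV L l (hL l) hz)⟩)
    ⟨⟨r, hf⟩, fun _ _ => rfl⟩ Λ).2

/-! ### Right derivations -/

/-- The value of `rightDer u` at the jet `z`. -/
def derAt (u : D.Var → D.Jet → D.Alg) (z : D.Jet) : D.Alg →ₗ[ℝ] D.Alg :=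
  derR fun g => multi tderiv g.2 (u g.1) z

theorem rightDer_apply (u : D.Var → D.Jet → D.Alg) (f : D.Jet → D.Alg) (z : D.Jet) :
    rightDer u f z = derAt u z (f z) := rfl

theorem derAt_jetGen (u : D.Var → D.Jet → D.Alg) (z : D.Jet) (v : D.Var) (Λ : D.MI) :
    derAt u z (jetGen v Λ) = multi tderiv Λ (u v) z :=
  derR_gen _ _

/-- The sources `u` have the parity of an odd derivation over `V`. -/
def OddOn (V : Set (D.Base × D.Fib)) (u : D.Var → D.Jet → D.Alg) : Prop :=
  ∀ v, ∀ z ∈ jetDom V, u v z ∈ parSub (D.par v + 1)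

theorem OddOn.multi {V : Set (D.Base × D.Fib)} (hV : IsOpen V) {u : D.Var → D.Jet → D.Alg}
    (hu : OddOn V u) (v : D.Var) (Λ : D.MI) {z : D.Jet} (hz : z ∈ jetDom V) :
    multi tderiv Λ (u v) z ∈ parSub (D.par v + 1) :=
  multi_tderiv_mem hV (fun l _ => shiftDer_mem_parSub l) (hu v) Λ z hz

theorem OddOn.derAt_mul {V : Set (D.Base × D.Fib)} (hV : IsOpen V) {u : D.Var → D.Jet → D.Alg}
    (hu : OddOn V u) {z : D.Jet} (hz : z ∈ jetDom V) (x y : D.Alg) :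
    derAt u z (x * y) = x * derAt u z y + derAt u z x * invol y :=
  derR_mul (par := fun g : D.Var × D.MI => D.par g.1) (U := fun g => GradedLagrangian.multi tderiv g.2 (u g.1) z)
    (fun g => hu.multi hV g.1 g.2 hz) x y

instance : Finite D.Var := by
  let f : (Fin D.p ⊕ Fin D.m) ⊕ (Fin D.p ⊕ (Σ k : Fin (D.N + 1), Σ ε : Fin 2, Fin (D.rk k ε))) → D.Var :=
    Sum.elim (Sum.elim .fieldOdd .antiEven) (Sum.elim .antiOdd fun x => .noether x.1 x.2.1 x.2.2)
  refine Finite.of_surjective f fun v => ?_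
  cases v with
  | fieldOdd a => exact ⟨.inl (.inl a), rfl⟩
  | antiEven i => exact ⟨.inl (.inr i), rfl⟩
  | antiOdd a => exact ⟨.inr (.inl a), rfl⟩
  | noether k ε r => exact ⟨.inr (.inr ⟨k, ε, r⟩), rfl⟩

theorem finite_low (D : Dims) (r : ℕ) : {g : D.Var × D.MI | ∀ l, g.2 l ≤ r}.Finite := by
  have h : {Λ : D.MI | ∀ l, Λ l ≤ r}.Finite := (Set.finite_Iic (fun _ : Fin D.n => r)).subset
    fun Λ h l => h l
  exact ((Set.finite_univ (α := D.Var)).prod h).subset fun g hg => ⟨trivial, hg⟩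

/-- The total derivatives are applied to the whole family of local expressions at once, so one bound
on the jet order serves all charts, as the definition of a density requires. -/
theorem exists_multi_order {ι : Type*} {V : ι → Set (D.Base × D.Fib)} (hV : ∀ i, IsOpen (V i))
    {f : ι → D.Jet → D.Alg} {r : ℕ} (hf : ∀ i, IsGradedFunction r (V i) (f i)) (Λ : D.MI) :
    ∃ s, ∀ i, IsGradedFunction s (V i) (multi tderiv Λ (f i)) := by
  have h1 := multi_mem (T := fun l (F : ι → D.Jet → D.Alg) i => tderiv l (F i))
    (P := fun F => ∃ s, ∀ i, IsGradedFunction s (V i) (F i))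
    (fun l F ⟨s, hs⟩ => ⟨s + 1, fun i => (hs i).tderiv (hV i) l⟩) ⟨r, hf⟩ Λ
  have h2 : ∀ i, multi (fun l (F : ι → D.Jet → D.Alg) i => tderiv l (F i)) Λ f i =
      multi tderiv Λ (f i) := fun i =>
    multi_rel (R := fun (F : ι → D.Jet → D.Alg) (g : D.Jet → D.Alg) => F i = g)
      (fun l F g h => by rw [← h]) rfl Λ
  simpa only [h2] using h1

theorem IsGradedFunction.mem_lowAlg {r : ℕ} {V : Set (D.Base × D.Fib)} {f : D.Jet → D.Alg}
    (hf : IsGradedFunction r V f) {z : D.Jet} (hz : z ∈ jetDom V) : f z ∈ lowAlg D r := by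
  obtain ⟨M, a, w, ha, hw, e⟩ := hf
  rw [e z hz]
  exact sum_mem fun i _ => Subalgebra.smul_mem _ (hw i) _

/-- The index set depends on the order only and not on the jet. So the derivation of a graded
function becomes one finite sum of graded functions. -/
theorem derAt_eq_sum {r : ℕ} (u : D.Var → D.Jet → D.Alg) (z : D.Jet) {x : D.Alg}
    (hx : x ∈ lowAlg D r) :
    derAt u z x = ∑ g ∈ (finite_low D r).toFinset, rpd g x * multi tderiv g.2 (u g.1) z := by
  refine finsum_eq_sum_of_support_subset _ fun g hg => ?_
  by_contra hc
  refine hg ?_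
  change rpd g x * _ = 0
  rw [rpd_eq_zero_of_mem_lowAlg hx fun h => hc (by simpa using h), zero_mul]

theorem exists_rightDer_order {ι : Type*} {V : ι → Set (D.Base × D.Fib)} (hV : ∀ i, IsOpen (V i))
    {u : ι → D.Var → D.Jet → D.Alg} {f : ι → D.Jet → D.Alg} {r s : ℕ}
    (hu : ∀ i v, IsGradedFunction s (V i) (u i v)) (hf : ∀ i, IsGradedFunction r (V i) (f i)) :
    ∃ t, ∀ i, IsGradedFunction t (V i) (rightDer (u i) (f i)) := by
  choose T hT using fun g : D.Var × D.MI =>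
    exists_multi_order hV (f := fun i => u i g.1) (fun i => hu i g.1) g.2
  refine ⟨r + ∑ g ∈ (finite_low D r).toFinset, T g, fun i => ?_⟩
  refine (IsGradedFunction.sum (s := (finite_low D r).toFinset)
    (f := fun g z => rpd g (f i z) * multi tderiv g.2 (u i g.1) z) fun g hg => ?_).congr
    fun z hz => derAt_eq_sum (u i) z ((hf i).mem_lowAlg hz)
  exact (((hf i).map (rpdL g) (fun x hx => rpd_mem_lowAlg hx g) le_rfl).mono_order
    (Nat.le_add_right _ _)).mul ((hT g i).mono_order
    ((Finset.single_le_sum (f := T) (fun _ _ => Nat.zero_le _) hg).trans (Nat.le_add_left _ _)))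

theorem exists_derAt_order {V : Set (D.Base × D.Fib)} (hV : IsOpen V)
    {u : D.Var → D.Jet → D.Alg} {s : ℕ} (hu : ∀ v, IsGradedFunction s V (u v)) (x : D.Alg) :
    ∃ t, IsGradedFunction t V fun z => derAt u z x := by
  obtain ⟨r, hr⟩ := exists_mem_lowAlg x
  obtain ⟨t, ht⟩ := exists_rightDer_order (ι := Unit) (V := fun _ => V) (fun _ => hV)
    (u := fun _ => u) (f := fun _ _ => x) (fun _ => hu) fun _ => IsGradedFunction.const hr
  exact ⟨t, ht ()⟩

/-- On a generator v_Λ this says d_l d_Λ u_v = d_{l+Λ} u_v. Products are handled by the two Leibniz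
rules, as the shift is a derivation that commutes with the parity involution. -/
theorem tderiv_derAt {V : Set (D.Base × D.Fib)} (hV : IsOpen V) {u : D.Var → D.Jet → D.Alg} {s : ℕ}
    (hu : ∀ v, IsGradedFunction s V (u v)) (hodd : OddOn V u) (l : Fin D.n) (x : D.Alg) :
    ∀ z ∈ jetDom V, tderiv l (fun z => derAt u z x) z = derAt u z (shiftDer l x) := by
  induction x using GrAlg.induction with
  | hc r =>
    intro z hz
    have h0 : ∀ z, derAt u z (algebraMap ℝ D.Alg r) = 0 := fun z => derR_algebraMap _ _
    simp only [h0]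
    rw [tderiv_const, map_zero, shiftDer_algebraMap, map_zero]
  | hg g =>
    intro z hz
    have h0 : ∀ z, derAt u z (jetGen g.1 g.2) = multi tderiv g.2 (u g.1) z :=
      fun z => derAt_jetGen _ _ _ _
    change tderiv l (fun z => derAt u z (jetGen g.1 g.2)) z = derAt u z (shiftDer l (jetGen g.1 g.2))
    simp only [h0]
    rw [shiftDer_jetGen, derAt_jetGen]
    exact ((hu g.1).multi_add_single hV g.2 l hz).symm
  | ha x y hx hy =>
    intro z hz
    obtain ⟨s, hs⟩ := exists_derAt_order hV hu x
    obtain ⟨t, ht⟩ := exists_derAt_order hV hu y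
    simp only [map_add]
    rw [hs.tderiv_add hV ht l hz, hx z hz, hy z hz]
  | hm x y hx hy =>
    intro z hz
    obtain ⟨s, hs⟩ := exists_derAt_order hV hu x
    obtain ⟨t, ht⟩ := exists_derAt_order hV hu y
    obtain ⟨p, hp⟩ := exists_mem_lowAlg x
    obtain ⟨q, hq⟩ := exists_mem_lowAlg (invol y)
    have cx := IsGradedFunction.const (V := V) hp
    have cy := IsGradedFunction.const (V := V) hq
    have cxt : IsGradedFunction (p + t) V fun z => x * derAt u z y :=
      (cx.mono_order (Nat.le_add_right p t)).mul (ht.mono_order (Nat.le_add_left t p))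
    have sy : IsGradedFunction (s + q) V fun z => derAt u z x * invol y :=
      (hs.mono_order (Nat.le_add_right s q)).mul (cy.mono_order (Nat.le_add_left q s))
    rw [tderiv_congr hV (g := fun z => x * derAt u z y + derAt u z x * invol y)
      (fun z hz => hodd.derAt_mul hV hz x y) l hz, cxt.tderiv_add hV sy l hz, cx.tderiv_mul hV ht l hz,
      hs.tderiv_mul hV cy l hz, hx z hz, hy z hz, tderiv_const, tderiv_const, shiftDer_mul, map_add,
      hodd.derAt_mul hV hz, hodd.derAt_mul hV hz, shiftDer_invol]
    abel

/-- The derivation acts fibrewise, hence is linear over functions of x^λ and y^i_Λ. On a local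
expression ∑ a_i w_i the claim therefore reduces to the constant elements w_i. -/
theorem IsGradedFunction.tderiv_rightDer {V : Set (D.Base × D.Fib)} (hV : IsOpen V)
    {u : D.Var → D.Jet → D.Alg} {s r : ℕ} (hu : ∀ v, IsGradedFunction s V (u v)) (hodd : OddOn V u)
    {f : D.Jet → D.Alg} (hf : IsGradedFunction r V f) (l : Fin D.n) {z : D.Jet} (hz : z ∈ jetDom V) :
    GradedLagrangian.tderiv l (rightDer u f) z = rightDer u (GradedLagrangian.tderiv l f) z := by
  obtain ⟨M, a, w, ha, hw, e⟩ := hf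
  choose t ht using fun i => exists_derAt_order hV hu (w i)
  let T := r + ∑ i, t i
  have ha' : ∀ i, IsSmoothOn T V (a i) := fun i => (ha i).mono_order (Nat.le_add_right _ _)
  have ht' : ∀ i, IsGradedFunction T V fun z => derAt u z (w i) := fun i =>
    (ht i).mono_order ((Finset.single_le_sum (f := t) (fun _ _ => Nat.zero_le _)
      (Finset.mem_univ i)).trans (Nat.le_add_left _ _))
  rw [GradedLagrangian.tderiv_congr hV (g := fun z => ∑ i, a i z • derAt u z (w i)) (fun z hz => by
    rw [rightDer_apply, e z hz, map_sum]; simp only [map_smul]) l hz,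
    tderiv_sum hV (fun i _ => smul (ha' i) (ht' i)) l hz, rightDer_apply, tderiv_of_eq hV ha e l hz,
    map_sum]
  refine Finset.sum_congr rfl fun i _ => ?_
  rw [tderiv_smul hV (ha i) (ht i) l hz, tderiv_derAt hV hu hodd l (w i) z hz, map_add, map_smul,
    map_smul]

/-! ### Coordinate changes between adapted charts -/

variable {X Y : Type*}
  [TopologicalSpace X] [ChartedSpace D.Base X] [IsManifold 𝓘(ℝ, D.Base) ∞ X]
  [TopologicalSpace Y] [ChartedSpace (D.Base × D.Fib) Y]
  [IsManifold 𝓘(ℝ, D.Base × D.Fib) ∞ Y] {B : Bundles D X Y}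

/-- Transition maps between charts of the maximal atlas are smooth. -/
theorem contDiffOn_transition {E M : Type*} [NormedAddCommGroup E] [NormedSpace ℝ E]
    [TopologicalSpace M] [ChartedSpace E M] [IsManifold 𝓘(ℝ, E) ∞ M] {e e' : OpenPartialHomeomorph M E}
    (he : e ∈ IsManifold.maximalAtlas 𝓘(ℝ, E) ∞ M) (he' : e' ∈ IsManifold.maximalAtlas 𝓘(ℝ, E) ∞ M) :
    ContDiffOn ℝ ∞ (fun x => e' (e.symm x)) {x | x ∈ e.target ∧ e.symm x ∈ e'.source} := by
  rw [← contMDiffOn_iff_contDiffOn]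
  exact (contMDiffOn_of_mem_maximalAtlas he').comp
    ((contMDiffOn_symm_of_mem_maximalAtlas he).mono fun x hx => hx.1) fun x hx => hx.2

namespace Chart

variable (α β : Chart B)

/-- The points of the chart `α` over the overlap with `β`. -/
def overlapSet : Set (D.Base × D.Fib) := {u | u ∈ α.eY.target ∧ α.eY.symm u ∈ β.eY.source}

/-- The base points of the chart `α` over the overlap with `β`. -/
def baseSet : Set D.Base := {x | x ∈ α.eX.target ∧ α.eX.symm x ∈ β.eX.source}

theorem isOpen_overlapSet : IsOpen (α.overlapSet β) :=
  α.eY.symm.isOpen_inter_preimage β.eY.open_source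

theorem isOpen_baseSet : IsOpen (α.baseSet β) := α.eX.symm.isOpen_inter_preimage β.eX.open_source

theorem overlapSet_subset : α.overlapSet β ⊆ α.eY.target := fun _ h => h.1

variable {α β}

theorem proj_symm {u : D.Base × D.Fib} (hu : u ∈ α.eY.target) :
    B.proj (α.eY.symm u) = α.eX.symm u.1 ∧ u.1 ∈ α.eX.target := by
  obtain ⟨h1, h2⟩ := α.adapted _ (α.eY.map_target hu)
  rw [α.eY.right_inv hu] at h2
  rw [h2]
  exact ⟨(α.eX.left_inv h1).symm, α.eX.map_source h1⟩

theorem fst_mem_baseSet {u : D.Base × D.Fib} (hu : u ∈ α.overlapSet β) : u.1 ∈ α.baseSet β := by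
  obtain ⟨h1, h2⟩ := proj_symm hu.1
  refine ⟨h2, ?_⟩
  rw [← h1]
  exact (β.adapted _ hu.2).1

theorem transition_eq {u : D.Base × D.Fib} (hu : u ∈ α.overlapSet β) :
    (α.baseMap β u.1, α.fibMap β u) = β.eY (α.eY.symm u) := by
  ext1
  · rw [(β.adapted _ hu.2).2, (proj_symm hu.1).1]
    rfl
  · rfl

theorem transition_mem {u : D.Base × D.Fib} (hu : u ∈ α.overlapSet β) :
    β.eY (α.eY.symm u) ∈ β.overlapSet α := by
  refine ⟨β.eY.map_source hu.2, ?_⟩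
  rw [β.eY.left_inv hu.2]
  exact α.eY.map_target hu.1

theorem contDiffOn_transitionY :
    ContDiffOn ℝ ∞ (fun u => β.eY (α.eY.symm u)) (α.overlapSet β) :=
  contDiffOn_transition α.eY_mem β.eY_mem

theorem contDiffOn_baseMap : ContDiffOn ℝ ∞ (α.baseMap β) (α.baseSet β) :=
  contDiffOn_transition α.eX_mem β.eX_mem

theorem contDiffOn_fibMap : ContDiffOn ℝ ∞ (α.fibMap β) (α.overlapSet β) :=
  contDiff_snd.comp_contDiffOn contDiffOn_transitionY

theorem baseMap_mem {x : D.Base} (hx : x ∈ α.baseSet β) : α.baseMap β x ∈ β.baseSet α := by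
  refine ⟨β.eX.map_source hx.2, ?_⟩
  rw [baseMap, β.eX.left_inv hx.2]
  exact α.eX.map_target hx.1

theorem baseMap_baseMap {x : D.Base} (hx : x ∈ α.baseSet β) : β.baseMap α (α.baseMap β x) = x := by
  rw [baseMap, baseMap, β.eX.left_inv hx.2, α.eX.right_inv hx.1]

theorem differentiableAt_baseMap {x : D.Base} (hx : x ∈ α.baseSet β) :
    DifferentiableAt ℝ (α.baseMap β) x :=
  (contDiffOn_baseMap.contDiffAt ((isOpen_baseSet α β).mem_nhds hx)).differentiableAt (by simp)

theorem fderiv_baseMap_fderiv {x : D.Base} (hx : x ∈ α.baseSet β) (e : D.Base) :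
    fderiv ℝ (α.baseMap β) x (fderiv ℝ (β.baseMap α) (α.baseMap β x) e) = e := by
  have h0 : HasFDerivAt (α.baseMap β) (fderiv ℝ (α.baseMap β) x)
      (β.baseMap α (α.baseMap β x)) := by
    rw [baseMap_baseMap hx]
    exact (differentiableAt_baseMap hx).hasFDerivAt
  have h1 : HasFDerivAt (fun y => α.baseMap β (β.baseMap α y))
      ((fderiv ℝ (α.baseMap β) x).comp (fderiv ℝ (β.baseMap α) (α.baseMap β x)))
      (α.baseMap β x) :=
    HasFDerivAt.comp (g := α.baseMap β) (f := β.baseMap α) _ h0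
      (differentiableAt_baseMap (baseMap_mem hx)).hasFDerivAt
  have h2 : (fun y => α.baseMap β (β.baseMap α y)) =ᶠ[𝓝 (α.baseMap β x)] id := by
    filter_upwards [(isOpen_baseSet β α).mem_nhds (baseMap_mem hx)] with y hy
    exact baseMap_baseMap hy
  have h3 := h1.unique ((hasFDerivAt_id _).congr_of_eventuallyEq h2)
  exact congrArg (fun L => L e) h3

theorem sum_invJac_smul (l : Fin D.n) {x : D.Base} {W : Type*} [AddCommGroup W] [Module ℝ W]
    (L : D.Base →ₗ[ℝ] W) :
    ∑ μ, α.invJac β l μ x • L (Pi.single μ 1) =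
      L (fderiv ℝ (β.baseMap α) (α.baseMap β x) (Pi.single l 1)) := by
  simp only [← map_smul, ← map_sum]
  congr 1
  ext ν
  simp [invJac, Pi.single_apply]

theorem sum_invJac_fderiv (l : Fin D.n) {x : D.Base} (hx : x ∈ α.baseSet β) {W : Type*}
    [AddCommGroup W] [Module ℝ W] (L : D.Base →ₗ[ℝ] W) :
    ∑ μ, α.invJac β l μ x • L (fderiv ℝ (α.baseMap β) x (Pi.single μ 1)) = L (Pi.single l 1) := by
  have := sum_invJac_smul (α := α) (β := β) l (x := x)
    (L.comp (fderiv ℝ (α.baseMap β) x : D.Base →ₗ[ℝ] D.Base))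
  simp only [LinearMap.comp_apply, ContinuousLinearMap.coe_coe] at this
  rw [this, fderiv_baseMap_fderiv hx]

/-- Smooth functions of base points are smooth functions of jets. -/
theorem isSmoothOn_base {r : ℕ} {g : D.Base → ℝ} (hg : ContDiffOn ℝ ∞ g (α.baseSet β)) :
    IsSmoothOn r (α.overlapSet β) (fun z => g z.1) :=
  IsSmoothOn.of_contDiffOn (g := fun u => g u.1)
    (hg.comp contDiff_fst.contDiffOn fun _ hu => fst_mem_baseSet hu)

theorem contDiffOn_fderiv_baseMap (e : D.Base) (μ : Fin D.n) :
    ContDiffOn ℝ ∞ (fun x => fderiv ℝ (α.baseMap β) x e μ) (α.baseSet β) := by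
  have h1 : ContDiffOn ℝ ∞ (fderiv ℝ (α.baseMap β)) (α.baseSet β) :=
    contDiffOn_baseMap.fderiv_of_isOpen (isOpen_baseSet α β) (by simp)
  exact (contDiff_apply ℝ ℝ μ).comp_contDiffOn (h1.clm_apply contDiffOn_const)

theorem contDiffOn_comp_baseMap {g : D.Base → ℝ} (hg : ContDiffOn ℝ ∞ g (β.baseSet α)) :
    ContDiffOn ℝ ∞ (fun x => g (α.baseMap β x)) (α.baseSet β) :=
  hg.comp contDiffOn_baseMap fun _ hx => baseMap_mem hx

theorem isSmoothOn_invJac (r : ℕ) (l μ : Fin D.n) :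
    IsSmoothOn r (α.overlapSet β) (fun z => α.invJac β l μ z.1) :=
  isSmoothOn_base (contDiffOn_comp_baseMap (contDiffOn_fderiv_baseMap _ _))

theorem contDiffOn_jac : ContDiffOn ℝ ∞ (α.jac β) (α.baseSet β) := by
  -- The Leibniz formula makes the Jacobian a polynomial in the partial derivatives, which are
  -- smooth.
  have h : ∀ x, α.jac β x = ∑ σ : Equiv.Perm (Fin D.n), Equiv.Perm.sign σ •
      ∏ i, fderiv ℝ (α.baseMap β) x (Pi.single i 1) (σ i) := by
    intro x
    rw [jac, ContinuousLinearMap.det, ← LinearMap.det_toMatrix', Matrix.det_apply]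
    simp [LinearMap.toMatrix'_apply]
  simp only [funext h]
  refine ContDiffOn.sum fun σ _ => ?_
  exact (contDiffOn_prod fun i _ => contDiffOn_fderiv_baseMap _ _).const_smul _

theorem hderiv_base {g : D.Base → ℝ} {z : D.Jet}
    (hg : DifferentiableAt ℝ g z.1) (μ : Fin D.n) :
    hderiv μ (fun z : D.Jet => g z.1) z = fderiv ℝ g z.1 (Pi.single μ 1) := by
  rw [hderiv_eq]
  refine (hasVD_real.2 ?_).vderiv_eq
  have hl : HasDerivAt (fun t : ℝ => z.1 + t • (Pi.single μ 1 : D.Base)) (Pi.single μ 1) 0 := by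
    simpa using ((hasDerivAt_id (0 : ℝ)).smul_const (Pi.single μ 1 : D.Base)).const_add z.1
  have hg' : HasFDerivAt g (fderiv ℝ g z.1) (z.1 + (0 : ℝ) • (Pi.single μ 1 : D.Base)) := by
    simpa using hg.hasFDerivAt
  exact hg'.comp_hasDerivAt (0 : ℝ) hl

/-- By the chain rule both sides are the second derivative ∂²x^ν/∂x'^l∂x'^m of the inverse
coordinate change. -/
theorem scalarD_invJac (l m ν : Fin D.n) {z : D.Jet} (hz : z ∈ α.overlap β) :
    α.scalarD β l (fun z => α.invJac β m ν z.1) z = α.scalarD β m (fun z => α.invJac β l ν z.1) z := by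
  have hx := fst_mem_baseSet (α := α) (β := β) hz
  have hx' := baseMap_mem hx
  have hc : ContDiffAt ℝ ∞ (β.baseMap α) (α.baseMap β z.1) :=
    contDiffOn_baseMap.contDiffAt ((isOpen_baseSet β α).mem_nhds hx')
  have hc1 : ContDiffAt ℝ 1 (fderiv ℝ (β.baseMap α)) (α.baseMap β z.1) :=
    hc.fderiv_right (by norm_cast)
  have hd := hc1.differentiableAt one_ne_zero
  have key : ∀ l m : Fin D.n, α.scalarD β l (fun z => α.invJac β m ν z.1) z =
      fderiv ℝ (fderiv ℝ (β.baseMap α)) (α.baseMap β z.1) (Pi.single l 1) (Pi.single m 1) ν := by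
    intro l m
    let L : (D.Base →L[ℝ] D.Base) →L[ℝ] ℝ :=
      (ContinuousLinearMap.proj ν).comp (ContinuousLinearMap.apply ℝ D.Base (Pi.single m 1))
    have h1 : HasFDerivAt (fun x => α.invJac β m ν x)
        (L.comp ((fderiv ℝ (fderiv ℝ (β.baseMap α)) (α.baseMap β z.1)).comp
          (fderiv ℝ (α.baseMap β) z.1))) z.1 :=
      L.hasFDerivAt.comp z.1 (hd.hasFDerivAt.comp z.1 (differentiableAt_baseMap hx).hasFDerivAt)
    have h2 : ∀ μ, hderiv μ (fun z : D.Jet => α.invJac β m ν z.1) z =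
        L (fderiv ℝ (fderiv ℝ (β.baseMap α)) (α.baseMap β z.1)
          (fderiv ℝ (α.baseMap β) z.1 (Pi.single μ 1))) := fun μ => by
      rw [hderiv_base h1.differentiableAt, h1.fderiv]
      rfl
    simp only [scalarD, h2]
    exact sum_invJac_fderiv l hx (L.comp (fderiv ℝ (fderiv ℝ (β.baseMap α)) (α.baseMap β z.1)) :
      D.Base →ₗ[ℝ] ℝ)
  rw [key, key, (hc.isSymmSndFDerivAt (by simpa using ENat.LEInfty.out)).eq]

/-! #### The total derivatives of the other chart -/

theorem gradedD_congr {f g : D.Jet → D.Alg} (h : Set.EqOn f g (α.overlap β)) (l : Fin D.n) :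
    Set.EqOn (α.gradedD β l f) (α.gradedD β l g) (α.overlap β) := fun z hz =>
  Finset.sum_congr rfl fun μ _ => by rw [tderiv_congr (isOpen_overlapSet α β) h μ hz]

theorem gradedD_mem {p : Submodule ℝ D.Alg} (l : Fin D.n) (hp : ∀ l, ∀ x ∈ p, shiftDer l x ∈ p)
    {f : D.Jet → D.Alg} (hf : ∀ z ∈ α.overlap β, f z ∈ p) :
    ∀ z ∈ α.overlap β, α.gradedD β l f z ∈ p := fun z hz =>
  sum_mem fun μ _ => Submodule.smul_mem _ _ (tderiv_mem (isOpen_overlapSet α β) μ (hp μ) hf z hz)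

theorem isGradedFunction_gradedD {r : ℕ} {f : D.Jet → D.Alg}
    (hf : IsGradedFunction r (α.overlapSet β) f) (l : Fin D.n) :
    IsGradedFunction (r + 1) (α.overlapSet β) (α.gradedD β l f) :=
  IsGradedFunction.sum fun μ _ => (hf.tderiv (isOpen_overlapSet α β) μ).smul (isSmoothOn_invJac _ l μ)

theorem gradedD_add {r r' : ℕ} {f g : D.Jet → D.Alg} (hf : IsGradedFunction r (α.overlapSet β) f)
    (hg : IsGradedFunction r' (α.overlapSet β) g) (l : Fin D.n) {z : D.Jet} (hz : z ∈ α.overlap β) :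
    α.gradedD β l (fun z => f z + g z) z = α.gradedD β l f z + α.gradedD β l g z := by
  simp only [gradedD, hf.tderiv_add (isOpen_overlapSet α β) hg _ hz, smul_add,
    Finset.sum_add_distrib]

theorem gradedD_mul {r r' : ℕ} {f g : D.Jet → D.Alg} (hf : IsGradedFunction r (α.overlapSet β) f)
    (hg : IsGradedFunction r' (α.overlapSet β) g) (l : Fin D.n) {z : D.Jet} (hz : z ∈ α.overlap β) :
    α.gradedD β l (fun z => f z * g z) z = α.gradedD β l f z * g z + f z * α.gradedD β l g z := by
  simp only [gradedD, hf.tderiv_mul (isOpen_overlapSet α β) hg _ hz, smul_add,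
    Finset.sum_add_distrib, Finset.sum_mul, Finset.mul_sum, smul_mul_assoc, mul_smul_comm]

theorem gradedD_smul {r r' : ℕ} {b : D.Jet → ℝ} {f : D.Jet → D.Alg}
    (hb : IsSmoothOn r (α.overlapSet β) b)
    (hf : IsGradedFunction r' (α.overlapSet β) f) (l : Fin D.n) {z : D.Jet} (hz : z ∈ α.overlap β) :
    α.gradedD β l (fun z => b z • f z) z = α.scalarD β l b z • f z + b z • α.gradedD β l f z := by
  simp only [gradedD, scalarD, IsGradedFunction.tderiv_smul (isOpen_overlapSet α β) hb hf _ hz,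
    smul_add, Finset.sum_add_distrib, Finset.sum_smul, Finset.smul_sum, smul_smul]
  congr 1
  exact Finset.sum_congr rfl fun μ _ => by rw [mul_comm]

theorem gradedD_sum {ι : Type*} {s : Finset ι} {r : ℕ} {f : ι → D.Jet → D.Alg}
    (hf : ∀ i ∈ s, IsGradedFunction r (α.overlapSet β) (f i)) (l : Fin D.n) {z : D.Jet}
    (hz : z ∈ α.overlap β) :
    α.gradedD β l (fun z => ∑ i ∈ s, f i z) z = ∑ i ∈ s, α.gradedD β l (f i) z := by
  simp only [gradedD, IsGradedFunction.tderiv_sum (isOpen_overlapSet α β) hf _ hz, Finset.smul_sum]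
  exact Finset.sum_comm

/-- Expanding d'_l d'_m gives a first order term, symmetric by `scalarD_invJac`, and a second order
term, symmetric because the d_μ commute. -/
theorem gradedD_comm {r : ℕ} {f : D.Jet → D.Alg} (hf : IsGradedFunction r (α.overlapSet β) f)
    (l m : Fin D.n) {z : D.Jet} (hz : z ∈ α.overlap β) :
    α.gradedD β l (α.gradedD β m f) z = α.gradedD β m (α.gradedD β l f) z := by
  have hV := isOpen_overlapSet α β
  have key : ∀ l m : Fin D.n, α.gradedD β l (α.gradedD β m f) z =
      ∑ ν, α.scalarD β l (fun z => α.invJac β m ν z.1) z • tderiv ν f z +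
        ∑ ν, ∑ μ, (α.invJac β m ν z.1 * α.invJac β l μ z.1) • tderiv μ (tderiv ν f) z := by
    intro l m
    have h1 : α.gradedD β l (α.gradedD β m f) z =
        ∑ ν, α.gradedD β l (fun z => α.invJac β m ν z.1 • tderiv ν f z) z :=
      gradedD_sum (fun ν _ => (hf.tderiv hV ν).smul (isSmoothOn_invJac _ m ν)) l hz
    rw [h1, ← Finset.sum_add_distrib]
    refine Finset.sum_congr rfl fun ν _ => ?_
    rw [gradedD_smul (isSmoothOn_invJac 0 m ν) (hf.tderiv hV ν) l hz]
    simp only [gradedD, Finset.smul_sum, smul_smul]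
  rw [key, key]
  congr 1
  · exact Finset.sum_congr rfl fun ν _ => by rw [scalarD_invJac l m ν hz]
  · rw [Finset.sum_comm]
    refine Finset.sum_congr rfl fun ν _ => Finset.sum_congr rfl fun μ _ => ?_
    rw [mul_comm, hf.tderiv_comm hV ν μ hz]

theorem exists_multi_gradedD {r : ℕ} {f : D.Jet → D.Alg} (hf : IsGradedFunction r (α.overlapSet β) f)
    (Λ : D.MI) : ∃ s, IsGradedFunction s (α.overlapSet β) (multi (α.gradedD β) Λ f) :=
  multi_mem (P := fun f : D.Jet → D.Alg => ∃ s, IsGradedFunction s (α.overlapSet β) f)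
    (fun l _ ⟨s, hs⟩ => ⟨s + 1, isGradedFunction_gradedD hs l⟩) ⟨r, hf⟩ Λ

theorem multi_gradedD_add_single {r : ℕ} {f : D.Jet → D.Alg}
    (hf : IsGradedFunction r (α.overlapSet β) f) (Λ : D.MI) (l : Fin D.n) :
    Set.EqOn (multi (α.gradedD β) (Λ + Pi.single l 1) f) (α.gradedD β l (multi (α.gradedD β) Λ f))
      (α.overlap β) :=
  multi_add_single (P := fun f => ∃ s, IsGradedFunction s (α.overlapSet β) f)
    (fun l _ ⟨s, hs⟩ => ⟨s + 1, isGradedFunction_gradedD hs l⟩) (fun l _ _ h => gradedD_congr h l)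
    (fun l m _ ⟨_, hs⟩ _ hz => gradedD_comm hs l m hz) ⟨r, hf⟩ Λ l

theorem multi_gradedD_mem {p : Submodule ℝ D.Alg} (hp : ∀ l, ∀ x ∈ p, shiftDer l x ∈ p)
    {f : D.Jet → D.Alg} (hf : ∀ z ∈ α.overlap β, f z ∈ p) (Λ : D.MI) :
    ∀ z ∈ α.overlap β, multi (α.gradedD β) Λ f z ∈ p :=
  multi_mem (P := fun f : D.Jet → D.Alg => ∀ z ∈ α.overlap β, f z ∈ p)
    (fun l _ h => gradedD_mem l hp h) hf Λ

theorem isSmoothOn_scalarD {r : ℕ} {a : D.Jet → ℝ} (ha : IsSmoothOn r (α.overlapSet β) a)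
    (l : Fin D.n) : IsSmoothOn (r + 1) (α.overlapSet β) (α.scalarD β l a) :=
  IsSmoothOn.sum fun μ _ => (isSmoothOn_invJac _ l μ).mul (ha.hderiv (isOpen_overlapSet α β) μ)

theorem scalarD_congr {a b : D.Jet → ℝ} (h : Set.EqOn a b (α.overlap β)) (l : Fin D.n) :
    Set.EqOn (α.scalarD β l a) (α.scalarD β l b) (α.overlap β) := fun z hz =>
  Finset.sum_congr rfl fun μ _ => by rw [hderiv_congr (isOpen_overlapSet α β) h μ hz]

theorem gradedD_smul_one {r : ℕ} {a : D.Jet → ℝ} (ha : IsSmoothOn r (α.overlapSet β) a)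
    (l : Fin D.n) {z : D.Jet} (hz : z ∈ α.overlap β) :
    α.gradedD β l (fun z => a z • (1 : D.Alg)) z = α.scalarD β l a z • (1 : D.Alg) := by
  have h1 : ∀ μ, shiftDer μ (1 : D.Alg) = 0 := fun μ => by
    simpa using shiftDer_algebraMap (D := D) μ 1
  rw [gradedD_smul ha (IsGradedFunction.const (r := 0) (one_mem _)) l hz]
  simp [gradedD, tderiv_const, h1]

/-- A real function is treated as a graded function through its multiple of the unit, which is
injective because the algebra is nontrivial. -/
theorem scalarD_comm {r : ℕ} {a : D.Jet → ℝ} (ha : IsSmoothOn r (α.overlapSet β) a)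
    (l m : Fin D.n) {z : D.Jet} (hz : z ∈ α.overlap β) :
    α.scalarD β l (α.scalarD β m a) z = α.scalarD β m (α.scalarD β l a) z := by
  have h := gradedD_comm (IsGradedFunction.smul ha (IsGradedFunction.const (one_mem _))) l m hz
  rw [gradedD_congr (fun z hz => gradedD_smul_one ha m hz) l hz,
    gradedD_congr (fun z hz => gradedD_smul_one ha l hz) m hz,
    gradedD_smul_one (isSmoothOn_scalarD ha m) l hz, gradedD_smul_one (isSmoothOn_scalarD ha l) m hz] at h
  exact smul_left_injective ℝ (one_ne_zero (α := D.Alg)) h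

theorem exists_multi_scalarD {r : ℕ} {a : D.Jet → ℝ} (ha : IsSmoothOn r (α.overlapSet β) a)
    (Λ : D.MI) : ∃ s, IsSmoothOn s (α.overlapSet β) (multi (α.scalarD β) Λ a) :=
  multi_mem (P := fun a : D.Jet → ℝ => ∃ s, IsSmoothOn s (α.overlapSet β) a)
    (fun l _ ⟨s, hs⟩ => ⟨s + 1, isSmoothOn_scalarD hs l⟩) ⟨r, ha⟩ Λ

theorem multi_scalarD_add_single {r : ℕ} {a : D.Jet → ℝ} (ha : IsSmoothOn r (α.overlapSet β) a)
    (Λ : D.MI) (l : Fin D.n) :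
    Set.EqOn (multi (α.scalarD β) (Λ + Pi.single l 1) a) (α.scalarD β l (multi (α.scalarD β) Λ a))
      (α.overlap β) :=
  multi_add_single (P := fun a => ∃ s, IsSmoothOn s (α.overlapSet β) a)
    (fun l _ ⟨s, hs⟩ => ⟨s + 1, isSmoothOn_scalarD hs l⟩) (fun l _ _ h => scalarD_congr h l)
    (fun l m _ ⟨_, hs⟩ _ hz => scalarD_comm hs l m hz) ⟨r, ha⟩ Λ l

end Chart

namespace Chart

variable {α β : Chart B}

/-! #### Prolongation of coordinate changes -/

theorem isSmoothOn_fibMap (r : ℕ) (i : Fin D.m) :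
    IsSmoothOn r (α.overlapSet β) (fun w => α.fibMap β (w.1, fun j => w.2 j 0) i) :=
  IsSmoothOn.of_contDiffOn (g := fun u => α.fibMap β u i)
    ((contDiff_apply ℝ ℝ i).comp_contDiffOn contDiffOn_fibMap)

theorem prolong_mem {z : D.Jet} (hz : z ∈ α.overlap β) : α.prolong β z ∈ jetDom β.eY.target := by
  have h := transition_eq (α := α) (β := β) hz
  have h' : ((α.prolong β z).1, fun i => (α.prolong β z).2 i 0) =
      (α.baseMap β z.1, α.fibMap β (z.1, fun j => z.2 j 0)) := by
    simp [prolong]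
  change ((α.prolong β z).1, fun i => (α.prolong β z).2 i 0) ∈ β.eY.target
  rw [h', h]
  exact β.eY.map_source hz.2

theorem exists_order_prolong (α β : Chart B) (r : ℕ) : ∃ s, ∀ (i : Fin D.m) (Λ : Fin D.n → Fin (r + 1)),
    IsSmoothOn s (α.overlapSet β) (fun z => (α.prolong β z).2 i fun l => (Λ l : ℕ)) := by
  choose s hs using fun (x : Fin D.m × (Fin D.n → Fin (r + 1))) =>
    exists_multi_scalarD (isSmoothOn_fibMap (α := α) (β := β) 0 x.1) fun l => (x.2 l : ℕ)
  refine ⟨∑ x, s x, fun i Λ => (hs (i, Λ)).mono_order ?_⟩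
  exact Finset.single_le_sum (f := s) (fun _ _ => Nat.zero_le _) (Finset.mem_univ (i, Λ))

theorem exists_isSmoothOn_comp_prolong {r : ℕ} {a : D.Jet → ℝ} (ha : IsSmoothOn r β.eY.target a) :
    ∃ s, IsSmoothOn s (α.overlapSet β) (fun z => a (α.prolong β z)) := by
  obtain ⟨s, hs⟩ := exists_order_prolong α β r
  obtain ⟨g, hg, e⟩ := isSmoothOn_iff.1 ha
  choose h hh eh using fun i Λ => isSmoothOn_iff.1 (hs i Λ)
  let F : FinJet D s → FinJet D r := fun u => (α.baseMap β u.1, fun i Λ => h i Λ u)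
  have hF : ∀ z ∈ α.overlap β, F (trunc s z) = trunc r (α.prolong β z) := by
    intro z hz
    refine Prod.ext rfl ?_
    funext i Λ
    exact (eh i Λ z hz).symm
  refine ⟨s, isSmoothOn_iff.2 ⟨g ∘ F, hg.comp ?_ ?_, fun z hz => ?_⟩⟩
  · refine ContDiffOn.prodMk ?_ ?_
    · exact contDiffOn_baseMap.comp contDiff_fst.contDiffOn fun u hu => fst_mem_baseSet hu
    · exact contDiffOn_pi.2 fun i => contDiffOn_pi.2 fun Λ => hh i Λ
  -- A finite jet is extended by zeros to a full jet, for which it is known that prolongation lands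
  -- over the other chart.
  · intro u hu
    have hz := extendJet_mem.2 hu
    have := hF _ hz
    rw [trunc_extendJet] at this
    rw [this, trunc_mem_finDom]
    exact prolong_mem hz
  · rw [e _ (prolong_mem hz), Function.comp_apply, hF z hz]

/-- The prolonged coordinate change carries the vector (∂x^μ/∂x'^l) d_μ to the horizontal direction
d_l of the other chart. For the base components this is the inverse Jacobian; for the fibre
components it is the identity y'_{l+Λ} = d'_l y'_Λ, which rests on the commutation of the d'_l. The
chain rule then gives the claim. -/
theorem scalarD_comp_prolong {r : ℕ} {a : D.Jet → ℝ} (ha : IsSmoothOn r β.eY.target a) (l : Fin D.n)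
    {z : D.Jet} (hz : z ∈ α.overlap β) :
    α.scalarD β l (fun z => a (α.prolong β z)) z = hderiv l a (α.prolong β z) := by
  have hV := isOpen_overlapSet α β
  have hx := fst_mem_baseSet (α := α) (β := β) hz
  obtain ⟨s, hs⟩ := exists_order_prolong α β r
  obtain ⟨g, hg, e⟩ := isSmoothOn_iff.1 ha
  have hpz := prolong_mem (α := α) (β := β) hz
  have hd : DifferentiableAt ℝ g (trunc r (α.prolong β z)) :=
    (hg.contDiffAt ((isOpen_finDom r β.eY.open_target).mem_nhds hpz)).differentiableAt (by simp)
  let w : Fin D.n → FinJet D r := fun μ =>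
    (fderiv ℝ (α.baseMap β) z.1 (Pi.single μ 1),
      fun i Λ => hderiv μ (fun z => (α.prolong β z).2 i fun l => (Λ l : ℕ)) z)
  have h1 : ∀ μ, hderiv μ (fun z => a (α.prolong β z)) z = fderiv ℝ g (trunc r (α.prolong β z)) (w μ) := by
    intro μ
    rw [hderiv_eq]
    refine (hasVD_real.2 ?_).vderiv_eq
    have hc : HasDerivAt (fun t : ℝ => trunc r (α.prolong β (z + t • horDir μ z))) (w μ) 0 := by
      refine HasDerivAt.prodMk ?_ ?_
      · have hl : HasDerivAt (fun t : ℝ => z.1 + t • (Pi.single μ 1 : D.Base)) (Pi.single μ 1) 0 := by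
          simpa using ((hasDerivAt_id (0 : ℝ)).smul_const (Pi.single μ 1 : D.Base)).const_add z.1
        have hb : HasFDerivAt (α.baseMap β) (fderiv ℝ (α.baseMap β) z.1)
            (z.1 + (0 : ℝ) • (Pi.single μ 1 : D.Base)) := by
          simpa using (differentiableAt_baseMap hx).hasFDerivAt
        exact hb.comp_hasDerivAt (0 : ℝ) hl
      · exact hasDerivAt_pi.2 fun i => hasDerivAt_pi.2 fun Λ =>
          hasVD_real.1 ((hs i Λ).hasVD hV hz (horDir μ z))
    have hd' : HasFDerivAt g (fderiv ℝ g (trunc r (α.prolong β z)))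
        (trunc r (α.prolong β (z + (0 : ℝ) • horDir μ z))) := by
      rw [zero_smul, add_zero]
      exact hd.hasFDerivAt
    refine (hd'.comp_hasDerivAt (0 : ℝ) hc).congr_of_eventuallyEq ?_
    filter_upwards [eventually_mem_jetDom hV hz (horDir μ z)] with t ht
    exact e _ (prolong_mem ht)
  have h2 : ∑ μ, α.invJac β l μ z.1 • w μ = trunc r (horDir l (α.prolong β z)) := by
    refine Prod.ext ?_ ?_
    · rw [Prod.fst_sum]
      exact sum_invJac_fderiv l hx LinearMap.id
    · rw [Prod.snd_sum]
      funext i Λ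
      rw [Finset.sum_apply, Finset.sum_apply]
      exact (multi_scalarD_add_single (isSmoothOn_fibMap (α := α) (β := β) 0 i)
        (fun l => (Λ l : ℕ)) l hz).symm
  rw [hderiv_eq, IsSmoothOn.vderiv_of_eq β.eY.open_target hg e hpz, ← h2, map_sum, scalarD]
  simp only [h1, map_smul, smul_eq_mul]

/-! #### The transition law of the generating basis -/

/-- The cocycle lives on X. Since the charts are adapted, the point of X under a jet depends
smoothly on the base coordinates alone. -/
theorem isSmoothOn_coordChange {q : ℕ} {ι : Type*} (Z : VectorBundleCore ℝ X (Fin q → ℝ) ι)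
    (hZ : Z.IsContMDiff 𝓘(ℝ, D.Base) ∞) (i j : ι)
    (h : ∀ y ∈ α.eY.source, y ∈ β.eY.source → B.proj y ∈ Z.baseSet i ∩ Z.baseSet j)
    (e : Fin q → ℝ) (b : Fin q) (r : ℕ) :
    IsSmoothOn r (α.overlapSet β) (fun z => Z.coordChange i j (B.proj (α.point z)) e b) := by
  have h1 : ContDiffOn ℝ ∞ (fun x => Z.coordChange i j (α.eX.symm x))
      {x | x ∈ α.eX.target ∧ α.eX.symm x ∈ Z.baseSet i ∩ Z.baseSet j} := by
    rw [← contMDiffOn_iff_contDiffOn]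
    exact (hZ.contMDiffOn_coordChange i j).comp
      ((contMDiffOn_symm_of_mem_maximalAtlas α.eX_mem).mono fun x hx => hx.1) fun x hx => hx.2
  have h2 : ContDiffOn ℝ ∞ (fun u : D.Base × D.Fib => Z.coordChange i j (α.eX.symm u.1) e b)
      (α.overlapSet β) := by
    refine (contDiff_apply ℝ ℝ b).comp_contDiffOn (ContDiffOn.clm_apply ?_ contDiffOn_const)
    refine h1.comp contDiff_fst.contDiffOn fun u hu => ⟨(proj_symm hu.1).2, ?_⟩
    rw [← (proj_symm hu.1).1]
    exact h _ (α.eY.map_target hu.1) hu.2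
  exact (IsSmoothOn.of_contDiffOn h2).congr fun z hz => by
    rw [point, (proj_symm (overlapSet_subset α β hz)).1]

theorem isSmoothOn_jac (r : ℕ) :
    IsSmoothOn r (α.overlapSet β) (fun z => β.jac α (α.baseMap β z.1)) :=
  isSmoothOn_base (contDiffOn_comp_baseMap contDiffOn_jac)

theorem isSmoothOn_fderiv_fibMap (r : ℕ) (i j : Fin D.m) :
    IsSmoothOn r (α.overlapSet β) (fun z =>
      fderiv ℝ (β.fibMap α) (α.baseMap β z.1, α.fibMap β (z.1, fun j => z.2 j 0))
        (0, Pi.single i 1) j) := by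
  have h1 : ContDiffOn ℝ ∞ (fderiv ℝ (β.fibMap α)) (β.overlapSet α) :=
    contDiffOn_fibMap.fderiv_of_isOpen (isOpen_overlapSet β α) (by simp)
  have h2 : ContDiffOn ℝ ∞ (fun u => fderiv ℝ (β.fibMap α) (β.eY (α.eY.symm u))
      (0, Pi.single i 1) j) (α.overlapSet β) :=
    (contDiff_apply ℝ ℝ j).comp_contDiffOn ((h1.comp contDiffOn_transitionY fun u hu =>
      transition_mem hu).clm_apply contDiffOn_const)
  exact (IsSmoothOn.of_contDiffOn h2).congr fun z hz => by
    rw [transition_eq (α := α) (β := β) hz]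

theorem isGradedFunction_transl {u : D.Var → D.Jet → D.Alg} {r : ℕ}
    (hu : ∀ v, IsGradedFunction r (α.overlapSet β) (u v)) (v : D.Var) :
    IsGradedFunction r (α.overlapSet β) (fun z => α.transl β (fun v => u v z) z v) := by
  cases v with
  | fieldOdd a =>
    exact IsGradedFunction.sum fun b _ => (hu _).smul (isSmoothOn_coordChange B.F B.smoothF _ _
      (fun y hy hy' => ⟨α.memF y hy, β.memF y hy'⟩) _ _ _)
  | antiEven i =>
    exact (IsGradedFunction.sum fun j _ => (hu _).smul (isSmoothOn_fderiv_fibMap _ _ _)).smul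
      (isSmoothOn_jac _)
  | antiOdd a =>
    exact (IsGradedFunction.sum fun b _ => (hu _).smul (isSmoothOn_coordChange B.F B.smoothF _ _
      (fun y hy hy' => ⟨β.memF y hy', α.memF y hy⟩) _ _ _)).smul (isSmoothOn_jac _)
  | noether k ε s =>
    exact (IsGradedFunction.sum fun b _ => (hu _).smul (isSmoothOn_coordChange (B.E k ε)
      (B.smoothE k ε) _ _ (fun y hy hy' => ⟨β.memE k ε y hy', α.memE k ε y hy⟩) _ _ _)).smul
      (isSmoothOn_jac _)

/-- At a fixed jet the transition law is linear with real coefficients, so derivations and component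
projections pass through it. -/
theorem transl_map (L : D.Alg →ₗ[ℝ] D.Alg) (u : D.Var → D.Alg) (z : D.Jet) (v : D.Var) :
    α.transl β (fun v => L (u v)) z v = L (α.transl β u z v) := by
  cases v <;> simp [transl]

/-- The transition law mixes only basis elements of equal parity and equal antifield number. This is
the source of the chart independence of parity and multidegree. -/
theorem transl_mem {p : Submodule ℝ D.Alg} {u : D.Var → D.Alg} {v : D.Var}
    (h : ∀ v', D.par v' = D.par v → D.ant v' = D.ant v → u v' ∈ p) (z : D.Jet) :
    α.transl β u z v ∈ p := by
  cases v with
  | fieldOdd a => exact sum_mem fun b _ => Submodule.smul_mem _ _ (h _ rfl rfl)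
  | antiEven i =>
    exact Submodule.smul_mem _ _ (sum_mem fun b _ => Submodule.smul_mem _ _ (h _ rfl rfl))
  | antiOdd a =>
    exact Submodule.smul_mem _ _ (sum_mem fun b _ => Submodule.smul_mem _ _ (h _ rfl rfl))
  | noether k ε s =>
    exact Submodule.smul_mem _ _ (sum_mem fun b _ => Submodule.smul_mem _ _ (h _ rfl rfl))

/-! #### Pull-back homomorphisms -/

theorem IsPullback.unique {z : D.Jet} {T T' : D.Alg →ₐ[ℝ] D.Alg} (h : α.IsPullback β z T)
    (h' : α.IsPullback β z T') : T = T' :=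
  GrAlg.hom_ext fun g => (h g.1 g.2).trans (h' g.1 g.2).symm

/-- The generators of `β` in terms of those of `α`. -/
def translGen (α β : Chart B) (v : D.Var) : D.Jet → D.Alg :=
  fun w => α.transl β (fun v' => jetGen v' 0) w v

theorem isGradedFunction_translGen (v : D.Var) :
    IsGradedFunction 0 (α.overlapSet β) (translGen α β v) :=
  isGradedFunction_transl (u := fun v _ => jetGen v 0)
    (fun v => IsGradedFunction.const (jetGen_mem_lowAlg v fun _ => le_rfl)) v

theorem IsPullback.jetGen_mem {z : D.Jet} (hz : z ∈ α.overlap β) {T : D.Alg →ₐ[ℝ] D.Alg}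
    (hT : α.IsPullback β z T) {p : Submodule ℝ D.Alg} (hp : ∀ l, ∀ x ∈ p, shiftDer l x ∈ p)
    (v : D.Var) (h : ∀ v', D.par v' = D.par v → D.ant v' = D.ant v → jetGen v' 0 ∈ p) (Λ : D.MI) :
    T (jetGen v Λ) ∈ p := by
  rw [hT]
  exact multi_gradedD_mem hp (fun w _ => transl_mem h w) Λ z hz

theorem IsPullback.invol {z : D.Jet} (hz : z ∈ α.overlap β) {T : D.Alg →ₐ[ℝ] D.Alg}
    (hT : α.IsPullback β z T) (x : D.Alg) : T (invol x) = GrAlg.invol (T x) := by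
  induction x using GrAlg.induction with
  | hc r => simp
  | hg g =>
    rw [invol_gen, map_smul]
    have h := hT.jetGen_mem hz (p := parSub (D.par g.1)) (fun l _ => shiftDer_mem_parSub l) g.1
      (fun v' h _ => h ▸ jetGen_mem_parSub v' 0) g.2
    exact (mem_parSub.1 h).symm
  | ha x y hx hy => simp [hx, hy]
  | hm x y hx hy => simp [hx, hy]

theorem IsPullback.mono_mem {z : D.Jet} (hz : z ∈ α.overlap β) {T : D.Alg →ₐ[ℝ] D.Alg}
    (hT : α.IsPullback β z T) (L : List (D.Var × D.MI)) :
    T (mono L) ∈ degSub multideg ({(L.map multideg).sum} : Set (ℕ →₀ ℕ)) := by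
  induction L with
  | nil =>
    rw [mono_nil, map_one]
    simpa using mono_mem_degSub (par := fun g : D.Var × D.MI => D.par g.1) (deg := multideg)
      (p := {0}) (l := []) (by simp)
  | cons g L ih =>
    rw [mono_cons, map_mul]
    refine mul_mem_degSub (p := {multideg g}) ?_ ih (by simp)
    refine hT.jetGen_mem hz (fun l _ => shiftDer_mem_degSub l) g.1 (fun v' _ h => ?_) g.2
    have := jetGen_mem_degSub v' 0 0
    rwa [show multideg (v', (0 : D.MI)) = multideg g by simp only [multideg, h]] at this

/-- Pull-backs preserve multidegrees. As a consequence the summands G and H of a global density are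
themselves global (`IsDensity.part`). -/
theorem IsPullback.comp {z : D.Jet} (hz : z ∈ α.overlap β) {T : D.Alg →ₐ[ℝ] D.Alg}
    (hT : α.IsPullback β z T) (d : ℕ →₀ ℕ) (x : D.Alg) :
    T (comp multideg d x) = GrAlg.comp multideg d (T x) := by
  have := comp_map_of_shift T.toLinearMap (0 : ℕ →₀ ℕ) (fun L => by
    simpa using hT.mono_mem hz L) d x
  rw [add_zero] at this
  exact this.symm

section Naturality

variable {T : D.Jet → D.Alg →ₐ[ℝ] D.Alg} (hT : ∀ z ∈ α.overlap β, α.IsPullback β z (T z))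
include hT

theorem exists_isGradedFunction_pullback (x : D.Alg) :
    ∃ s, IsGradedFunction s (α.overlapSet β) (fun w => T w x) := by
  induction x using GrAlg.induction with
  | hc r => exact ⟨0, by simpa using IsGradedFunction.const (Subalgebra.algebraMap_mem _ r)⟩
  | hg g =>
    obtain ⟨s, hs⟩ := exists_multi_gradedD (isGradedFunction_translGen (α := α) (β := β) g.1) g.2
    exact ⟨s, hs.congr fun z hz => hT z hz g.1 g.2⟩
  | ha x y hx hy =>
    obtain ⟨s, hs⟩ := hx
    obtain ⟨t, ht⟩ := hy
    refine ⟨s + t, ?_⟩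
    simpa using (hs.mono_order (Nat.le_add_right s t)).add (ht.mono_order (Nat.le_add_left t s))
  | hm x y hx hy =>
    obtain ⟨s, hs⟩ := hx
    obtain ⟨t, ht⟩ := hy
    refine ⟨s + t, ?_⟩
    simpa using (hs.mono_order (Nat.le_add_right s t)).mul (ht.mono_order (Nat.le_add_left t s))

theorem gradedD_pullback (l : Fin D.n) (x : D.Alg) :
    ∀ z ∈ α.overlap β, α.gradedD β l (fun w => T w x) z = T z (shiftDer l x) := by
  induction x using GrAlg.induction with
  | hc r =>
    intro z hz
    simp [gradedD, tderiv_const]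
  | hg g =>
    intro z hz
    have h1 := hT z hz g.1 (g.2 + Pi.single l 1)
    have h2 := multi_gradedD_add_single (isGradedFunction_translGen (α := α) (β := β) g.1) g.2 l hz
    have h3 := gradedD_congr (α := α) (β := β) (fun z hz => hT z hz g.1 g.2) l hz
    change α.gradedD β l (fun w => T w (jetGen g.1 g.2)) z = T z (shiftDer l (jetGen g.1 g.2))
    rw [shiftDer_jetGen, h1]
    exact h3.trans h2.symm
  | ha x y hx hy =>
    intro z hz
    obtain ⟨s, hs⟩ := exists_isGradedFunction_pullback hT x
    obtain ⟨t, ht⟩ := exists_isGradedFunction_pullback hT y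
    simp only [map_add]
    rw [gradedD_add hs ht l hz, hx z hz, hy z hz]
  | hm x y hx hy =>
    intro z hz
    obtain ⟨s, hs⟩ := exists_isGradedFunction_pullback hT x
    obtain ⟨t, ht⟩ := exists_isGradedFunction_pullback hT y
    simp only [map_mul]
    rw [gradedD_mul hs ht l hz, hx z hz, hy z hz, shiftDer_mul, map_add, map_mul, map_mul]

/-- In a local expression ∑ a_i w_i the coefficients are treated by `scalarD_comp_prolong`. The
elements w_i are treated by `gradedD_pullback`, which on generators is the recursion defining the
pull-back. -/
theorem gradedD_pullback_comp {r : ℕ} {f : D.Jet → D.Alg} (hf : IsGradedFunction r β.eY.target f)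
    (l : Fin D.n) : Set.EqOn (α.gradedD β l fun w => T w (f (α.prolong β w)))
      (fun z => T z (tderiv l f (α.prolong β z))) (α.overlap β) := by
  intro z hz
  obtain ⟨M, a, w, ha, hw, e⟩ := hf
  choose s hs using fun i => exists_isSmoothOn_comp_prolong (α := α) (ha i)
  choose t ht using fun i => exists_isGradedFunction_pullback hT (w i)
  have hs' : ∀ i, IsSmoothOn (∑ i, s i + ∑ i, t i) (α.overlapSet β) fun z => a i (α.prolong β z) :=
    fun i => (hs i).mono_order ((Finset.single_le_sum (f := s) (fun _ _ => Nat.zero_le _)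
      (Finset.mem_univ i)).trans (Nat.le_add_right _ _))
  have ht' : ∀ i, IsGradedFunction (∑ i, s i + ∑ i, t i) (α.overlapSet β) fun z => T z (w i) :=
    fun i => (ht i).mono_order ((Finset.single_le_sum (f := t) (fun _ _ => Nat.zero_le _)
      (Finset.mem_univ i)).trans (Nat.le_add_left _ _))
  rw [gradedD_congr (g := fun z => ∑ i, a i (α.prolong β z) • T z (w i)) (fun z hz => by
      simp only [e _ (prolong_mem hz), map_sum, map_smul]) l hz,
    gradedD_sum (fun i _ => (ht' i).smul (hs' i)) l hz]
  simp only
  rw [IsGradedFunction.tderiv_of_eq β.eY.open_target ha e l (prolong_mem hz), map_sum]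
  refine Finset.sum_congr rfl fun i _ => ?_
  rw [gradedD_smul (hs i) (ht i) l hz, gradedD_pullback hT l _ z hz, scalarD_comp_prolong (ha i) l hz,
    map_add, map_smul, map_smul]

theorem multi_gradedD_pullback_comp {r : ℕ} {f : D.Jet → D.Alg}
    (hf : IsGradedFunction r β.eY.target f) (Λ : D.MI) :
    Set.EqOn (multi (α.gradedD β) Λ fun w => T w (f (α.prolong β w)))
      (fun z => T z (multi tderiv Λ f (α.prolong β z))) (α.overlap β) :=
  (multi_rel (R := fun (g f : D.Jet → D.Alg) => (∃ s, IsGradedFunction s β.eY.target f) ∧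
      Set.EqOn g (fun w => T w (f (α.prolong β w))) (α.overlap β)) (f' := f)
    (fun l _ _ ⟨⟨s, hs⟩, e⟩ => ⟨⟨s + 1, hs.tderiv β.eY.open_target l⟩,
      (gradedD_congr e l).trans (gradedD_pullback_comp hT hs l)⟩) ⟨⟨r, hf⟩, fun _ _ => rfl⟩ Λ).2

end Naturality

/-- Each d'_l combines the d_μ with coefficients depending on x only, over which the derivation is
linear; so it commutes with d'_l because it commutes with d_μ. -/
theorem multi_gradedD_rightDer {u : D.Var → D.Jet → D.Alg} {r s : ℕ}
    (hu : ∀ v, IsGradedFunction s (α.overlapSet β) (u v)) (hodd : OddOn (α.overlapSet β) u)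
    {f : D.Jet → D.Alg} (hf : IsGradedFunction r (α.overlapSet β) f) (Λ : D.MI) :
    Set.EqOn (rightDer u (multi (α.gradedD β) Λ f)) (multi (α.gradedD β) Λ (rightDer u f))
      (α.overlap β) := by
  refine Set.EqOn.symm (multi_rel (R := fun (g f : D.Jet → D.Alg) =>
      (∃ s, IsGradedFunction s (α.overlapSet β) f) ∧ Set.EqOn g (rightDer u f) (α.overlap β)) (f' := f)
    (fun l _ f' ⟨⟨t, ht⟩, e⟩ => ⟨⟨t + 1, isGradedFunction_gradedD ht l⟩,
      (gradedD_congr e l).trans fun z hz => ?_⟩) ⟨⟨r, hf⟩, fun _ _ => rfl⟩ Λ).2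
  simp only [gradedD, rightDer_apply, map_sum, map_smul]
  refine Finset.sum_congr rfl fun μ _ => ?_
  rw [ht.tderiv_rightDer (isOpen_overlapSet α β) hu hodd μ hz, rightDer_apply]

/-- Pull-backs preserve parity, so both sides obey the same odd Leibniz rule and generators suffice.
The generator v_Λ of the other chart is pulled back to d'_Λ of the expression of v; moving the
derivation inside d'_Λ produces d'_Λ of the transformed source, which by naturality is the pull-back
of d_Λ u'_v. -/
theorem derAt_pullback {T : D.Jet → D.Alg →ₐ[ℝ] D.Alg}
    (hT : ∀ z ∈ α.overlap β, α.IsPullback β z (T z)) {u u' : D.Var → D.Jet → D.Alg} {s : ℕ}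
    (hu : ∀ v, IsGradedFunction s α.eY.target (u v)) (hodd : OddOn α.eY.target u)
    (hu' : ∀ v, IsGradedFunction s β.eY.target (u' v)) (hodd' : OddOn β.eY.target u')
    (hglue : ∀ z ∈ α.overlap β, ∀ v, T z (u' v (α.prolong β z)) = α.transl β (fun v => u v z) z v)
    {z : D.Jet} (hz : z ∈ α.overlap β) (x : D.Alg) :
    derAt u z (T z x) = T z (derAt u' (α.prolong β z) x) := by
  have hzα : z ∈ jetDom α.eY.target := hz.1
  induction x using GrAlg.induction with
  | hc r =>
    have h1 : derAt u z (algebraMap ℝ D.Alg r) = 0 := derR_algebraMap _ _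
    have h2 : derAt u' (α.prolong β z) (algebraMap ℝ D.Alg r) = 0 := derR_algebraMap _ _
    rw [AlgHom.commutes, h1, h2, map_zero]
  | hg g =>
    change derAt u z (T z (jetGen g.1 g.2)) = T z (derAt u' (α.prolong β z) (jetGen g.1 g.2))
    have huo : ∀ v, IsGradedFunction s (α.overlapSet β) (u v) := fun v =>
      (hu v).mono_set (overlapSet_subset α β)
    have hoo : OddOn (α.overlapSet β) u := fun v z hz => hodd v z hz.1
    have h1 := multi_gradedD_rightDer huo hoo (isGradedFunction_translGen (α := α) (β := β) g.1) g.2 hz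
    have h2 : Set.EqOn (rightDer u (translGen α β g.1))
        (fun w => T w (u' g.1 (α.prolong β w))) (α.overlap β) := by
      intro w hw
      simp only [hglue w hw, rightDer_apply, translGen]
      rw [← transl_map (derAt u w)]
      simp only [derAt_jetGen, multi_zero]
    have h3 := multi_rel (R := fun (f g : D.Jet → D.Alg) => Set.EqOn f g (α.overlap β))
      (fun l _ _ h => gradedD_congr h l) h2 g.2 hz
    rw [derAt_jetGen, hT z hz]
    exact h1.trans (h3.trans (multi_gradedD_pullback_comp hT (hu' g.1) g.2 hz))
  | ha x y hx hy => simp only [map_add, hx, hy]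
  | hm x y hx hy =>
    rw [map_mul, hodd.derAt_mul α.eY.open_target hzα,
      hodd'.derAt_mul β.eY.open_target (prolong_mem hz), hx, hy, map_add, map_mul, map_mul,
      (hT z hz).invol hz]

end Chart

/-! ### Antifield numbers -/

/-- The total antifield number of a multidegree. -/
def weight (d : ℕ →₀ ℕ) : ℕ := d.sum fun a c => a * c

theorem weight_add (d e : ℕ →₀ ℕ) : weight (d + e) = weight d + weight e :=
  Finsupp.sum_add_index' (fun _ => mul_zero _) fun _ _ _ => mul_add _ _ _

theorem weight_single (a c : ℕ) : weight (Finsupp.single a c) = a * c :=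
  Finsupp.sum_single_index (mul_zero _)

/-- The entry at 0 does not contribute to the weight and must be excluded separately; for
multidegrees that occur in the algebra `mem_degSub_zero` does this. -/
theorem eq_zero_of_weight {d : ℕ →₀ ℕ} (h : weight d = 0) (h0 : d 0 = 0) : d = 0 := by
  ext a
  by_contra hc
  have h1 : a * d a = 0 := by
    have := (Finset.sum_eq_zero_iff.1 h) a (Finsupp.mem_support_iff.2 hc)
    exact this
  rcases mul_eq_zero.1 h1 with e | e
  · subst e; exact hc h0
  · exact hc e

theorem eq_single_of_weight {d : ℕ →₀ ℕ} {a : ℕ} (ha : d a ≠ 0) (h : weight d = a) (h0 : d 0 = 0) :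
    d = Finsupp.single a 1 := by
  have hle : Finsupp.single a 1 ≤ d := by
    rw [Finsupp.single_le_iff]
    omega
  obtain ⟨e, rfl⟩ := exists_add_of_le hle
  rw [weight_add, weight_single] at h
  rw [Finsupp.add_apply] at h0
  rw [eq_zero_of_weight (d := e) (by omega) (by omega), add_zero]

/-- The multidegrees of antifield number `q` with antifields of stages `≤ k` only. -/
def pureSet (k q : ℤ) : Set (ℕ →₀ ℕ) := {d | (∀ a ∈ d.support, (a : ℤ) ≤ k + 2) ∧ (weight d : ℤ) = q}

/-- An antifield of stage k already has antifield number k + 2, so in a term of that total antifield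
number it is the only antifield. Apart from such terms only lower stages occur. -/
theorem mem_pureSet_of_ne_single {k : ℤ} {b : ℕ} (hb : (b : ℤ) = k + 2) {d : ℕ →₀ ℕ}
    (hd : d ∈ pureSet k b) (h0 : d 0 = 0) (hne : d ≠ Finsupp.single b 1) : d ∈ pureSet (k - 1) b := by
  refine ⟨fun a ha => ?_, hd.2⟩
  have h1 := hd.1 a ha
  by_contra hc
  have : a = b := by omega
  subst this
  exact hne (eq_single_of_weight (Finsupp.mem_support_iff.1 ha) (by exact_mod_cast hd.2) h0)

theorem isPure_iff {k q : ℤ} {x : D.Alg} : IsPure k q x ↔ x ∈ degSub multideg (pureSet k q) := Iff.rfl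

theorem mem_degSub_zero (x : D.Alg) : x ∈ degSub multideg {d : ℕ →₀ ℕ | d 0 = 0} := by
  refine mem_of_mono (fun L => mono_mem_degSub ?_) x
  induction L with
  | nil => rfl
  | cons g L ih =>
    simp only [List.map_cons, List.sum_cons, Set.mem_ofPred_eq, Finsupp.add_apply] at ih ⊢
    rw [ih, add_zero, multideg]
    split_ifs with h
    · rfl
    · exact Finsupp.single_eq_of_ne (Ne.symm h)

theorem sub_comp_mem_degSub {p : Set (ℕ →₀ ℕ)} {x : D.Alg} (hx : x ∈ degSub multideg p)
    (d : ℕ →₀ ℕ) : x - comp multideg d x ∈ degSub multideg (p \ {d}) := by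
  intro e he
  by_cases h : e = d
  · subst h
    rw [comp_sub, comp_of_mem (comp_mem_degSub e x), sub_self] at he
    exact absurd rfl he
  · refine ⟨hx e ?_, h⟩
    rwa [comp_sub, comp_of_not_mem (comp_mem_degSub d x) (show e ∉ ({d} : Set _) from h),
      sub_zero] at he

theorem exists_of_rpd_ne_zero {p : Set (ℕ →₀ ℕ)} {x : D.Alg} (hx : x ∈ degSub multideg p)
    {g : D.Var × D.MI} (h : rpd g x ≠ 0) (hg : D.ant g.1 ≠ 0) : ∃ d ∈ p, d (D.ant g.1) ≠ 0 := by
  obtain ⟨d, hd⟩ := exists_deg_of_rpd_ne_zero hx h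
  refine ⟨_, hd, ?_⟩
  rw [multideg, if_neg hg, Finsupp.add_apply, Finsupp.single_eq_same]
  omega

theorem comp_mul_of_mem {y : D.Alg} (hy : y ∈ degSub multideg ({0} : Set (ℕ →₀ ℕ)))
    (d : ℕ →₀ ℕ) (x : D.Alg) : comp multideg d (y * x) = y * comp multideg d x := by
  have := comp_map_of_shift (LinearMap.mulLeft ℝ y) (0 : ℕ →₀ ℕ) (fun L =>
    mul_mem_degSub hy (mono_mem_degSub (p := {(L.map multideg).sum}) rfl) (by simp)) d x
  simpa using this

theorem comp_invol (d : ℕ →₀ ℕ) (x : D.Alg) :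
    comp multideg d (invol x) = invol (comp multideg d x) := by
  have := comp_map_of_shift (deg := multideg)
    (AlgHom.toLinearMap (invol (par := fun g : D.Var × D.MI => D.par g.1))) (0 : ℕ →₀ ℕ) (fun L => by
    rw [AlgHom.toLinearMap_apply, invol_mono]
    refine Submodule.smul_mem _ _ (mono_mem_degSub ?_)
    simp) d x
  simpa using this

theorem multi_tderiv_zero (Λ : D.MI) (z : D.Jet) : multi tderiv Λ (0 : D.Jet → D.Alg) z = 0 := by
  have := multi_tderiv_mem (p := ⊥) (V := Set.univ) isOpen_univ
    (fun l x hx => by rw [(Submodule.mem_bot ℝ).1 hx, map_zero]; exact zero_mem _)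
    (f := (0 : D.Jet → D.Alg)) (fun _ _ => rfl) Λ z trivial
  exact (Submodule.mem_bot ℝ).1 this

theorem multi_tderiv_mem_degSub {V : Set (D.Base × D.Fib)} (hV : IsOpen V) {p : Set (ℕ →₀ ℕ)}
    {f : D.Jet → D.Alg} (hf : ∀ z ∈ jetDom V, f z ∈ degSub multideg p) (Λ : D.MI) {z : D.Jet}
    (hz : z ∈ jetDom V) : multi tderiv Λ f z ∈ degSub multideg p :=
  multi_tderiv_mem hV (fun l _ => shiftDer_mem_degSub l) hf Λ z hz

theorem derAt_congr {u u' : D.Var → D.Jet → D.Alg} {z : D.Jet} {x : D.Alg}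
    (h : ∀ g : D.Var × D.MI, rpd g x ≠ 0 → u g.1 = u' g.1) : derAt u z x = derAt u' z x :=
  derR_congr fun g hg => by rw [h g hg]

theorem derAt_eq_add {u u₁ u₂ : D.Var → D.Jet → D.Alg} {z : D.Jet} {x : D.Alg}
    (h : ∀ g : D.Var × D.MI, rpd g x ≠ 0 → (u g.1 = u₁ g.1 ∧ u₂ g.1 = 0) ∨
      (u g.1 = u₂ g.1 ∧ u₁ g.1 = 0)) : derAt u z x = derAt u₁ z x + derAt u₂ z x := by
  refine Eq.trans ?_ (derR_add (par := fun g : D.Var × D.MI => D.par g.1)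
    (U := fun g => multi tderiv g.2 (u₁ g.1) z) (V := fun g => multi tderiv g.2 (u₂ g.1) z) x)
  refine derR_congr fun g hg => ?_
  rcases h g hg with ⟨h1, h2⟩ | ⟨h1, h2⟩
  · rw [h1, h2, multi_tderiv_zero, add_zero]
  · rw [h1, h2, multi_tderiv_zero, zero_add]

/-- A derivation removes one factor and inserts a total derivative of its source, and total
derivatives do not change multidegrees. Degree questions about δ_k thereby become arithmetic with
sets of multidegrees. -/
theorem derAt_mem_degSub {V : Set (D.Base × D.Fib)} (hV : IsOpen V) {u : D.Var → D.Jet → D.Alg}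
    {p r : Set (ℕ →₀ ℕ)} {Q : D.Var → Set (ℕ →₀ ℕ)}
    (hu : ∀ v, ∀ z ∈ jetDom V, u v z ∈ degSub multideg (Q v)) {z : D.Jet} (hz : z ∈ jetDom V)
    {x : D.Alg} (hx : x ∈ degSub multideg p)
    (h : ∀ (v : D.Var) d, d + multideg (v, (0 : D.MI)) ∈ p → ∀ e ∈ Q v, d + e ∈ r) :
    derAt u z x ∈ degSub multideg r :=
  derR_mem fun g _ => mul_mem_degSub (rpd_mem_degSub g hx)
    (multi_tderiv_mem_degSub hV (hu g.1) g.2 hz) (h g.1)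

/-! ### Operations on densities -/

namespace IsDensity

theorem add {φ ψ : Family B} (hφ : IsDensity φ) (hψ : IsDensity ψ) : IsDensity (φ + ψ) where
  order := by
    obtain ⟨r, hr⟩ := hφ.order
    obtain ⟨s, hs⟩ := hψ.order
    exact ⟨max r s, fun α => ((hr α).mono_order (le_max_left _ _)).add
      ((hs α).mono_order (le_max_right _ _))⟩
  glue α β z hz := by
    obtain ⟨T, hT, e⟩ := hφ.glue α β z hz
    obtain ⟨T', hT', e'⟩ := hψ.glue α β z hz
    obtain rfl := hT.unique hT'
    refine ⟨T, hT, ?_⟩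
    simp only [Pi.add_apply, map_add, smul_add, e, e']

theorem sub {φ ψ : Family B} (hφ : IsDensity φ) (hψ : IsDensity ψ) : IsDensity (φ - ψ) where
  order := by
    obtain ⟨r, hr⟩ := hφ.order
    obtain ⟨s, hs⟩ := hψ.order
    exact ⟨max r s, fun α => ((hr α).mono_order (le_max_left _ _)).sub
      ((hs α).mono_order (le_max_right _ _))⟩
  glue α β z hz := by
    obtain ⟨T, hT, e⟩ := hφ.glue α β z hz
    obtain ⟨T', hT', e'⟩ := hψ.glue α β z hz
    obtain rfl := hT.unique hT'
    refine ⟨T, hT, ?_⟩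
    simp only [Pi.sub_apply, map_sub, smul_sub, e, e']

theorem part {φ : Family B} (hφ : IsDensity φ) (d : ℕ →₀ ℕ) : IsDensity (φ.part d) where
  order := by
    obtain ⟨r, hr⟩ := hφ.order
    exact ⟨r, fun α => (hr α).comp multideg d⟩
  glue α β z hz := by
    obtain ⟨T, hT, e⟩ := hφ.glue α β z hz
    refine ⟨T, hT, ?_⟩
    simp only [Family.part, Dims.part, e, comp_smul, hT.comp hz]

end IsDensity

/-- A family of values of an odd right derivation on the generating basis that changes like the
basis under changes of charts. -/
structure IsSource (u : Chart B → D.Var → D.Jet → D.Alg) : Prop where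
  order : ∃ s, ∀ α v, IsGradedFunction s α.eY.target (u α v)
  odd : ∀ α, OddOn α.eY.target (u α)
  glue : ∀ α β : Chart B, ∀ z ∈ α.overlap β, ∀ T : D.Alg →ₐ[ℝ] D.Alg, α.IsPullback β z T →
    ∀ v, T (u β v (α.prolong β z)) = α.transl β (fun v => u α v z) z v

/-- The right derivation with the given values on the generating basis in each chart. -/
def derFam (u : Chart B → D.Var → D.Jet → D.Alg) (φ : Family B) : Family B :=
  fun α => rightDer (u α) (φ α)

theorem derFam_apply (u : Chart B → D.Var → D.Jet → D.Alg) (φ : Family B) (α : Chart B) (z : D.Jet) :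
    derFam u φ α z = derAt (u α) z (φ α z) := rfl

namespace KoszulTate

variable {S : Lagrangian B} (K : KoszulTate S)

theorem δ_apply (k : ℤ) (φ : Family B) (α : Chart B) (z : D.Jet) :
    K.δ k φ α z = derAt (source S K.Δ k α) z (φ α z) := rfl

-- The Jacobian factor is a scalar at each jet and passes through the derivation, so gluing reduces
-- to `Chart.derAt_pullback`. The uniform order comes from `exists_rightDer_order`.
include K in
theorem isDensity_derFam {u : Chart B → D.Var → D.Jet → D.Alg} (hu : IsSource u)
    {φ : Family B} (hφ : IsDensity φ) : IsDensity (derFam u φ) where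
  order := by
    obtain ⟨r, hr⟩ := hφ.order
    obtain ⟨s, hs⟩ := hu.order
    exact exists_rightDer_order (V := fun α : Chart B => α.eY.target) (fun α => α.eY.open_target) hs hr
  glue α β z hz := by
    classical
    obtain ⟨s, hs⟩ := hu.order
    choose T hT _ using K.glue α β
    -- Differentiation in the jet requires pull-backs at all jets of the overlap, not just at `z`;
    -- values off the overlap play no role.
    let T' : D.Jet → D.Alg →ₐ[ℝ] D.Alg := fun z => if h : z ∈ α.overlap β then T z h else AlgHom.id ℝ _
    have hT' : ∀ z ∈ α.overlap β, α.IsPullback β z (T' z) := fun z hz => by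
      simp only [T', dif_pos hz]
      exact hT z hz
    obtain ⟨T₀, hT₀, e⟩ := hφ.glue α β z hz
    obtain rfl := hT₀.unique (hT' z hz)
    refine ⟨T' z, hT' z hz, ?_⟩
    rw [derFam_apply, e, map_smul, derFam_apply, Chart.derAt_pullback hT' (hs α) (hu.odd α) (hs β)
      (hu.odd β) (fun z hz v => hu.glue α β z hz _ (hT' z hz) v) hz]

include K in
theorem isDensity_zero : IsDensity (0 : Family B) where
  order := ⟨0, fun _ => IsGradedFunction.zero⟩
  glue α β z hz := by
    obtain ⟨T, hT, _⟩ := K.glue α β z hz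
    exact ⟨T, hT, by simp⟩

/-- The values `Δ_{r_j}` at `c̄_{r_j}` for a single stage `j`; the other values are zero. -/
def stageSource (j : ℤ) (α : Chart B) : D.Var → D.Jet → D.Alg
  | .noether i ε r => if (i.val : ℤ) = j then K.Δ α i ε r else 0
  | _ => 0

theorem isSource_stageSource (j : ℤ) : IsSource (K.stageSource j) where
  order := by
    obtain ⟨s, hs⟩ := K.order
    refine ⟨s, fun α v => ?_⟩
    cases v with
    | noether i ε r =>
      simp only [stageSource]
      split_ifs
      · exact hs α i ε r
      · exact IsGradedFunction.zero
    | _ => exact IsGradedFunction.zero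
  odd α v z hz := by
    cases v with
    | noether i ε r =>
      simp only [stageSource]
      split_ifs
      · exact K.parity α i ε r z hz
      · exact zero_mem _
    | _ => exact zero_mem _
  glue α β z hz T hT v := by
    obtain ⟨T', hT', e⟩ := K.glue α β z hz
    obtain rfl := hT.unique hT'
    cases v with
    | noether i ε r =>
      -- The transition law of the Δ is stated with the source of δ_N, where no stage is cut off.
      have hi : (i.val : ℤ) ≤ D.N := by have := i.2; omega
      by_cases h : (i.val : ℤ) = j
      · have := e i ε r
        simp only [Chart.transl, source, hi, if_true] at this
        simp only [stageSource, Chart.transl, h, if_true]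
        exact this
      · simp [stageSource, Chart.transl, h]
    | _ => simp [stageSource, Chart.transl]

end KoszulTate

theorem IsSource.part {u : Chart B → D.Var → D.Jet → D.Alg} (hu : IsSource u) (d : ℕ →₀ ℕ) :
    IsSource fun α v z => Dims.part d (u α v z) where
  order := by
    obtain ⟨s, hs⟩ := hu.order
    exact ⟨s, fun α v => (hs α v).comp multideg d⟩
  odd α v z hz := by
    have := hu.odd α v z hz
    rw [mem_parSub] at this ⊢
    change invol (comp multideg d (u α v z)) = (-1 : ℝ) ^ (D.par v + 1) • comp multideg d (u α v z)
    rw [← comp_invol, this, comp_smul]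
  glue α β z hz T hT v := by
    change T (comp multideg d (u β v (α.prolong β z))) = _
    rw [hT.comp hz, hu.glue α β z hz T hT v]
    exact (Chart.transl_map (compL multideg d) (fun v => u α v z) z v).symm

namespace KoszulTate

variable {S : Lagrangian B} (K : KoszulTate S)

/-- The linear part of Δ_{r_k} is a multidegree component of it. Since pull-backs respect
components, it changes like the basis, too. -/
theorem linSource_eq (k : ℕ) : K.linSource k =
    fun α v z => Dims.part (Finsupp.single (k + 1) 1) (K.stageSource k α v z) := by
  funext α v
  have h0 : ∀ d, Dims.part d (0 : D.Alg) = 0 := fun d => comp_zero d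
  cases v with
  | noether i ε r =>
    by_cases h : i.val = k
    · simp [linSource, stageSource, h]
    · have h' : ¬ (i.val : ℤ) = k := by exact_mod_cast h
      simp only [linSource, stageSource, if_neg h, if_neg h', Pi.zero_apply, h0]
      rfl
  | _ => simp only [linSource, stageSource, Pi.zero_apply, h0]; rfl

theorem isSource_linSource (k : ℕ) : IsSource (K.linSource k) := by
  rw [K.linSource_eq]
  exact (K.isSource_stageSource k).part _

/-! #### Degrees of the values of the Koszul–Tate operators -/

theorem lagrangian_mem (α : Chart B) {z : D.Jet} (hz : z ∈ α.dom) :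
    S.L α z ∈ degSub multideg ({0} : Set (ℕ →₀ ℕ)) := fun d hd =>
  eq_zero_of_weight (by exact_mod_cast (S.chain.pure α z hz d hd).2) (mem_degSub_zero _ d hd)

theorem eulerSum_mem {V : Set (D.Base × D.Fib)} (hV : IsOpen V) {p : Set (ℕ →₀ ℕ)}
    {P : D.MI → D.Jet → D.Alg} (hP : ∀ Λ, ∀ z ∈ jetDom V, P Λ z ∈ degSub multideg p) {z : D.Jet}
    (hz : z ∈ jetDom V) : eulerSum P z ∈ degSub multideg p :=
  finsum_induction (· ∈ degSub multideg p) (zero_mem _) (fun _ _ => add_mem) fun Λ =>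
    Submodule.smul_mem _ _ (multi_tderiv_mem_degSub hV (hP Λ) Λ hz)

/-- Multidegrees of the values of the Koszul–Tate operators on the generating basis. -/
def sourceDeg (D : Dims) : D.Var → Set (ℕ →₀ ℕ)
  | .fieldOdd _ => ∅
  | .antiEven _ => {0}
  | .antiOdd _ => {0}
  | .noether j _ _ => pureSet ((j.val : ℤ) - 1) ((j.val : ℤ) + 1)

/-- The variational derivatives contain no antifields because the Lagrangian contains none. Every
operation in the Euler sum preserves this, default values included, so no regularity of the
Lagrangian enters. -/
theorem source_mem (k : ℤ) (α : Chart B) (v : D.Var) : ∀ z ∈ jetDom α.eY.target,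
    source S K.Δ k α v z ∈ degSub multideg (sourceDeg D v) := by
  intro z hz
  cases v with
  | fieldOdd a => exact zero_mem _
  | antiEven i =>
    refine eulerSum_mem α.eY.open_target (fun Λ z hz => ?_) hz
    refine vderiv_mem (f := S.L α) (v := (0, Pi.single i (Pi.single Λ 1))) ?_
    filter_upwards [eventually_mem_jetDom α.eY.open_target hz
      ((0, Pi.single i (Pi.single Λ 1)) : D.Jet)] with t ht
    exact lagrangian_mem α ht
  | antiOdd a =>
    refine eulerSum_mem α.eY.open_target (fun Λ z hz => ?_) hz
    have h := lpd_mem_degSub ((Var.fieldOdd a, Λ) : D.Var × D.MI) (lagrangian_mem (S := S) α hz)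
    have h0 : multideg ((Var.fieldOdd a, Λ) : D.Var × D.MI) = 0 := rfl
    simp only [h0, add_zero] at h
    exact h
  | noether j ε r =>
    simp only [source]
    split_ifs
    · exact K.pure α j ε r z hz
    · exact zero_mem _

/-- Multidegrees of the values at a single stage. -/
def stageDeg (D : Dims) (j : ℤ) : D.Var → Set (ℕ →₀ ℕ)
  | .noether i _ _ => {d | (i.val : ℤ) = j ∧ d ∈ pureSet (j - 1) (j + 1)}
  | _ => ∅

theorem stageSource_mem (j : ℤ) (α : Chart B) (v : D.Var) : ∀ z ∈ jetDom α.eY.target,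
    K.stageSource j α v z ∈ degSub multideg (stageDeg D j v) := by
  intro z hz
  cases v with
  | noether i ε r =>
    simp only [stageSource]
    split_ifs with h
    · refine degSub_le (q := stageDeg D j (.noether i ε r)) (fun d hd => ?_) (K.pure α i ε r z hz)
      exact ⟨h, by rw [← h]; exact hd⟩
    · exact zero_mem _
  | _ => exact zero_mem _

/-- For negative j there are no antifields of stage j and the operator vanishes, so the degree
condition is asked for 0 ≤ j only. This allows c̄_{r_{-1}} = s̄_A to be treated along with the other
stages. -/
theorem derAt_stageSource_mem {j : ℤ} {b : ℕ} (hb : (b : ℤ) = j + 2) {α : Chart B} {z : D.Jet}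
    (hz : z ∈ α.dom) {p r : Set (ℕ →₀ ℕ)} {x : D.Alg} (hx : x ∈ degSub multideg p)
    (h : 0 ≤ j → ∀ d, d + Finsupp.single b 1 ∈ p → ∀ e ∈ pureSet (j - 1) (j + 1), d + e ∈ r) :
    derAt (K.stageSource j α) z x ∈ degSub multideg r := by
  refine derAt_mem_degSub α.eY.open_target (K.stageSource_mem j α) hz hx fun v d hd e he => ?_
  cases v with
  | noether i ε s =>
    obtain ⟨hi, he⟩ := he
    have hib : i.val + 2 = b := by omega
    simp only [multideg, ant, hib, show b ≠ 0 by omega, if_false] at hd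
    exact h (by omega) d hd e he
  | _ => exact absurd he (Set.notMem_empty _)

/-- Replacing the factor of antifield number b by Δ_{r_j}, of antifield number b - 1 and stage ≤ j -
1, leaves s̄_A times an element of lower stage; the total is again b. -/
theorem derAt_stageSource_pure {j : ℤ} {b : ℕ} (hb : (b : ℤ) = j + 2) {α : Chart B} {z : D.Jet}
    (hz : z ∈ α.dom) {x : D.Alg}
    (hx : x ∈ degSub multideg ({Finsupp.single 1 1 + Finsupp.single b 1} : Set (ℕ →₀ ℕ))) :
    derAt (K.stageSource j α) z x ∈ degSub multideg (pureSet (j - 1) b) := by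
  refine K.derAt_stageSource_mem hb hz hx fun hj d hd e he => ?_
  obtain rfl : d = Finsupp.single 1 1 := add_right_cancel hd
  refine ⟨fun a ha => ?_, ?_⟩
  · rcases Finset.mem_union.1 (Finsupp.support_add ha) with h | h
    · have := Finset.mem_singleton.1 (Finsupp.support_single_subset h)
      omega
    · exact he.1 a h
  · have := he.2
    rw [weight_add, weight_single]
    push_cast
    omega

theorem derAt_stageSource_pure_of_single {k : ℕ} {α : Chart B} {z : D.Jet} (hz : z ∈ α.dom)
    {x : D.Alg} (hx : x ∈ degSub multideg ({Finsupp.single (k + 2) 1} : Set (ℕ →₀ ℕ))) :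
    derAt (K.stageSource k α) z x ∈ degSub multideg (pureSet ((k : ℤ) - 1) (k + 1)) := by
  refine K.derAt_stageSource_mem (b := k + 2) (by push_cast; rfl) hz hx fun _ d hd e he => ?_
  have h1 : d + Finsupp.single (k + 2) 1 = 0 + Finsupp.single (k + 2) 1 := by
    rw [zero_add]; exact hd
  obtain rfl := add_right_cancel h1
  rwa [zero_add]

/-- The operator δ̄ replaces one factor s̄_A by an expression free of antifields. -/
theorem δbar_mem {α : Chart B} {z : D.Jet} (hz : z ∈ α.dom) {p : Set (ℕ →₀ ℕ)} {x : D.Alg}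
    (hx : x ∈ degSub multideg p) : derAt (source S K.Δ (-1) α) z x ∈
      degSub multideg {d | d + Finsupp.single 1 1 ∈ p} := by
  have hu : ∀ v, ∀ z ∈ jetDom α.eY.target, source S K.Δ (-1) α v z ∈
      degSub multideg {e : ℕ →₀ ℕ | D.ant v = 1 ∧ e = 0} := by
    intro v z hz
    have h := K.source_mem (-1) α v z hz
    cases v with
    | fieldOdd a => exact zero_mem _
    | antiEven i => exact fun d hd => ⟨rfl, h d hd⟩
    | antiOdd a => exact fun d hd => ⟨rfl, h d hd⟩
    | noether j ε r =>
      have : ¬ (j.val : ℤ) ≤ -1 := by omega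
      simp only [source, if_neg this]
      exact zero_mem _
  refine derAt_mem_degSub α.eY.open_target hu hz hx fun v d hd e he => ?_
  obtain ⟨hv, rfl⟩ := he
  rw [add_zero]
  simpa [multideg, hv] using hd

/-- The operators differ only at antifields of stage greater than k, which do not occur in `x`. Each
δ_k can so be exchanged for δ_N, whose square is known to vanish. -/
theorem derAt_source_congr {k k' q : ℤ} (h : k ≤ k') {α : Chart B} {z : D.Jet}
    {x : D.Alg} (hx : x ∈ degSub multideg (pureSet k q)) :
    derAt (source S K.Δ k α) z x = derAt (source S K.Δ k' α) z x := by
  refine derAt_congr fun g hg => ?_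
  obtain ⟨v, Λ⟩ := g
  cases v with
  | noether j ε r =>
    obtain ⟨d, hd, hne⟩ := exists_of_rpd_ne_zero hx hg (by simp [ant])
    have := hd.1 _ (Finsupp.mem_support_iff.2 hne)
    simp only [ant] at this
    have h1 : (j.val : ℤ) ≤ k := by push_cast at this; omega
    simp only [source, if_pos h1, if_pos (h1.trans h)]
  | _ => rfl

theorem derAt_source_of_single {k : ℕ} {α : Chart B} {z : D.Jet} {x : D.Alg}
    (hx : x ∈ degSub multideg ({Finsupp.single (k + 2) 1} : Set (ℕ →₀ ℕ))) :
    derAt (source S K.Δ k α) z x = derAt (K.stageSource k α) z x := by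
  refine derAt_congr fun g hg => ?_
  obtain ⟨v, Λ⟩ := g
  have key : D.ant v ≠ 0 → D.ant v = k + 2 := fun h0 => by
    obtain ⟨d, rfl, hne⟩ := exists_of_rpd_ne_zero hx hg h0
    by_contra hc
    exact hne (Finsupp.single_eq_of_ne hc)
  cases v with
  | fieldOdd a => rfl
  | antiEven i => simp [ant] at key
  | antiOdd i => simp [ant] at key
  | noether j ε r =>
    have h1 : j.val = k := by simpa [ant] using key
    simp [source, stageSource, h1]

/-- Only s̄_A and the antifields of antifield number b can be differentiated. For b = 1, which is H
at stage k = 0, the second operator belongs to stage -1 and is zero. -/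
theorem derAt_source_of_add {k : ℤ} {b : ℕ} (hb : (b : ℤ) ≤ k + 2) {α : Chart B} {z : D.Jet}
    {x : D.Alg}
    (hx : x ∈ degSub multideg ({Finsupp.single 1 1 + Finsupp.single b 1} : Set (ℕ →₀ ℕ))) :
    derAt (source S K.Δ k α) z x =
      derAt (source S K.Δ (-1) α) z x + derAt (K.stageSource ((b : ℤ) - 2) α) z x := by
  refine derAt_eq_add fun g hg => ?_
  obtain ⟨v, Λ⟩ := g
  have key : D.ant v ≠ 0 → D.ant v = 1 ∨ D.ant v = b := fun h0 => by
    obtain ⟨d, rfl, hne⟩ := exists_of_rpd_ne_zero hx hg h0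
    by_contra hc
    push Not at hc
    exact hne (by rw [Finsupp.add_apply, Finsupp.single_eq_of_ne hc.1, Finsupp.single_eq_of_ne hc.2,
      add_zero])
  cases v with
  | noether j ε r =>
    right
    have h1 : j.val + 2 = b := by simpa [ant] using key
    have h2 : (j.val : ℤ) ≤ k := by omega
    have h3 : (j.val : ℤ) = (b : ℤ) - 2 := by omega
    have h4 : ¬ (j.val : ℤ) ≤ -1 := by omega
    exact ⟨by simp only [source, stageSource, if_pos h2, if_pos h3], by simp only [source, if_neg h4]⟩
  | _ => exact Or.inl ⟨rfl, rfl⟩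

/-- The coefficients of an element linear in the c̄_{r_k} are free of antifields. So the component
can be taken on the factor d_Λ Δ_{r_k}, and there it commutes with d_Λ. -/
theorem derAt_linSource {k : ℕ} {α : Chart B} {z : D.Jet} (hz : z ∈ α.dom) {x : D.Alg}
    (hx : x ∈ degSub multideg ({Finsupp.single (k + 2) 1} : Set (ℕ →₀ ℕ))) :
    derAt (K.linSource k α) z x =
      comp multideg (Finsupp.single (k + 1) 1) (derAt (K.stageSource k α) z x) := by
  refine Eq.trans ?_ (comp_derR (par := fun g : D.Var × D.MI => D.par g.1)
    (U := fun g => multi tderiv g.2 (K.stageSource k α g.1) z) _ x).symm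
  refine finsum_congr fun g => ?_
  obtain ⟨s, hs⟩ := (K.isSource_stageSource (k : ℤ)).order
  have h1 : multi tderiv g.2 (K.linSource k α g.1) z =
      comp multideg (Finsupp.single (k + 1) 1) (multi tderiv g.2 (K.stageSource k α g.1) z) := by
    rw [K.linSource_eq]
    exact multi_tderiv_map α.eY.open_target (hs α g.1) (compL multideg _)
      (fun l x => shiftDer_comp l _ x) g.2 hz
  change rpd g x * multi tderiv g.2 (K.linSource k α g.1) z = _
  rw [h1]
  by_cases hg : rpd g x = 0
  · simp [hg]
  by_cases hk : D.ant g.1 = k + 2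
  · refine (comp_mul_of_mem ?_ _ _).symm
    refine degSub_le ?_ (rpd_mem_degSub g hx)
    intro d hd
    have h2 : d + Finsupp.single (k + 2) 1 = 0 + Finsupp.single (k + 2) 1 := by
      rw [zero_add]
      simpa [multideg, hk] using hd
    exact add_right_cancel h2
  · have h0 : K.stageSource k α g.1 = 0 := by
      obtain ⟨v, Λ⟩ := g
      cases v with
      | noether j ε r =>
        have : ¬ (j.val : ℤ) = k := fun h => hk (by simp only [ant]; omega)
        simp only [stageSource, if_neg this]
      | _ => rfl
    rw [h0, multi_tderiv_zero, comp_zero, mul_zero, comp_zero]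

theorem δ_δ {k q : ℤ} (hk : k ≤ D.N) {α : Chart B} {z : D.Jet} (hz : z ∈ α.dom) {x : D.Alg}
    (hx : x ∈ degSub multideg (pureSet k q)) :
    derAt (source S K.Δ D.N α) z (derAt (source S K.Δ k α) z x) = 0 := by
  rw [K.derAt_source_congr hk hx]
  exact K.nilpotent α (fun _ => x) z hz

end KoszulTate

/-! ### Arithmetic of multidegrees and the summands G and H -/

theorem le_weight {d : ℕ →₀ ℕ} {a : ℕ} (h : d a ≠ 0) : a ≤ weight d :=
  (Nat.le_mul_of_pos_right a (Nat.pos_of_ne_zero h)).trans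
    (Finset.single_le_sum (f := fun a => a * d a) (fun _ _ => Nat.zero_le _)
      (Finsupp.mem_support_iff.2 h))

/-- The numbers of factors differ, one against two. This separates G from H. -/
theorem single_ne_single_add_single (a b c : ℕ) :
    Finsupp.single a 1 ≠ (Finsupp.single b 1 + Finsupp.single c 1 : ℕ →₀ ℕ) := by
  intro h
  have := congrArg (fun d : ℕ →₀ ℕ => d.sum fun _ n => n) h
  simp only [Finsupp.sum_add_index' (h := fun _ n => n) (fun _ => rfl) fun _ _ _ => rfl,
    Finsupp.sum_single_index (h := fun _ n => n) rfl] at this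
  omega

/-- If a product is linear in antifields and one factor has positive antifield number, that factor
carries the only antifield. -/
theorem eq_zero_of_add_eq_single {d e : ℕ →₀ ℕ} {a : ℕ} (ha : a ≠ 0)
    (h : d + e = Finsupp.single a 1) (he : weight e ≠ 0) : d = 0 := by
  obtain ⟨b, hb⟩ : ∃ b, e b ≠ 0 := by
    by_contra hc
    push Not at hc
    exact he (by rw [show e = 0 from Finsupp.ext hc]; rfl)
  have h1 : b = a := by
    by_contra hne
    have := DFunLike.congr_fun h b
    rw [Finsupp.add_apply, Finsupp.single_eq_of_ne hne] at this
    omega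
  subst h1
  have h2 := congrArg weight h
  rw [weight_add, weight_single] at h2
  have h3 := le_weight hb
  have h4 := DFunLike.congr_fun h 0
  rw [Finsupp.add_apply, Finsupp.single_eq_of_ne (Ne.symm ha)] at h4
  exact eq_zero_of_weight (by omega) (by omega)

theorem Gpart_mem (k : ℕ) (φ : Family B) (α : Chart B) (z : D.Jet) :
    Gpart k φ α z ∈ degSub multideg ({Finsupp.single (k + 2) 1} : Set (ℕ →₀ ℕ)) :=
  comp_mem_degSub _ _

theorem Hpart_mem (k : ℕ) (φ : Family B) (α : Chart B) (z : D.Jet) :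
    Hpart k φ α z ∈
      degSub multideg ({Finsupp.single 1 1 + Finsupp.single (k + 1) 1} : Set (ℕ →₀ ℕ)) :=
  comp_mem_degSub _ _

theorem IsChain.part {k q : ℤ} {φ : Family B} (hφ : IsChain k q φ) (d : ℕ →₀ ℕ) :
    IsChain k q (φ.part d) where
  density := hφ.density.part d
  pure α z hz := by
    rw [isPure_iff]
    by_cases hd : d ∈ pureSet k q
    · exact degSub_le (Set.singleton_subset_iff.2 hd) (comp_mem_degSub d (φ α z))
    · have : φ.part d α z = 0 := comp_of_not_mem (hφ.pure α z hz) hd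
      rw [this]
      exact zero_mem _

theorem IsChain.add {k q : ℤ} {φ ψ : Family B} (hφ : IsChain k q φ) (hψ : IsChain k q ψ) :
    IsChain k q (φ + ψ) where
  density := hφ.density.add hψ.density
  pure α z hz := add_mem (isPure_iff.1 (hφ.pure α z hz)) (isPure_iff.1 (hψ.pure α z hz))

/-! ### Noether identities and cycles: the three statements -/

namespace KoszulTate

variable {S : Lagrangian B} (K : KoszulTate S)

/-- The part of `δ_k φ` that is linear in the antifields of stage `k - 1` is the left-hand side of
the Noether identity. -/
theorem comp_δ {k : ℕ} {α : Chart B} {z : D.Jet} (hz : z ∈ α.dom) {x : D.Alg}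
    (hx : x ∈ degSub multideg (pureSet k (k + 2))) :
    comp multideg (Finsupp.single (k + 1) 1) (derAt (source S K.Δ k α) z x) =
      derAt (K.linSource k α) z (comp multideg (Finsupp.single (k + 2) 1) x) +
      derAt (source S K.Δ (-1) α) z
        (comp multideg (Finsupp.single 1 1 + Finsupp.single (k + 1) 1) x) := by
  set G := comp multideg (Finsupp.single (k + 2) 1) x with hG
  set H := comp multideg (Finsupp.single 1 1 + Finsupp.single (k + 1) 1) x with hH
  have hGm : G ∈ degSub multideg ({Finsupp.single (k + 2) 1} : Set (ℕ →₀ ℕ)) := comp_mem_degSub _ _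
  have hHm : H ∈ degSub multideg
      ({Finsupp.single 1 1 + Finsupp.single (k + 1) 1} : Set (ℕ →₀ ℕ)) := comp_mem_degSub _ _
  have hR := sub_comp_mem_degSub (sub_comp_mem_degSub hx (Finsupp.single (k + 2) 1))
    (Finsupp.single 1 1 + Finsupp.single (k + 1) 1)
  have hHG : comp multideg (Finsupp.single 1 1 + Finsupp.single (k + 1) 1) G = 0 :=
    comp_of_not_mem hGm fun h => single_ne_single_add_single (k + 2) 1 (k + 1) h.symm
  rw [← hG, comp_sub, ← hH, hHG, sub_zero] at hR
  -- The remainder has no component of the multidegrees of G and H. It is to be seen that no other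
  -- multidegree can produce a term linear in the antifields of stage k - 1.
  have hδR : comp multideg (Finsupp.single (k + 1) 1)
      (derAt (source S K.Δ k α) z (x - G - H)) = 0 := by
    refine comp_of_not_mem (p := {d | d ≠ Finsupp.single (k + 1) 1})
      (derAt_mem_degSub α.eY.open_target (K.source_mem k α) hz hR fun v d hd e he hde => ?_)
      fun h => h rfl
    obtain ⟨⟨hd1, hd2⟩, hd3⟩ := hd
    -- If an s̄_A was replaced by an antifield-free value, the term had one further antifield, of
    -- antifield number k + 1, and so belonged to H.
    have anti : ∀ e ∈ ({0} : Set (ℕ →₀ ℕ)), multideg (v, (0 : D.MI)) = Finsupp.single 1 1 →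
        d + e = Finsupp.single (k + 1) 1 → False := by
      rintro _ rfl hv h
      rw [add_zero] at h
      rw [hv, h, add_comm] at hd3
      exact hd3 rfl
    cases v with
    | fieldOdd a => exact he
    | antiEven i => exact anti e he rfl hde
    | antiOdd i => exact anti e he rfl hde
    | noether j ε r =>
      -- The inserted Δ has positive antifield number, so it carries the only antifield of the
      -- result and the replaced factor stood alone. Antifield number k + 2 then forces j = k, so
      -- the term belonged to G.
      have hw := he.2
      have hd0 := eq_zero_of_add_eq_single (by omega) hde (by omega)
      subst hd0
      have hm : multideg (Var.noether j ε r, (0 : D.MI)) = Finsupp.single (j.val + 2) 1 := by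
        simp [multideg, ant]
      rw [zero_add, hm] at hd1 hd2
      have hd4 := hd1.2
      rw [weight_single] at hd4
      have hjk : j.val = k := by push_cast at hd4; omega
      exact hd2 (by rw [hjk]; rfl)
  have hδG : comp multideg (Finsupp.single (k + 1) 1) (derAt (source S K.Δ k α) z G) =
      derAt (K.linSource k α) z G := by
    rw [K.derAt_source_of_single hGm, K.derAt_linSource hz hGm]
  have hδH : comp multideg (Finsupp.single (k + 1) 1) (derAt (source S K.Δ k α) z H) =
      derAt (source S K.Δ (-1) α) z H := by
    -- Of the two contributions to δ_k H, the one of δ̄ lies wholly in the wanted component, while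
    -- the other involves only stages ≤ k - 2.
    rw [K.derAt_source_of_add (b := k + 1) (by push_cast; omega) hHm, comp_add]
    have h1 := K.δbar_mem hz hHm
    have h2 := K.derAt_stageSource_pure (j := ((k + 1 : ℕ) : ℤ) - 2) (b := k + 1) (by omega) hz hHm
    rw [comp_of_mem (degSub_le (fun d hd => add_right_cancel
      (show d + Finsupp.single 1 1 = Finsupp.single (k + 1) 1 + Finsupp.single 1 1 by
        rw [add_comm (Finsupp.single (k + 1) 1)]; exact hd)) h1), comp_of_not_mem h2, add_zero]
    intro h
    have := h.1 (k + 1) (by simp)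
    push_cast at this
    omega
  have hsum : x = G + H + (x - G - H) := by abel
  rw [hsum, map_add, map_add, comp_add, comp_add, hδR, hδG, hδH, add_zero]

theorem isNoetherIdentity_of_isCycle {k : ℕ} {φ : Family B} (hφ : IsChain k (k + 2) φ)
    (hc : K.IsCycle k φ) : K.IsNoetherIdentity k φ := by
  intro α z hz
  have h := K.comp_δ hz (isPure_iff.1 (hφ.pure α z hz))
  rw [← K.δ_apply, hc α z hz] at h
  exact h.symm.trans (comp_zero _)

theorem exists_cycle_of_isNoetherIdentity (hreg : K.HomologyRegular) {k : ℕ} (hk : k ≤ D.N)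
    {φ : Family B} (hφ : IsChain k (k + 2) φ) (hN : K.IsNoetherIdentity k φ) :
    ∃ ψ : Family B, IsChain ((k : ℤ) - 1) (k + 2) ψ ∧
      Same ((K.δ k ψ).part (Finsupp.single (k + 1) 1)) 0 ∧
      K.IsCycle k (Gpart k φ + Hpart k φ - ψ) := by
  have hG : IsChain k (k + 2) (Gpart k φ) := hφ.part _
  have hH : IsChain k (k + 2) (Hpart k φ) := hφ.part _
  -- This is δ_k(G + H) with the terms that cancel by (*) left out. It involves only derivations
  -- known to preserve global densities, δ̄ having disappeared.
  set σ : Family B := derFam (K.stageSource k) (Gpart k φ) - derFam (K.linSource k) (Gpart k φ) +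
    derFam (K.stageSource (((k + 1 : ℕ) : ℤ) - 2)) (Hpart k φ) with hσ
  have hσδ : ∀ (α : Chart B), ∀ z ∈ α.dom, σ α z = K.δ k (Gpart k φ + Hpart k φ) α z := by
    intro α z hz
    have h1 : derAt (K.linSource k α) z (Gpart k φ α z) +
        derAt (source S K.Δ (-1) α) z (Hpart k φ α z) = 0 := hN α z hz
    have h2 := K.derAt_source_of_single (α := α) (z := z) (Gpart_mem k φ α z)
    have h3 := K.derAt_source_of_add (k := k) (b := k + 1) (by push_cast; omega) (α := α) (z := z)
      (Hpart_mem k φ α z)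
    have h4 : K.δ k (Gpart k φ + Hpart k φ) α z = derAt (source S K.Δ k α) z (Gpart k φ α z) +
        derAt (source S K.Δ k α) z (Hpart k φ α z) := by
      rw [δ_apply, Pi.add_apply, Pi.add_apply, map_add]
    have h5 : σ α z = derAt (K.stageSource k α) z (Gpart k φ α z) -
        derAt (K.linSource k α) z (Gpart k φ α z) +
        derAt (K.stageSource (((k + 1 : ℕ) : ℤ) - 2) α) z (Hpart k φ α z) := rfl
    rw [h4, h2, h3, h5, eq_neg_of_add_eq_zero_left h1]
    abel
  -- Subtracting the linear part of Δ_{r_k} removes the only terms of the first contribution with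
  -- antifields of stage k - 1; the second contribution has none.
  have hpure : ∀ (α : Chart B), ∀ z ∈ α.dom,
      σ α z ∈ degSub multideg (pureSet ((k : ℤ) - 2) (k + 1)) := by
    intro α z hz
    refine add_mem ?_ ?_
    · have h1 := K.derAt_stageSource_pure_of_single hz (Gpart_mem k φ α z)
      have h2 := sub_comp_mem_degSub h1 (Finsupp.single (k + 1) 1)
      rw [← K.derAt_linSource hz (Gpart_mem k φ α z)] at h2
      intro d hd
      obtain ⟨h3, h4⟩ := h2 d hd
      have h5 := mem_pureSet_of_ne_single (k := (k : ℤ) - 1) (b := k + 1) (by push_cast; omega)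
        (by exact_mod_cast h3) (mem_degSub_zero _ d hd) h4
      rw [show (k : ℤ) - 1 - 1 = k - 2 by ring] at h5
      exact_mod_cast h5
    · have h1 := K.derAt_stageSource_pure (j := ((k + 1 : ℕ) : ℤ) - 2) (b := k + 1) (by omega) hz
        (Hpart_mem k φ α z)
      rw [show ((k + 1 : ℕ) : ℤ) - 2 - 1 = (k : ℤ) - 2 by push_cast; ring] at h1
      exact_mod_cast h1
  -- Homology regularity starts at stage -1, so k = 0 is separate: stage ≤ -2 leaves no antifields,
  -- which contradicts antifield number 1 unless the element is zero.
  by_cases hk0 : k = 0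
  · have hzero : ∀ (α : Chart B), ∀ z ∈ α.dom, σ α z = 0 := by
      intro α z hz
      rw [← sum_comp (deg := multideg) (σ α z)]
      refine Finset.sum_eq_zero fun d _ => comp_of_not_mem (hpure α z hz) fun hd => ?_
      have h1 : weight d ≠ 0 := by have := hd.2; omega
      refine h1 (Finset.sum_eq_zero fun a ha => ?_)
      have := hd.1 a ha
      rw [show a = 0 by omega]
      exact zero_mul _
    refine ⟨0, ⟨K.isDensity_zero, fun α z _ => zero_mem (degSub multideg _)⟩, fun α z _ => ?_, ?_⟩
    · change comp multideg _ (derAt _ z 0) = 0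
      rw [map_zero, comp_zero]
    · intro α z hz
      rw [sub_zero, ← hσδ α z hz, hzero α z hz]
      rfl
  · have hdens : IsDensity σ := ((K.isDensity_derFam (K.isSource_stageSource _) hG.density).sub
      (K.isDensity_derFam (K.isSource_linSource _) hG.density)).add
      (K.isDensity_derFam (K.isSource_stageSource _) hH.density)
    -- On elements of such low stage δ_{k-2} is δ_N, and σ is a value of δ_k on a chain of stage k.
    have hcyc : K.IsCycle ((k : ℤ) - 2) σ := by
      intro α z hz
      rw [δ_apply, K.derAt_source_congr (k' := D.N) (by omega) (hpure α z hz), hσδ α z hz]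
      exact K.δ_δ (by omega) hz (isPure_iff.1 ((hG.add hH).pure α z hz))
    obtain ⟨ψ, hψ, hb⟩ := hreg ((k : ℤ) - 2) (by omega) (by omega) σ
      ⟨hdens, fun α z hz => by
        rw [isPure_iff, show (k : ℤ) - 2 + 3 = k + 1 by ring]; exact hpure α z hz⟩ hcyc
    rw [show (k : ℤ) - 2 + 1 = k - 1 by ring] at hψ hb
    rw [show (k : ℤ) - 2 + 3 + 1 = k + 2 by ring] at hψ
    have hψδ : ∀ (α : Chart B), ∀ z ∈ α.dom, K.δ k ψ α z = σ α z := by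
      intro α z hz
      rw [hb α z hz, δ_apply, δ_apply,
        K.derAt_source_congr (k := (k : ℤ) - 1) (k' := k) (by omega) (isPure_iff.1 (hψ.pure α z hz))]
    refine ⟨ψ, hψ, fun α z hz => ?_, fun α z hz => ?_⟩
    -- The boundary equals σ, whose stages are ≤ k - 2, so it has no term linear in the antifields
    -- of stage k - 1.
    · change comp multideg _ (K.δ k ψ α z) = 0
      rw [hψδ α z hz]
      refine comp_of_not_mem (hpure α z hz) fun hd => ?_
      have := hd.1 (k + 1) (by simp)
      push_cast at this
      omega
    · have h1 : K.δ k (Gpart k φ + Hpart k φ - ψ) α z =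
          K.δ k (Gpart k φ + Hpart k φ) α z - K.δ k ψ α z := by
        rw [δ_apply, Pi.sub_apply, Pi.sub_apply, map_sub]
        rfl
      rw [h1, hψδ α z hz, hσδ α z hz, sub_self]
      rfl

theorem isBoundary_of_isTrivialIdentity (hreg : K.HomologyRegular) {k : ℕ} (hk : k ≤ D.N)
    {φ : Family B} (hφ : IsChain k (k + 2) φ) (hc : K.IsCycle k φ) (ht : K.IsTrivialIdentity k φ) :
    K.IsBoundary k (k + 2) φ := by
  rcases ht with h | ⟨ψ₀, hψ₀, hGψ₀⟩
  · exact h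
  -- As δ̄ removes exactly one s̄_A and G is linear in the c̄_{r_k}, only this component of `ψ₀`
  -- contributes to G.
  set ψ : Family B := ψ₀.part (Finsupp.single 1 1 + Finsupp.single (k + 2) 1) with hψ
  have hψc : IsChain k (k + 3) ψ := hψ₀.part _
  have hψm : ∀ (α : Chart B) (z : D.Jet), ψ α z ∈ degSub multideg
      ({Finsupp.single 1 1 + Finsupp.single (k + 2) 1} : Set (ℕ →₀ ℕ)) :=
    fun α z => comp_mem_degSub _ _
  have hGψ : ∀ (α : Chart B), ∀ z ∈ α.dom,
      derAt (source S K.Δ (-1) α) z (ψ α z) = Gpart k φ α z := by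
    intro α z hz
    have h1 := comp_map_of_shift (deg := multideg) (derAt (source S K.Δ (-1) α) z)
      (Finsupp.single 1 1)
      (fun L => K.δbar_mem hz (mono_mem_degSub (p := {(L.map multideg).sum}) rfl))
      (Finsupp.single (k + 2) 1) (ψ₀ α z)
    have h2 : derAt (source S K.Δ (-1) α) z (ψ₀ α z) = Gpart k φ α z := (hGψ₀ α z hz).symm
    rw [h2, comp_of_mem (Gpart_mem k φ α z), add_comm] at h1
    exact h1.symm
  -- By G = δ̄ψ this is Φ - δ_k ψ, written so that it is visibly global and free of antifields of
  -- stage k.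
  set σ : Family B := φ - Gpart k φ - derFam (K.stageSource k) ψ with hσ
  have hδψ : ∀ (α : Chart B), ∀ z ∈ α.dom, σ α z = φ α z - K.δ k ψ α z := by
    intro α z hz
    have h1 := K.derAt_source_of_add (k := k) (b := k + 2) (by push_cast; omega) (α := α) (z := z)
      (hψm α z)
    rw [hGψ α z hz, show ((k + 2 : ℕ) : ℤ) - 2 = k by push_cast; ring] at h1
    rw [δ_apply, h1, ← sub_sub]
    rfl
  have hpure : ∀ (α : Chart B), ∀ z ∈ α.dom,
      σ α z ∈ degSub multideg (pureSet ((k : ℤ) - 1) (k + 2)) := by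
    intro α z hz
    refine sub_mem ?_ ?_
    · have h2 := sub_comp_mem_degSub (isPure_iff.1 (hφ.pure α z hz)) (Finsupp.single (k + 2) 1)
      intro d hd
      obtain ⟨h3, h4⟩ := h2 d hd
      have h5 := mem_pureSet_of_ne_single (k := (k : ℤ)) (b := k + 2) (by push_cast; omega)
        (by exact_mod_cast h3) (mem_degSub_zero _ d hd) h4
      exact_mod_cast h5
    · have h1 := K.derAt_stageSource_pure (j := (k : ℤ)) (b := k + 2) (by push_cast; omega) hz
        (hψm α z)
      exact_mod_cast h1
  have hdens : IsDensity σ := (hφ.density.sub (hφ.density.part _)).sub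
    (K.isDensity_derFam (K.isSource_stageSource _) hψc.density)
  have hcyc : K.IsCycle ((k : ℤ) - 1) σ := by
    intro α z hz
    have h1 : derAt (source S K.Δ D.N α) z (φ α z) = 0 := by
      rw [← K.derAt_source_congr (k := k) (by omega) (isPure_iff.1 (hφ.pure α z hz))]
      exact hc α z hz
    have h2 := K.δ_δ (k := k) (by omega) hz (isPure_iff.1 (hψc.pure α z hz))
    rw [δ_apply, K.derAt_source_congr (k' := D.N) (by omega) (hpure α z hz), hδψ α z hz, map_sub, h1,
      δ_apply, h2, sub_zero]
    rfl
  -- Regularity at stage k - 1, which is at least -1, gives a primitive of stage k; adding ψ to it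
  -- yields the primitive of Φ.
  obtain ⟨χ, hχ, hb⟩ := hreg ((k : ℤ) - 1) (by omega) (by omega) σ
    ⟨hdens, fun α z hz => by
      rw [isPure_iff, show (k : ℤ) - 1 + 3 = k + 2 by ring]; exact hpure α z hz⟩ hcyc
  rw [show (k : ℤ) - 1 + 1 = k by ring] at hχ hb
  rw [show (k : ℤ) - 1 + 3 + 1 = k + 3 by ring] at hχ
  refine ⟨ψ + χ, ?_, fun α z hz => ?_⟩
  · rw [show (k : ℤ) + 2 + 1 = k + 3 by ring]
    exact hψc.add hχ
  · have h1 : K.δ k (ψ + χ) α z = K.δ k ψ α z + K.δ k χ α z := by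
      rw [δ_apply, Pi.add_apply, Pi.add_apply, map_add]
      rfl
    rw [h1, ← hb α z hz, hδψ α z hz]
    abel

end KoszulTate

end GradedLagrangian

end

theorem mainTheorem12 {D : GradedLagrangian.Dims} {X Y : Type*}
    [TopologicalSpace X] [ChartedSpace D.Base X] [IsManifold 𝓘(ℝ, D.Base) ∞ X]
    [TopologicalSpace Y] [ChartedSpace (D.Base × D.Fib) Y]
    [IsManifold 𝓘(ℝ, D.Base × D.Fib) ∞ Y]
    (B : GradedLagrangian.Bundles D X Y) (S : GradedLagrangian.Lagrangian B)
    (K : GradedLagrangian.KoszulTate S) (hreg : K.HomologyRegular) (k : ℕ) (hk : k ≤ D.N) :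
    -- each cycle yields a Noether identity
    (∀ φ : GradedLagrangian.Family B, GradedLagrangian.IsChain k (k + 2) φ →
      K.IsCycle k φ → K.IsNoetherIdentity k φ) ∧
    -- each Noether identity extends to the cycle condition of `G + H - ψ`
    (∀ φ : GradedLagrangian.Family B, GradedLagrangian.IsChain k (k + 2) φ →
      K.IsNoetherIdentity k φ →
      ∃ ψ : GradedLagrangian.Family B, GradedLagrangian.IsChain ((k : ℤ) - 1) (k + 2) ψ ∧
        GradedLagrangian.Same ((K.δ k ψ).part (Finsupp.single (k + 1) 1)) 0 ∧
        K.IsCycle k (GradedLagrangian.Gpart k φ + GradedLagrangian.Hpart k φ - ψ)) ∧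
    -- trivial Noether identities are boundaries
    (∀ φ : GradedLagrangian.Family B, GradedLagrangian.IsChain k (k + 2) φ →
      K.IsCycle k φ → K.IsTrivialIdentity k φ → K.IsBoundary k (k + 2) φ) :=
  ⟨fun _ hφ hc => K.isNoetherIdentity_of_isCycle hφ hc,
    fun _ hφ hN => K.exists_cycle_of_isNoetherIdentity hreg hk hφ hN,
    fun _ hφ hc ht => K.isBoundary_of_isTrivialIdentity hreg hk hφ hc ht⟩
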